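/- Let $n\ge 2$ and let $S\subset\mathbb{R}^n$ be a compact smooth hypersurface (possibly with boundary) which is the graph of a smooth function over a compact subset of a hyperplane. Let $N$ be its unit normal, $T_uS=N(u)^\perp$ its tangent space at $u$, $\sigma$ its surface measure, and $L^p(S)=L^p(S,\sigma)$. Assume that $S$ is strictly convex, in the sense that its shape operator $\mathrm{d}N_u:T_uS\to T_uS$ is positive definite for every $u\in S$ and that the Gauss map $N$ is injective on $S$; that $N(S)$ is geodesically convex, i.e. its intersection with every great circle is connected (possibly empty); and that $N(u)\cdot N(u')\ge\frac12$ for all $u,u'\in S$. Let $Q(S)$ be the smallest constant $c$ such that $\lambda_j(u)\le c\,\lambda_k(u')$ for all $u,u'\in S$ and $1\le j,k\le n-1$, where $\lambda_1(u),\dots,\lambda_{n-1}(u)$ are the principal curvatures of $S$ at $u$ (the eigenvalues of $\mathrm{d}N_u$). For $u,u'\in S$ with $u'\ne u$ let $R_uu'$ be the unique point $u''\in S$ with $u''\neq u'$, if there is one, such that $(u'-u'')\cdot N(u)=0$ and $N(u)\wedge N(u')\wedge N(u'')=0$; put $R_uu=u$. Let $J(u,u')$ be the Jacobian factor of the map $u\mapsto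 R_uu'$ with respect to $\sigma$, so that for each fixed $u'\in S$ $$\int\Phi(R_uu')\,J(u,u')\,\mathrm{d}\sigma(u)=\int\Phi\,\mathrm{d}\sigma ,$$ where the left integral is over those $u\in S$ for which $R_uu'$ exists and the right integral is over the set of the corresponding points $R_uu'$. Define $$I_{S,s}(g_1,g_2)(u):=\int\frac{g_1(u')\,g_2(R_uu')}{|u'-R_uu'|^{s}}\,J(u,u')\,\mathrm{d}\sigma(u'),$$ the integral being over those $u'\in S$ for which $R_uu'$ exists. **Theorem.** Let $0<s<n-1$ and $q\in[\frac12,1]$. Then there is a constant $C$, depending only on $n$, $s$, $q$ and the diameter of $S$, such that for every $S$ as above and all complex-valued $g_1,g_2\in L^{2q}(S)$, the integral defining $I_{S,s}(g_1,g_2)(u)$ converges absolutely for $\sigma$-almost every $u\in S$, the function $I_{S,s}(g_1,g_2)$ is $\sigma$-measurable, and $$\|I_{S,s}(g_1,g_2)\|_{L^q(S)}\le C\,Q(S)^{2(n-1)}\,\|g_1\|_{L^{2q}(S)}\,\|g_2\|_{L^{2q}(S)}.$$ -/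

import Mathlib

open MeasureTheory
open scoped ENNReal NNReal ContDiff RealInnerProductSpace

noncomputable section

/-- A compact smooth hypersurface of `ℝⁿ` (possibly with boundary) that is a graph: the points
`frame x + φ x • e`, with `x` in a compact set `D` of `ℝⁿ⁻¹`, where `e` is a unit vector, `frame`
identifies `ℝⁿ⁻¹` isometrically with the hyperplane orthogonal to `e`, and `φ` is smooth on a
neighbourhood of `D`. -/
structure GraphHypersurface (n : ℕ) where
  e : EuclideanSpace ℝ (Fin n)
  frame : EuclideanSpace ℝ (Fin (n - 1)) →ₗᵢ[ℝ] EuclideanSpace ℝ (Fin n)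
  D : Set (EuclideanSpace ℝ (Fin (n - 1)))
  φ : EuclideanSpace ℝ (Fin (n - 1)) → ℝ
  norm_e : ‖e‖ = 1
  frame_orthogonal : ∀ x, ⟪frame x, e⟫ = 0
  isCompact_D : IsCompact D
  D_subset : D ⊆ closure (interior D)
  smooth : ∃ U, IsOpen U ∧ D ⊆ U ∧ ContDiffOn ℝ ∞ φ U

namespace GraphHypersurface

variable {n : ℕ} (S : GraphHypersurface n)

/-- The graph parametrisation. -/
def param (x : EuclideanSpace ℝ (Fin (n - 1))) : EuclideanSpace ℝ (Fin n) :=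
  S.frame x + S.φ x • S.e

/-- The hypersurface as a set of points of `ℝⁿ`. -/
def carrier : Set (EuclideanSpace ℝ (Fin n)) := S.param '' S.D

/-- The graph coordinates of a point: the adjoint of `frame`, so that `coord (param x) = x`. -/
def coord : EuclideanSpace ℝ (Fin n) →L[ℝ] EuclideanSpace ℝ (Fin (n - 1)) :=
  ContinuousLinearMap.adjoint S.frame.toContinuousLinearMap

/-- The area element `(1 + |∇φ|²)^(1/2)` of the graph. -/
def areaElement (x : EuclideanSpace ℝ (Fin (n - 1))) : ℝ :=
  √(1 + ‖gradient S.φ x‖ ^ 2)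

/-- The surface measure `σ`, as a measure on `ℝⁿ` carried by the hypersurface. -/
def surfaceMeasure : Measure (EuclideanSpace ℝ (Fin n)) :=
  ((volume.restrict S.D).withDensity fun x => ENNReal.ofReal (S.areaElement x)).map S.param

/-- The Gauss map `u ↦ N(u)`: the unit normal that is outward when `φ` is convex. It is extended
to a neighbourhood of the hypersurface so as to be constant in the direction `e`; only its values
at points of the hypersurface and its derivatives in tangential directions are used. -/
def gaussMap (u : EuclideanSpace ℝ (Fin n)) : EuclideanSpace ℝ (Fin n) :=
  (S.areaElement (S.coord u))⁻¹ • (S.frame (gradient S.φ (S.coord u)) - S.e)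

/-- The tangent space `T_u S`, the hyperplane orthogonal to `N(u)`. -/
def tangentSpace (u : EuclideanSpace ℝ (Fin n)) : Submodule ℝ (EuclideanSpace ℝ (Fin n)) :=
  (Submodule.span ℝ {S.gaussMap u})ᗮ

/-- `κ` is a principal curvature at `u`: an eigenvalue of the shape operator `dN_u` on `T_u S`. -/
def IsPrincipalCurvature (u : EuclideanSpace ℝ (Fin n)) (κ : ℝ) : Prop :=
  ∃ w ∈ S.tangentSpace u, w ≠ 0 ∧ fderiv ℝ S.gaussMap u w = κ • w

/-- The curvature quotient `Q(S)`: the least `c` such that `κ ≤ c κ'` for all principal curvatures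
`κ`, `κ'` at any two points of the hypersurface. -/
def curvatureQuotient : ℝ :=
  sInf {c : ℝ | ∀ u ∈ S.carrier, ∀ u' ∈ S.carrier, ∀ κ κ' : ℝ,
    S.IsPrincipalCurvature u κ → S.IsPrincipalCurvature u' κ' → κ ≤ c * κ'}

/-- The standing assumptions on the hypersurface. -/
structure IsAdmissible : Prop where
  /-- Strict convexity: the shape operator is positive definite at every point. -/
  shape_posDef : ∀ u ∈ S.carrier, ∀ w ∈ S.tangentSpace u, w ≠ 0 →
    0 < ⟪fderiv ℝ S.gaussMap u w, w⟫
  /-- The Gauss map is injective. -/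
  injOn_gaussMap : Set.InjOn S.gaussMap S.carrier
  /-- The set of normals is geodesically convex: it meets every great circle in a connected
  (possibly empty) set. -/
  geodesicallyConvex : ∀ W : Submodule ℝ (EuclideanSpace ℝ (Fin n)), Module.finrank ℝ W = 2 →
    IsPreconnected (S.gaussMap '' S.carrier ∩ (W : Set (EuclideanSpace ℝ (Fin n))))
  /-- The normals lie in a cone of fixed aperture. -/
  cone : ∀ u ∈ S.carrier, ∀ u' ∈ S.carrier, 1 / 2 ≤ ⟪S.gaussMap u, S.gaussMap u'⟫

/-- The conditions that define `u'' = R_u u'` for `u' ≠ u`: `u''` is a point of the hypersurface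
other than `u'` with `(u' - u'') · N(u) = 0` and `N(u) ∧ N(u') ∧ N(u'') = 0`. -/
def IsReflection (u u' u'' : EuclideanSpace ℝ (Fin n)) : Prop :=
  u'' ∈ S.carrier ∧ u'' ≠ u' ∧ ⟪u' - u'', S.gaussMap u⟫ = 0 ∧
    ¬ LinearIndependent ℝ ![S.gaussMap u, S.gaussMap u', S.gaussMap u'']

/-- The set of the points `u'` of the hypersurface for which `R_u u'` exists. -/
def reflectionDomain (u : EuclideanSpace ℝ (Fin n)) : Set (EuclideanSpace ℝ (Fin n)) :=
  {u' | u' ∈ S.carrier ∧ (u' = u ∨ ∃ u'', S.IsReflection u u' u'')}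

open Classical in
/-- The map `(u, u') ↦ R_u u'`, with `R_u u = u`; outside the domain the value is irrelevant. -/
def reflection (u u' : EuclideanSpace ℝ (Fin n)) : EuclideanSpace ℝ (Fin n) :=
  if u' = u then u
  else if h : ∃ u'', S.IsReflection u u' u'' then h.choose else u'

/-- The map `u ↦ R_u u'` in graph coordinates, for a fixed `u'`. -/
def reflectionInCoord (u' : EuclideanSpace ℝ (Fin n)) (x : EuclideanSpace ℝ (Fin (n - 1))) :
    EuclideanSpace ℝ (Fin (n - 1)) :=
  S.coord (S.reflection (S.param x) u')

/-- The domain of the map `u ↦ R_u u'` in graph coordinates, for a fixed `u'`. -/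
def reflectionInCoordDomain (u' : EuclideanSpace ℝ (Fin n)) :
    Set (EuclideanSpace ℝ (Fin (n - 1))) :=
  {x | x ∈ S.D ∧ u' ∈ S.reflectionDomain (S.param x)}

/-- The Jacobian factor `J(u, u')` of `u ↦ R_u u'` with respect to the surface measure, that is
`∫ Φ(R_u u') J(u, u') dσ(u) = ∫ Φ dσ` (over the range of `u ↦ R_u u'`) for each fixed `u'`. -/
def jacobian (u u' : EuclideanSpace ℝ (Fin n)) : ℝ :=
  |(fderivWithin ℝ (S.reflectionInCoord u') (S.reflectionInCoordDomain u') (S.coord u)).det| *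
    (S.areaElement (S.coord (S.reflection u u')) / S.areaElement (S.coord u))

/-- The integrand `g₁(u') g₂(R_u u') |u' - R_u u'|^(-s) J(u, u')`. -/
def fractionalIntegrand (s : ℝ) (g₁ g₂ : EuclideanSpace ℝ (Fin n) → ℂ)
    (u u' : EuclideanSpace ℝ (Fin n)) : ℂ :=
  g₁ u' * g₂ (S.reflection u u') / ((‖u' - S.reflection u u'‖ ^ s : ℝ) : ℂ) *
    ((S.jacobian u u' : ℝ) : ℂ)

/-- The surface-carried bilinear fractional integral `I_{S,s}(g₁, g₂)(u)`, the integral being over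
the points `u'` of the hypersurface for which `R_u u'` exists. -/
def fractionalIntegral (s : ℝ) (g₁ g₂ : EuclideanSpace ℝ (Fin n) → ℂ)
    (u : EuclideanSpace ℝ (Fin n)) : ℂ :=
  ∫ u' in S.reflectionDomain u, S.fractionalIntegrand s g₁ g₂ u u' ∂S.surfaceMeasure

end GraphHypersurface

end

noncomputable section

namespace GraphHypersurface

variable {n : ℕ} (S : GraphHypersurface n)

local notation "𝔼" => EuclideanSpace ℝ (Fin (n - 1))
local notation "𝕍" => EuclideanSpace ℝ (Fin n)

/-! ### The ambient decomposition -/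

/-! The estimate rests on two facts about R: for fixed u' the change of variables u'' = R_u u' is
compensated by the factor J, and |u - u'| ≤ 4 Q(S) |u' - R_u u'|. They yield the power Q^(n-1), and
the stated power follows because Q ≥ 1.

Geometry. The normal over x is a multiple of (∇φ(x), -1), so passing from normals to gradients is
the central (gnomonic) projection, which turns great circles into lines. Geodesic convexity of N(S)
therefore makes ∇φ(D) convex (`convex_gradientImage`). For u ≠ u', the relation u'' = R_u u' says
that the gradient at u lies on the line through the gradients at u' and u'', and orthogonality of
N(u) to the chord from u' to u'' selects an explicit point of the segment (`isReflection_iff`). So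
one solves for u instead of u'': for fixed u', the map u'' ↦ u (`mid`) is explicit. Strict convexity
makes it injective (`mid_injOn`) and its differential invertible (`midGradientDeriv_eq_zero`).
Continuity of R, differentiability of u ↦ R_u u', the formula for J and the change of variables
(`lintegral_reflection_le`) all come from inverting it.

Size. The Rayleigh quotients of the shape operator lie in an interval [lam, Lam] with Lam ≤ Q lam.
Following the curve of points whose normals run from one given normal to another shows that the
Gauss map is bi-Lipschitz with constants comparable to lam and Lam. Since N(u) lies on the arc from
N(u') to N(u''), this gives the second fact above (`norm_param_mid_sub_le`). Projecting along a
single normal gives σ(B(z,r)) ≤ C r^(n-1) with C depending on n alone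
(`surfaceMeasure_closedBall_le`).

Analysis. Cut the kernel into pieces where |u' - R_u u'| is about r = 2^(-k) Δ. On such a piece u,
u' and R_u u' lie within ρ, a multiple of Q r, of each other, so over a ball of radius ρ only the
values of g₁ and g₂ on the doubled ball matter. Fubini and the change of variables bound the L¹ norm
of the piece on the ball by the product of the L¹ norms on the doubled ball, and Hölder turns this
into an L^q bound by L^(2q) norms. Integrating over the centre of the ball in ℝⁿ and applying
Cauchy–Schwarz makes the bound global (`lintegral_op_rpow_le`). With the weight r^(-s) each piece
has size of order Q^(n-1) r^(n-1-s), and as t ↦ t^q is subadditive the q-th powers sum geometrically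
(`exists_fractional_bound`). -/

theorem inner_frame_add_smul (v w : 𝔼) (a b : ℝ) :
    ⟪S.frame v + a • S.e, S.frame w + b • S.e⟫ = ⟪v, w⟫ + a * b := by
  have h := S.frame_orthogonal
  have he : ⟪S.e, S.e⟫ = (1 : ℝ) := by rw [real_inner_self_eq_norm_sq, S.norm_e]; norm_num
  have h' : ⟪S.e, S.frame w⟫ = 0 := by rw [real_inner_comm, h]
  simp only [inner_add_left, inner_add_right, inner_smul_left, inner_smul_right,
    S.frame.inner_map_map, h, h', he]
  simp [mul_comm]

theorem norm_sq_frame_add_smul (v : 𝔼) (a : ℝ) :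
    ‖S.frame v + a • S.e‖ ^ 2 = ‖v‖ ^ 2 + a ^ 2 := by
  rw [← real_inner_self_eq_norm_sq, inner_frame_add_smul, real_inner_self_eq_norm_sq, sq a]

theorem inner_coord (v : 𝔼) (u : 𝕍) : ⟪v, S.coord u⟫ = ⟪S.frame v, u⟫ := by
  rw [coord, ContinuousLinearMap.adjoint_inner_right]; rfl

@[simp] theorem coord_frame (v : 𝔼) : S.coord (S.frame v) = v := by
  refine ext_inner_left ℝ fun w => ?_
  rw [inner_coord, S.frame.inner_map_map]

@[simp] theorem coord_e : S.coord S.e = 0 := by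
  refine ext_inner_left ℝ fun w => ?_
  rw [inner_coord, S.frame_orthogonal, inner_zero_right]

@[simp] theorem coord_param (x : 𝔼) : S.coord (S.param x) = x := by
  simp [param]

theorem param_injective : Function.Injective S.param := fun x y h => by
  rw [← S.coord_param x, h, coord_param]

/-- The range of `frame` has codimension one, so its orthogonal complement is the line spanned by
`e`. -/
theorem frame_coord_add (u : 𝕍) : S.frame (S.coord u) + ⟪S.e, u⟫ • S.e = u := by
  have hn : 0 < n := by
    rcases Nat.eq_zero_or_pos n with rfl | h
    · have := S.norm_e
      rw [Subsingleton.elim S.e 0, norm_zero] at this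
      norm_num at this
    · exact h
  let W := LinearMap.range S.frame.toLinearMap
  have hW : Module.finrank ℝ W = n - 1 := by
    rw [LinearMap.finrank_range_of_inj S.frame.injective, finrank_euclideanSpace_fin]
  have hW' : Module.finrank ℝ Wᗮ = 1 := by
    have := W.finrank_add_finrank_orthogonal
    rw [hW, finrank_euclideanSpace_fin] at this
    omega
  have he0 : S.e ≠ 0 := by
    intro h; have := S.norm_e; rw [h, norm_zero] at this; norm_num at this
  have heW : S.e ∈ Wᗮ := by
    rw [Submodule.mem_orthogonal]
    rintro _ ⟨x, rfl⟩
    exact S.frame_orthogonal x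
  have hvW : u - S.frame (S.coord u) ∈ Wᗮ := by
    rw [Submodule.mem_orthogonal]
    rintro _ ⟨x, rfl⟩
    change ⟪S.frame x, _⟫ = 0
    rw [inner_sub_right, S.frame.inner_map_map, inner_coord, sub_self]
  obtain ⟨c, hc⟩ := (finrank_eq_one_iff_of_nonzero' (⟨S.e, heW⟩ : Wᗮ)
    (by simpa using he0)).1 hW' ⟨_, hvW⟩
  have hc' : c • S.e = u - S.frame (S.coord u) := congrArg Subtype.val hc
  have hce : c = ⟪S.e, u⟫ := by
    have := congrArg (fun z => ⟪S.e, z⟫) hc'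
    simp only [inner_smul_right, real_inner_self_eq_norm_sq, S.norm_e, inner_sub_right] at this
    rw [real_inner_comm (S.frame _) S.e, S.frame_orthogonal] at this
    linarith
  rw [← hce, hc']; abel

/-! ### First and second order calculus of the graph -/

/-- The unnormalised normal `(∇φ, -1)`. -/
def normal (x : 𝔼) : 𝕍 := S.frame (gradient S.φ x) - S.e

/-- The differential of the graph parametrisation. -/
def tangentMap (x : 𝔼) : 𝔼 →L[ℝ] 𝕍 :=
  S.frame.toContinuousLinearMap + (innerSL ℝ (gradient S.φ x)).smulRight S.e

/-- The Hessian of `φ`, as the derivative of the gradient. -/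
def hess (x : 𝔼) : 𝔼 →L[ℝ] 𝔼 := fderiv ℝ (gradient S.φ) x

theorem tangentMap_apply (x w : 𝔼) :
    S.tangentMap x w = S.frame w + ⟪gradient S.φ x, w⟫ • S.e := by
  simp [tangentMap]

theorem normal_eq (x : 𝔼) : S.normal x = S.frame (gradient S.φ x) + (-1 : ℝ) • S.e := by
  simp [normal, sub_eq_add_neg]

theorem inner_tangentMap_normal (x w : 𝔼) : ⟪S.tangentMap x w, S.normal x⟫ = 0 := by
  rw [tangentMap_apply, normal_eq, inner_frame_add_smul, real_inner_comm]; ring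

theorem norm_sq_tangentMap (x w : 𝔼) :
    ‖S.tangentMap x w‖ ^ 2 = ‖w‖ ^ 2 + ⟪gradient S.φ x, w⟫ ^ 2 := by
  rw [tangentMap_apply, norm_sq_frame_add_smul]

theorem norm_le_norm_tangentMap (x w : 𝔼) : ‖w‖ ≤ ‖S.tangentMap x w‖ := by
  refine le_of_sq_le_sq ?_ (norm_nonneg _)
  rw [norm_sq_tangentMap]; nlinarith [sq_nonneg ⟪gradient S.φ x, w⟫]

theorem areaElement_sq (x : 𝔼) : S.areaElement x ^ 2 = 1 + ‖gradient S.φ x‖ ^ 2 :=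
  Real.sq_sqrt (by positivity)

theorem areaElement_pos (x : 𝔼) : 0 < S.areaElement x := Real.sqrt_pos.2 (by positivity)

theorem norm_normal (x : 𝔼) : ‖S.normal x‖ = S.areaElement x := by
  refine (sq_eq_sq₀ (norm_nonneg _) (S.areaElement_pos x).le).1 ?_
  rw [normal_eq, norm_sq_frame_add_smul, areaElement_sq]; ring

theorem gaussMap_param (x : 𝔼) :
    S.gaussMap (S.param x) = (S.areaElement x)⁻¹ • S.normal x := by
  rw [gaussMap, coord_param, normal]

theorem norm_gaussMap (u : 𝕍) : ‖S.gaussMap u‖ = 1 := by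
  have : S.gaussMap u = (S.areaElement (S.coord u))⁻¹ • S.normal (S.coord u) := rfl
  rw [this, norm_smul, norm_normal, Real.norm_of_nonneg (inv_nonneg.2 (S.areaElement_pos _).le),
    inv_mul_cancel₀ (S.areaElement_pos _).ne']

theorem exists_tangentMap_eq {x : 𝔼} {v : 𝕍} (h : ⟪v, S.normal x⟫ = 0) :
    ∃ w, S.tangentMap x w = v := by
  refine ⟨S.coord v, ?_⟩
  rw [tangentMap_apply]
  conv_rhs => rw [← S.frame_coord_add v]
  rw [← S.frame_coord_add v, normal_eq, inner_frame_add_smul, real_inner_comm] at h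
  congr 2
  linarith

variable {S}

theorem contDiffAt_phi {x : 𝔼} (hx : x ∈ S.D) : ContDiffAt ℝ ∞ S.φ x := by
  obtain ⟨U, hU, hD, h⟩ := S.smooth
  exact h.contDiffAt (hU.mem_nhds (hD hx))

theorem contDiffAt_gradient {x : 𝔼} (hx : x ∈ S.D) : ContDiffAt ℝ ∞ (gradient S.φ) x := by
  have h : ContDiffAt ℝ ∞ (fderiv ℝ S.φ) x := (contDiffAt_phi hx).fderiv_right (by simp)
  exact (InnerProductSpace.toDual ℝ 𝔼).symm.contDiff.contDiffAt.comp x h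

theorem hasGradientAt_phi {x : 𝔼} (hx : x ∈ S.D) :
    HasGradientAt S.φ (gradient S.φ x) x :=
  ((contDiffAt_phi hx).differentiableAt (by simp)).hasGradientAt

theorem hasFDerivAt_phi {x : 𝔼} (hx : x ∈ S.D) :
    HasFDerivAt S.φ (innerSL ℝ (gradient S.φ x)) x :=
  (hasGradientAt_phi hx).hasFDerivAt

theorem hasStrictFDerivAt_gradient {x : 𝔼} (hx : x ∈ S.D) :
    HasStrictFDerivAt (gradient S.φ) (S.hess x) x :=
  (contDiffAt_gradient hx).hasStrictFDerivAt (by simp)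

theorem hasFDerivAt_gradient {x : 𝔼} (hx : x ∈ S.D) :
    HasFDerivAt (gradient S.φ) (S.hess x) x :=
  (hasStrictFDerivAt_gradient hx).hasFDerivAt

theorem continuousOn_phi : ContinuousOn S.φ S.D := fun _ hx =>
  (contDiffAt_phi hx).continuousAt.continuousWithinAt

theorem continuousOn_gradient : ContinuousOn (gradient S.φ) S.D := fun _ hx =>
  (contDiffAt_gradient hx).continuousAt.continuousWithinAt

theorem continuousOn_hess : ContinuousOn S.hess S.D := fun _ hx =>
  (((contDiffAt_gradient hx).fderiv_right (m := 0) (by simp)).continuousAt).continuousWithinAt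

theorem continuousOn_areaElement : ContinuousOn S.areaElement S.D := by
  unfold areaElement
  exact (continuousOn_const.add (continuousOn_gradient.norm.pow 2)).sqrt

theorem continuousOn_param : ContinuousOn S.param S.D :=
  S.frame.continuous.continuousOn.add (continuousOn_phi.smul continuousOn_const)

theorem hess_symm {x : 𝔼} (hx : x ∈ S.D) (v w : 𝔼) : ⟪S.hess x v, w⟫ = ⟪S.hess x w, v⟫ := by
  have h := (contDiffAt_phi hx).isSymmSndFDerivAt
    (by
      simp only [minSmoothness_of_isRCLikeNormedField]
      exact WithTop.coe_le_coe.2 (le_top : (2 : ℕ∞) ≤ ⊤)) v w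
  have key : ∀ v w : 𝔼, fderiv ℝ (fderiv ℝ S.φ) x v w = ⟪S.hess x v, w⟫ := by
    intro v w
    have h1 : HasFDerivAt (fderiv ℝ S.φ)
        ((InnerProductSpace.toDual ℝ 𝔼).toContinuousLinearEquiv.toContinuousLinearMap.comp
          (S.hess x)) x := by
      have := ((InnerProductSpace.toDual ℝ 𝔼).toContinuousLinearEquiv.hasFDerivAt).comp x
        (hasFDerivAt_gradient hx)
      refine this.congr_of_eventuallyEq (Filter.Eventually.of_forall fun y => ?_)
      simp [gradient]
    rw [h1.fderiv]
    simp
  rw [← key, ← key, h]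

theorem hasFDerivAt_param {x : 𝔼} (hx : x ∈ S.D) : HasFDerivAt S.param (S.tangentMap x) x := by
  unfold param tangentMap
  exact S.frame.toContinuousLinearMap.hasFDerivAt.add ((hasFDerivAt_phi hx).smul_const S.e)

theorem hasFDerivAt_normal {x : 𝔼} (hx : x ∈ S.D) :
    HasFDerivAt S.normal (S.frame.toContinuousLinearMap.comp (S.hess x)) x := by
  unfold normal
  exact (S.frame.toContinuousLinearMap.hasFDerivAt.comp x (hasFDerivAt_gradient hx)).sub_const S.e

theorem differentiableAt_inv_areaElement {x : 𝔼} (hx : x ∈ S.D) :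
    DifferentiableAt ℝ (fun y => (S.areaElement y)⁻¹) x := by
  unfold areaElement
  have h1 := (hasFDerivAt_gradient hx).differentiableAt
  refine DifferentiableAt.inv (DifferentiableAt.sqrt ?_ (by positivity)) ?_
  · exact (h1.norm_sq ℝ).const_add 1
  · exact (Real.sqrt_pos.2 (by positivity)).ne'

/-- Differentiating the normalising factor contributes only along the normal, so the functional `L`
need not be identified: it disappears when tested against tangent vectors. -/
theorem exists_fderiv_gaussMap {x : 𝔼} (hx : x ∈ S.D) : ∃ L : 𝔼 →L[ℝ] ℝ, ∀ w,
    fderiv ℝ S.gaussMap (S.param x) (S.tangentMap x w) =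
      (S.areaElement x)⁻¹ • S.frame (S.hess x w) + L w • S.normal x := by
  have ha := differentiableAt_inv_areaElement hx
  have h1 := ha.hasFDerivAt.smul (hasFDerivAt_normal hx)
  have h2 : HasFDerivAt S.gaussMap _ (S.param x) :=
    HasFDerivAt.comp (S.param x) (g := fun y => (S.areaElement y)⁻¹ • S.normal y) (f := S.coord)
      (by rw [coord_param]; exact h1) S.coord.hasFDerivAt
  refine ⟨fderiv ℝ (fun y => (S.areaElement y)⁻¹) x, fun w => ?_⟩
  rw [h2.fderiv]
  have : S.coord (S.tangentMap x w) = w := by simp [tangentMap_apply]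
  simp [this]

theorem inner_fderiv_gaussMap {x : 𝔼} (hx : x ∈ S.D) (v w : 𝔼) :
    ⟪fderiv ℝ S.gaussMap (S.param x) (S.tangentMap x v), S.tangentMap x w⟫ =
      (S.areaElement x)⁻¹ * ⟪S.hess x v, w⟫ := by
  obtain ⟨L, hL⟩ := exists_fderiv_gaussMap hx
  rw [hL, inner_add_left, inner_smul_left, inner_smul_left,
    real_inner_comm (S.tangentMap x w) (S.normal x), inner_tangentMap_normal,
    tangentMap_apply]
  have := S.inner_frame_add_smul (S.hess x v) w 0 ⟪gradient S.φ x, w⟫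
  simp only [zero_smul, add_zero, zero_mul] at this
  rw [this]; simp

theorem tangentMap_mem_tangentSpace (x w : 𝔼) :
    S.tangentMap x w ∈ S.tangentSpace (S.param x) := by
  rw [tangentSpace, Submodule.mem_orthogonal_singleton_iff_inner_left, gaussMap_param,
    inner_smul_right, inner_tangentMap_normal, mul_zero]

/-- Differentiate |N|² = 1. -/
theorem inner_fderiv_gaussMap_normal {x : 𝔼} (hx : x ∈ S.D) (v : 𝔼) :
    ⟪fderiv ℝ S.gaussMap (S.param x) (S.tangentMap x v), S.normal x⟫ = 0 := by
  have hd : DifferentiableAt ℝ S.gaussMap (S.param x) := by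
    have ha := differentiableAt_inv_areaElement hx
    have h1 := ha.smul (hasFDerivAt_normal hx).differentiableAt
    exact DifferentiableAt.comp (S.param x) (g := fun y => (S.areaElement y)⁻¹ • S.normal y)
      (f := S.coord) (by rw [coord_param]; exact h1) S.coord.differentiableAt
  have h := hd.hasFDerivAt.norm_sq
  have h' : HasFDerivAt (fun u => ‖S.gaussMap u‖ ^ 2) (0 : 𝕍 →L[ℝ] ℝ) (S.param x) := by
    simp only [norm_gaussMap]; exact hasFDerivAt_const _ _
  have h2 := congrArg (fun L => L (S.tangentMap x v)) (h.unique h')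
  simp only [smul_apply, ContinuousLinearMap.comp_apply, innerSL_apply_apply,
    zero_apply, gaussMap_param, inner_smul_left] at h2
  rw [real_inner_comm]
  have := (S.areaElement_pos x).ne'
  simpa [this] using h2

/-! ### Curvature bounds -/

theorem eq_zero_of_forall_quadratic_nonneg {b c : ℝ} (h : ∀ t : ℝ, 0 ≤ 2 * t * b + t ^ 2 * c) :
    b = 0 := by
  by_contra hb
  have hc : 0 < |c| + 1 := by positivity
  have h1 := h (-b / (|c| + 1))
  have h2 : 2 * (-b / (|c| + 1)) * b + (-b / (|c| + 1)) ^ 2 * c =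
      (b ^ 2 / (|c| + 1)) * (c / (|c| + 1) - 2) := by field_simp; ring
  rw [h2] at h1
  have h3 : c / (|c| + 1) ≤ 1 := (div_le_one hc).2 (by linarith [le_abs_self c])
  have h4 : 0 < b ^ 2 / (|c| + 1) := by positivity
  nlinarith

/-- The first variation of a Rayleigh quotient vanishes at an extremal vector, which is the weak
form of the eigenvalue equation. It suffices because dN maps tangent vectors to tangent vectors. The
sign of `ε` lets one argument serve for minima (`ε = -1`) and maxima (`ε = 1`). -/
theorem isPrincipalCurvature_of_extremal {x w : 𝔼} (hx : x ∈ S.D) (hw : w ≠ 0) {κ ε : ℝ}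
    (hε : ε ≠ 0)
    (h : ∀ v, 0 ≤ ε * (κ * ‖S.tangentMap x v‖ ^ 2 - (S.areaElement x)⁻¹ * ⟪S.hess x v, v⟫))
    (h0 : κ * ‖S.tangentMap x w‖ ^ 2 = (S.areaElement x)⁻¹ * ⟪S.hess x w, w⟫) :
    S.IsPrincipalCurvature (S.param x) κ := by
  have hb : ∀ v, κ * ⟪S.tangentMap x w, S.tangentMap x v⟫ -
      (S.areaElement x)⁻¹ * ⟪S.hess x w, v⟫ = 0 := by
    intro v
    have := eq_zero_of_forall_quadratic_nonneg (b := ε * (κ * ⟪S.tangentMap x w, S.tangentMap x v⟫ -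
      (S.areaElement x)⁻¹ * ⟪S.hess x w, v⟫))
      (c := ε * (κ * ‖S.tangentMap x v‖ ^ 2 - (S.areaElement x)⁻¹ * ⟪S.hess x v, v⟫)) (fun t => by
        have h1 := h (w + t • v)
        simp only [map_add, map_smul, ← real_inner_self_eq_norm_sq, inner_add_left, inner_add_right,
          inner_smul_left, inner_smul_right, hess_symm hx v w,
          real_inner_comm (S.tangentMap x w) (S.tangentMap x v)] at h1
        rw [← real_inner_self_eq_norm_sq] at h0 ⊢
        simp only [RCLike.conj_to_real] at h1
        nlinarith [congrArg (fun y => ε * y) h0])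
    exact (mul_eq_zero.1 this).resolve_left hε
  refine ⟨S.tangentMap x w, tangentMap_mem_tangentSpace x w, ?_, ?_⟩
  · intro h
    have := S.norm_le_norm_tangentMap x w
    rw [h, norm_zero, norm_le_zero_iff] at this
    exact hw this
  · rw [← sub_eq_zero]
    obtain ⟨y, hy⟩ := S.exists_tangentMap_eq (x := x)
      (v := fderiv ℝ S.gaussMap (S.param x) (S.tangentMap x w) - κ • S.tangentMap x w) (by
        rw [inner_sub_left, inner_fderiv_gaussMap_normal hx, inner_smul_left,
          inner_tangentMap_normal]; simp)
    rw [← inner_self_eq_zero (𝕜 := ℝ)]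
    nth_rw 2 [← hy]
    rw [inner_sub_left, inner_fderiv_gaussMap hx, inner_smul_left]
    have := hb y
    simp only [RCLike.conj_to_real]
    linarith

theorem hess_pos (hS : S.IsAdmissible) {x w : 𝔼} (hx : x ∈ S.D) (hw : w ≠ 0) :
    0 < ⟪S.hess x w, w⟫ := by
  have h := hS.shape_posDef (S.param x) ⟨x, hx, rfl⟩ _ (tangentMap_mem_tangentSpace x w) (by
    intro h
    have := S.norm_le_norm_tangentMap x w
    rw [h, norm_zero, norm_le_zero_iff] at this
    exact hw this)
  rw [inner_fderiv_gaussMap hx] at h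
  exact (mul_pos_iff_of_pos_left (inv_pos.2 (S.areaElement_pos x))).1 h

/-- The shape operator has all its Rayleigh quotients in `[lam, Lam]`. -/
structure CurvatureBounds (S : GraphHypersurface n) (lam Lam : ℝ) : Prop where
  pos : 0 < lam
  le : lam ≤ Lam
  lower : ∀ x ∈ S.D, ∀ w, lam * ‖S.tangentMap x w‖ ^ 2 ≤ (S.areaElement x)⁻¹ * ⟪S.hess x w, w⟫
  upper : ∀ x ∈ S.D, ∀ w, (S.areaElement x)⁻¹ * ⟪S.hess x w, w⟫ ≤ Lam * ‖S.tangentMap x w‖ ^ 2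

/-- By compactness the Rayleigh quotient attains its extrema over all points and unit directions.
They are principal curvatures, hence compete in the definition of Q(S), and this is why the ratio
`Lam / lam` is at most Q(S). -/
theorem exists_curvatureBounds (hn : 2 ≤ n) (hS : S.IsAdmissible) (hne : S.D.Nonempty) :
    ∃ lam Lam, S.CurvatureBounds lam Lam ∧ Lam ≤ S.curvatureQuotient * lam := by
  have : Nontrivial 𝔼 := by
    have : Nonempty (Fin (n - 1)) := ⟨⟨0, by omega⟩⟩
    infer_instance
  let f : 𝔼 × 𝔼 → ℝ := fun p =>
    (S.areaElement p.1)⁻¹ * ⟪S.hess p.1 p.2, p.2⟫ / ‖S.tangentMap p.1 p.2‖ ^ 2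
  let K : Set (𝔼 × 𝔼) := S.D ×ˢ Metric.sphere (0 : 𝔼) 1
  have hK : IsCompact K := S.isCompact_D.prod (isCompact_sphere 0 1)
  have hKne : K.Nonempty := hne.prod (NormedSpace.sphere_nonempty.2 zero_le_one)
  have htpos : ∀ x : 𝔼, ∀ w : 𝔼, w ≠ 0 → 0 < ‖S.tangentMap x w‖ := fun x w hw =>
    (norm_pos_iff.2 hw).trans_le (S.norm_le_norm_tangentMap x w)
  have hsph : ∀ w : 𝔼, w ∈ Metric.sphere (0 : 𝔼) 1 → w ≠ 0 := by
    rintro w hw rfl; simp at hw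
  have hf : ContinuousOn f K := by
    have h1 : ContinuousOn (fun p : 𝔼 × 𝔼 => p.1) K := continuousOn_fst
    have h2 : ContinuousOn (fun p : 𝔼 × 𝔼 => p.2) K := continuousOn_snd
    have hm : Set.MapsTo (fun p : 𝔼 × 𝔼 => p.1) K S.D := fun p hp => hp.1
    have ha := continuousOn_areaElement.comp h1 hm
    have hh := continuousOn_hess.comp h1 hm
    have hg := continuousOn_gradient.comp h1 hm
    have ht : ContinuousOn (fun p : 𝔼 × 𝔼 => S.tangentMap p.1 p.2) K := by
      simp only [tangentMap_apply]
      have hi : ContinuousOn (fun p : 𝔼 × 𝔼 => ⟪gradient S.φ p.1, p.2⟫) K :=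
        ContinuousOn.inner (𝕜 := ℝ) hg h2
      exact (S.frame.continuous.comp_continuousOn h2).add (hi.smul continuousOn_const)
    refine ContinuousOn.div ((ha.inv₀ fun p _ => (S.areaElement_pos _).ne').mul
      (ContinuousOn.inner (𝕜 := ℝ) (hh.clm_apply h2) h2)) (ht.norm.pow 2) fun p hp => ?_
    exact (pow_pos (htpos _ _ (hsph _ hp.2)) 2).ne'
  obtain ⟨⟨x₀, w₀⟩, hp₀, hmin⟩ := hK.exists_isMinOn hKne hf
  obtain ⟨⟨x₁, w₁⟩, hp₁, hmax⟩ := hK.exists_isMaxOn hKne hf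
  have hfpos : ∀ p ∈ K, 0 < f p := fun p hp => by
    have h1 := hess_pos hS hp.1 (hsph _ hp.2)
    have h2 := htpos p.1 p.2 (hsph _ hp.2)
    have h3 := S.areaElement_pos p.1
    positivity
  have hscale : ∀ x ∈ S.D, ∀ w : 𝔼, w ≠ 0 → ∃ p ∈ K,
      f p * ‖S.tangentMap x w‖ ^ 2 = (S.areaElement x)⁻¹ * ⟪S.hess x w, w⟫ := by
    intro x hx w hw
    have hw' : ‖w‖ ≠ 0 := norm_ne_zero_iff.2 hw
    have h2 := (htpos x w hw).ne'
    refine ⟨(x, ‖w‖⁻¹ • w), ⟨hx, ?_⟩, ?_⟩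
    · rw [mem_sphere_zero_iff_norm, norm_smul, norm_inv, norm_norm, inv_mul_cancel₀ hw']
    · simp only [f, map_smul, inner_smul_left, inner_smul_right, norm_smul, norm_inv, norm_norm,
        RCLike.conj_to_real]
      field_simp
  have hlow : ∀ x ∈ S.D, ∀ w, f (x₀, w₀) * ‖S.tangentMap x w‖ ^ 2 ≤
      (S.areaElement x)⁻¹ * ⟪S.hess x w, w⟫ := by
    intro x hx w
    rcases eq_or_ne w 0 with rfl | hw
    · simp
    obtain ⟨p, hp, h⟩ := hscale x hx w hw
    rw [← h]
    exact mul_le_mul_of_nonneg_right (hmin hp) (by positivity)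
  have hupp : ∀ x ∈ S.D, ∀ w, (S.areaElement x)⁻¹ * ⟪S.hess x w, w⟫ ≤
      f (x₁, w₁) * ‖S.tangentMap x w‖ ^ 2 := by
    intro x hx w
    rcases eq_or_ne w 0 with rfl | hw
    · simp
    obtain ⟨p, hp, h⟩ := hscale x hx w hw
    rw [← h]
    exact mul_le_mul_of_nonneg_right (hmax hp) (by positivity)
  have heq : ∀ p ∈ K, f p * ‖S.tangentMap p.1 p.2‖ ^ 2 =
      (S.areaElement p.1)⁻¹ * ⟪S.hess p.1 p.2, p.2⟫ := fun p hp =>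
    div_mul_cancel₀ _ (pow_pos (htpos _ _ (hsph _ hp.2)) 2).ne'
  have hpc₀ : S.IsPrincipalCurvature (S.param x₀) (f (x₀, w₀)) :=
    isPrincipalCurvature_of_extremal hp₀.1 (hsph _ hp₀.2) (ε := -1) (by norm_num)
      (fun v => by linarith [hlow x₀ hp₀.1 v]) (heq _ hp₀)
  have hpc₁ : S.IsPrincipalCurvature (S.param x₁) (f (x₁, w₁)) :=
    isPrincipalCurvature_of_extremal hp₁.1 (hsph _ hp₁.2) (ε := 1) (by norm_num)
      (fun v => by linarith [hupp x₁ hp₁.1 v]) (heq _ hp₁)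
  have hpos := hfpos _ hp₀
  refine ⟨f (x₀, w₀), f (x₁, w₁), ⟨hpos, hmin hp₁, hlow, hupp⟩, ?_⟩
  rw [← div_le_iff₀ hpos]
  have hcurv : ∀ u ∈ S.carrier, ∀ κ, S.IsPrincipalCurvature u κ →
      f (x₀, w₀) ≤ κ ∧ κ ≤ f (x₁, w₁) := by
    rintro _ ⟨x, hx, rfl⟩ κ ⟨v, hv, hv0, hκ⟩
    rw [tangentSpace, Submodule.mem_orthogonal_singleton_iff_inner_left, gaussMap_param,
      inner_smul_right, mul_eq_zero, or_iff_right (inv_ne_zero (S.areaElement_pos x).ne')] at hv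
    obtain ⟨w, rfl⟩ := S.exists_tangentMap_eq hv
    have h1 := inner_fderiv_gaussMap hx w w
    rw [hκ, inner_smul_left, real_inner_self_eq_norm_sq] at h1
    simp only [RCLike.conj_to_real] at h1
    have h2 : 0 < ‖S.tangentMap x w‖ ^ 2 := pow_pos (norm_pos_iff.2 hv0) 2
    have h3 := hlow x hx w
    have h4 := hupp x hx w
    rw [← h1] at h3 h4
    exact ⟨le_of_mul_le_mul_right h3 h2, le_of_mul_le_mul_right h4 h2⟩
  -- The infimum of an empty set of reals would be 0, so an admissible constant has to be exhibited
  -- first.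
  refine le_csInf ⟨f (x₁, w₁) / f (x₀, w₀), ?_⟩ ?_
  · intro u hu u' hu' κ κ' h h'
    have h1 := (hcurv u hu κ h).2
    have h2 := (hcurv u' hu' κ' h').1
    have h3 := hfpos _ hp₁
    rw [div_mul_eq_mul_div, le_div_iff₀ hpos]
    nlinarith
  · intro c hc
    rw [div_le_iff₀ hpos]
    exact hc _ ⟨x₁, hp₁.1, rfl⟩ _ ⟨x₀, hp₀.1, rfl⟩ _ _ hpc₁ hpc₀

/-! ### The set of gradients and the inverse of the gradient map -/

theorem exists_continuousLinearEquiv {F : Type*} [NormedAddCommGroup F] [NormedSpace ℝ F]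
    [FiniteDimensional ℝ F] (L : F →L[ℝ] F) (hL : ∀ w, L w = 0 → w = 0) :
    ∃ Le : F ≃L[ℝ] F, (Le : F →L[ℝ] F) = L := by
  have hi : Function.Injective (L : F →ₗ[ℝ] F) :=
    (injective_iff_map_eq_zero _).2 hL
  exact ⟨(LinearEquiv.ofInjectiveEndo (L : F →ₗ[ℝ] F) hi).toContinuousLinearEquiv, by ext; rfl⟩

variable (S) in
/-- The image of the gradient map, i.e. the set of normals in the gnomonic chart. -/
def gradientImage : Set 𝔼 := gradient S.φ '' S.D

variable (S) in
/-- The inverse of the gradient map. -/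
def gradientInv : 𝔼 → 𝔼 := Function.invFunOn (gradient S.φ) S.D

theorem injOn_gradient (hS : S.IsAdmissible) : Set.InjOn (gradient S.φ) S.D := by
  intro x hx y hy h
  refine S.param_injective (hS.injOn_gaussMap ⟨x, hx, rfl⟩ ⟨y, hy, rfl⟩ ?_)
  simp only [gaussMap_param, normal, areaElement, h]

theorem gradientInv_mem {p : 𝔼} (hp : p ∈ S.gradientImage) : S.gradientInv p ∈ S.D :=
  Function.invFunOn_mem hp

theorem gradient_gradientInv {p : 𝔼} (hp : p ∈ S.gradientImage) :
    gradient S.φ (S.gradientInv p) = p :=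
  Function.invFunOn_eq hp

theorem gradientInv_gradient (hS : S.IsAdmissible) {x : 𝔼} (hx : x ∈ S.D) :
    S.gradientInv (gradient S.φ x) = x :=
  (injOn_gradient hS).leftInvOn_invFunOn hx

theorem gradientInv_image (hS : S.IsAdmissible) : S.gradientInv '' S.gradientImage = S.D := by
  ext x
  constructor
  · rintro ⟨p, hp, rfl⟩; exact gradientInv_mem hp
  · exact fun hx => ⟨_, ⟨x, hx, rfl⟩, gradientInv_gradient hS hx⟩

/-- A continuous injection of a compact set is closed onto its image, so its inverse is continuous.
-/
theorem continuousOn_gradientInv (hS : S.IsAdmissible) :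
    ContinuousOn S.gradientInv S.gradientImage := by
  rw [continuousOn_iff_isClosed]
  intro t ht
  refine ⟨gradient S.φ '' (S.D ∩ t), ((S.isCompact_D.inter_right ht).image_of_continuousOn
    (continuousOn_gradient.mono Set.inter_subset_left)).isClosed, ?_⟩
  ext p
  constructor
  · rintro ⟨h1, h2⟩
    exact ⟨⟨_, ⟨gradientInv_mem h2, h1⟩, gradient_gradientInv h2⟩, h2⟩
  · rintro ⟨⟨x, hx, rfl⟩, h2⟩
    exact ⟨by rw [Set.mem_preimage, gradientInv_gradient hS hx.1]; exact hx.2, h2⟩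

theorem hess_eq_zero (hS : S.IsAdmissible) {x : 𝔼} (hx : x ∈ S.D) (w : 𝔼) (h : S.hess x w = 0) :
    w = 0 := by
  by_contra hw
  have := hess_pos hS hx hw
  rw [h, inner_zero_left] at this
  exact this.false

theorem exists_hessEquiv (hS : S.IsAdmissible) {x : 𝔼} (hx : x ∈ S.D) :
    ∃ Le : 𝔼 ≃L[ℝ] 𝔼, (Le : 𝔼 →L[ℝ] 𝔼) = S.hess x :=
  exists_continuousLinearEquiv _ (hess_eq_zero hS hx)

theorem hasFDerivWithinAt_gradientInv (hS : S.IsAdmissible) {x : 𝔼} (hx : x ∈ S.D)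
    {Le : 𝔼 ≃L[ℝ] 𝔼} (hLe : (Le : 𝔼 →L[ℝ] 𝔼) = S.hess x) :
    HasFDerivWithinAt S.gradientInv (Le.symm : 𝔼 →L[ℝ] 𝔼) S.gradientImage (gradient S.φ x) := by
  have hp : gradient S.φ x ∈ S.gradientImage := ⟨x, hx, rfl⟩
  refine HasFDerivWithinAt.of_local_left_inverse (f := gradient S.φ) (t := S.D) ?_ ?_ hp ?_
  · exact tendsto_nhdsWithin_iff.2 ⟨continuousOn_gradientInv hS _ hp,
      eventually_nhdsWithin_of_forall fun p hp => gradientInv_mem hp⟩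
  · rw [gradientInv_gradient hS hx, hLe]
    exact (hasFDerivAt_gradient hx).hasFDerivWithinAt
  · exact eventually_nhdsWithin_of_forall fun p hp => gradient_gradientInv hp

/-- The plane spanned by two normals meets the sphere in a great circle, whose part in N(S) is
connected. Central projection carries that part continuously into the line through the two
gradients, and a connected subset of a line containing two points contains the segment between them.
-/
theorem convex_gradientImage (hS : S.IsAdmissible) : Convex ℝ S.gradientImage := by
  rw [convex_iff_segment_subset]
  rintro _ ⟨x, hx, rfl⟩ _ ⟨y, hy, rfl⟩
  rcases eq_or_ne (gradient S.φ x) (gradient S.φ y) with heq | hne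
  · rw [heq, segment_same]
    exact Set.singleton_subset_iff.2 ⟨y, hy, rfl⟩
  let W : Submodule ℝ 𝕍 := Submodule.span ℝ (Set.range ![S.normal x, S.normal y])
  have hcomb : ∀ α β : ℝ, α • S.normal x + β • S.normal y =
      S.frame (α • gradient S.φ x + β • gradient S.φ y) + (-(α + β)) • S.e := by
    intro α β
    simp only [normal, map_add, map_smul]
    module
  have hcoord : ∀ α β : ℝ, S.coord (α • S.normal x + β • S.normal y) =
      α • gradient S.φ x + β • gradient S.φ y := by
    intro α β
    rw [hcomb]; simp
  have hinner : ∀ (v : 𝔼) (c : ℝ), ⟪S.e, S.frame v + c • S.e⟫ = c := by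
    intro v c
    have := S.inner_frame_add_smul 0 v 1 c
    simpa using this
  have hli : LinearIndependent ℝ ![S.normal x, S.normal y] := by
    rw [LinearIndependent.pair_iff]
    intro α β h
    have h1 := hcoord α β
    have h2 := hinner (α • gradient S.φ x + β • gradient S.φ y) (-(α + β))
    rw [← hcomb, h, inner_zero_right] at h2
    rw [h, map_zero] at h1
    have hβ : β = -α := by linarith
    rw [hβ, neg_smul, ← sub_eq_add_neg, ← smul_sub, eq_comm, smul_eq_zero, sub_eq_zero] at h1
    have := h1.resolve_right hne
    exact ⟨this, by rw [hβ, this, neg_zero]⟩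
  have hW : Module.finrank ℝ W = 2 := by
    rw [finrank_span_eq_card hli, Fintype.card_fin]
  have hconn := hS.geodesicallyConvex W hW
  let C := S.gaussMap '' S.carrier ∩ (W : Set 𝕍)
  -- The gnomonic chart: rescale so that the `e`-component becomes -1, then drop it. It sends each
  -- normal to its gradient.
  let Ψ : 𝕍 → 𝔼 := fun ζ => (-⟪S.e, ζ⟫)⁻¹ • S.coord ζ
  have hev : ∀ z, ⟪S.e, S.gaussMap (S.param z)⟫ = -(S.areaElement z)⁻¹ := by
    intro z
    rw [gaussMap_param, inner_smul_right, normal_eq, hinner]; ring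
  have hΨ : ∀ z, Ψ (S.gaussMap (S.param z)) = gradient S.φ z := by
    intro z
    have := (S.areaElement_pos z).ne'
    have h1 : Ψ (S.gaussMap (S.param z)) =
        (-⟪S.e, S.gaussMap (S.param z)⟫)⁻¹ • S.coord (S.gaussMap (S.param z)) := rfl
    rw [h1, hev, gaussMap_param, normal_eq]
    simp [smul_smul, mul_inv_cancel₀ this]
  have hΨc : ContinuousOn Ψ C := by
    suffices hi : ContinuousOn (fun ζ : 𝕍 => (-⟪S.e, ζ⟫)⁻¹) C from
      hi.smul S.coord.continuous.continuousOn
    refine ContinuousOn.inv₀ ?_ ?_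
    · exact (continuous_const.inner continuous_id).neg.continuousOn
    · rintro _ ⟨⟨_, ⟨z, hz, rfl⟩, rfl⟩, _⟩
      simp only [hev, neg_neg]
      exact inv_ne_zero (S.areaElement_pos z).ne'
  have hline : ∀ ζ ∈ C, ∃ t : ℝ, Ψ ζ = gradient S.φ x + t • (gradient S.φ y - gradient S.φ x) := by
    rintro _ ⟨⟨_, ⟨z, hz, rfl⟩, rfl⟩, hzW⟩
    rw [hΨ]
    have h1 : S.normal z ∈ W := by
      have := W.smul_mem (S.areaElement z) hzW
      rwa [gaussMap_param, smul_smul, mul_inv_cancel₀ (S.areaElement_pos z).ne', one_smul] at this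
    simp only [W, Matrix.range_cons, Matrix.range_empty, Set.union_empty, Set.singleton_union] at h1
    obtain ⟨α, β, h⟩ := Submodule.mem_span_pair.1 h1
    have h2 := hcoord α β
    have h3 := hinner (α • gradient S.φ x + β • gradient S.φ y) (-(α + β))
    rw [← hcomb, h, normal_eq, hinner] at h3
    rw [h, normal_eq] at h2
    simp only [map_add, map_smul, coord_frame, coord_e, smul_zero, add_zero] at h2
    refine ⟨β, ?_⟩
    rw [h2, show α = 1 - β by linarith]
    module
  have hmem : ∀ z ∈ S.D, S.normal z ∈ W → S.gaussMap (S.param z) ∈ C := fun z hz h =>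
    ⟨⟨_, ⟨z, hz, rfl⟩, rfl⟩, by rw [gaussMap_param]; exact W.smul_mem _ h⟩
  have hxC := hmem x hx (Submodule.subset_span ⟨0, rfl⟩)
  have hyC := hmem y hy (Submodule.subset_span ⟨1, rfl⟩)
  let d := gradient S.φ y - gradient S.φ x
  have hd : 0 < ⟪d, d⟫ := by
    rw [real_inner_self_eq_norm_sq]
    exact pow_pos (norm_pos_iff.2 (sub_ne_zero.2 hne.symm)) 2
  -- The coordinate along `d` is injective on the line, so reaching the intermediate value
  -- determines the intermediate point.
  have hord : Set.OrdConnected ((fun ζ => ⟪Ψ ζ, d⟫) '' C) :=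
    (hconn.image _ (hΨc.inner continuousOn_const)).ordConnected
  intro p hp
  rw [segment_eq_image'] at hp
  obtain ⟨t, ht, rfl⟩ := hp
  have hval : ⟪gradient S.φ x + t • d, d⟫ ∈ (fun ζ => ⟪Ψ ζ, d⟫) '' C := by
    refine hord.out ⟨_, hxC, rfl⟩ ⟨_, hyC, rfl⟩ ?_
    simp only [hΨ]
    have hy' : gradient S.φ y = gradient S.φ x + d := by simp [d]
    rw [hy', inner_add_left, inner_add_left, inner_smul_left, RCLike.conj_to_real]
    constructor <;> nlinarith [ht.1, ht.2]
  obtain ⟨ζ, hζ, h⟩ := hval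
  obtain ⟨t', ht'⟩ := hline ζ hζ
  have htt : t' = t := by
    simp only [ht', inner_add_left, inner_smul_left, RCLike.conj_to_real] at h
    exact mul_right_cancel₀ hd.ne' (add_left_cancel h)
  rw [htt] at ht'
  obtain ⟨⟨_, ⟨z, hz, rfl⟩, rfl⟩, _⟩ := hζ
  rw [hΨ] at ht'
  exact ⟨z, hz, ht'⟩

/-- The gradient map is a local homeomorphism at an interior point of `D`, since its differential,
the Hessian, is invertible there. -/
theorem interior_gradientImage_nonempty (hS : S.IsAdmissible) (hne : S.D.Nonempty) :
    (interior S.gradientImage).Nonempty := by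
  obtain ⟨x, hx⟩ : (interior S.D).Nonempty :=
    closure_nonempty_iff.1 (hne.mono S.D_subset)
  have hxD := interior_subset hx
  obtain ⟨Le, hLe⟩ := exists_hessEquiv hS hxD
  have h := hasStrictFDerivAt_gradient hxD
  rw [← hLe] at h
  refine ⟨gradient S.φ x, mem_interior_iff_mem_nhds.2 ?_⟩
  rw [← h.map_nhds_eq_of_equiv]
  exact Filter.image_mem_map (mem_interior_iff_mem_nhds.1 hx)

/-- `D` is the image of a convex set with nonempty interior under a map with invertible derivatives.
This makes derivatives within `D` meaningful at boundary points, whatever the shape of the boundary.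
-/
theorem uniqueDiffOn_D (hS : S.IsAdmissible) : UniqueDiffOn ℝ S.D := by
  intro x hx
  have hP := uniqueDiffOn_convex (convex_gradientImage hS)
    (interior_gradientImage_nonempty hS ⟨x, hx⟩) _ ⟨x, hx, rfl⟩
  obtain ⟨Le, hLe⟩ := exists_hessEquiv hS hx
  have := (hasFDerivWithinAt_gradientInv hS hx hLe).uniqueDiffWithinAt hP
    Le.symm.surjective.denseRange
  rwa [gradientInv_image hS, gradientInv_gradient hS hx] at this

/-! ### Comparison of points and normals along great circles -/

/-- A mean value theorem along the curve of the hypersurface whose normals run through the great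
circle arc between the normals at two points. -/
theorem exists_mean_value_on_arc (hS : S.IsAdmissible) {x y : 𝔼} (hx : x ∈ S.D) (hy : y ∈ S.D)
    (ξ : 𝕍) : ∃ t ∈ Set.Ioo (0 : ℝ) 1, ∃ z ∈ S.D, ∃ z' : 𝔼, ∃ c : ℝ, 0 < c ∧
      (1 - t) • S.gaussMap (S.param x) + t • S.gaussMap (S.param y) = c • S.normal z ∧
      (∀ w, ⟪S.tangentMap z w, S.gaussMap (S.param y) - S.gaussMap (S.param x)⟫ =
        c * ⟪S.hess z z', w⟫) ∧
      ⟪S.tangentMap z z', ξ⟫ = ⟪S.param y - S.param x, ξ⟫ := by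
  set α := (S.areaElement x)⁻¹ with hα
  set β := (S.areaElement y)⁻¹ with hβ
  have hαp : 0 < α := inv_pos.2 (S.areaElement_pos x)
  have hβp : 0 < β := inv_pos.2 (S.areaElement_pos y)
  set g := gradient S.φ x with hg
  set h := gradient S.φ y with hh
  -- The chord between the unit normals, rather than the arc, is used as parameter: its point at
  -- time t is b(t) times the unnormalised normal with gradient p(t) = r(t) / b(t).
  let b : ℝ → ℝ := fun t => α + t * (β - α)
  let r : ℝ → 𝔼 := fun t => α • g + t • (β • h - α • g)
  let p : ℝ → 𝔼 := fun t => (b t)⁻¹ • r t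
  let p' : ℝ → 𝔼 := fun t => (b t)⁻¹ • ((β • h - α • g) - (β - α) • p t)
  have hb : ∀ t ∈ Set.Icc (0 : ℝ) 1, 0 < b t := by
    intro t ht
    have : b t = (1 - t) * α + t * β := by simp only [b]; ring
    rw [this]
    rcases eq_or_lt_of_le ht.1 with h0 | h0
    · rw [← h0]; simpa using hαp
    · have := mul_pos h0 hβp
      have := mul_nonneg (sub_nonneg.2 ht.2) hαp.le
      linarith
  have hpP : ∀ t ∈ Set.Icc (0 : ℝ) 1, p t ∈ S.gradientImage := by
    intro t ht
    have hbt := hb t ht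
    have hseg := (convex_gradientImage hS) (x := g) ⟨x, hx, rfl⟩ (y := h) ⟨y, hy, rfl⟩
      (a := (1 - t) * α / b t) (b := t * β / b t)
      (div_nonneg (mul_nonneg (sub_nonneg.2 ht.2) hαp.le) hbt.le)
      (div_nonneg (mul_nonneg ht.1 hβp.le) hbt.le)
      (by rw [← add_div, div_eq_one_iff_eq hbt.ne']; simp only [b]; ring)
    convert hseg using 1
    simp only [p, r, smul_add, smul_smul, smul_sub, div_eq_inv_mul]
    module
  have hpd : ∀ t ∈ Set.Icc (0 : ℝ) 1, HasDerivAt p (p' t) t := by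
    intro t ht
    have hbt := (hb t ht).ne'
    have h1 : HasDerivAt b (β - α) t := by
      simpa [b] using ((hasDerivAt_id t).mul_const (β - α)).const_add α
    have h2 : HasDerivAt r (β • h - α • g) t := by
      simpa [r] using ((hasDerivAt_id t).smul_const (β • h - α • g)).const_add (α • g)
    have h3 := (h1.inv hbt).smul h2
    refine h3.congr_deriv ?_
    simp only [p', p, Pi.inv_apply, smul_sub, smul_smul]
    have : -(β - α) / b t ^ 2 = -((b t)⁻¹ * ((β - α) * (b t)⁻¹)) := by field_simp
    rw [this, neg_smul, ← sub_eq_add_neg]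
  let z : ℝ → 𝔼 := fun t => S.gradientInv (p t)
  have hz : ∀ t ∈ Set.Icc (0 : ℝ) 1, z t ∈ S.D ∧ gradient S.φ (z t) = p t := fun t ht =>
    ⟨gradientInv_mem (hpP t ht), gradient_gradientInv (hpP t ht)⟩
  have hz' : ∀ t ∈ Set.Icc (0 : ℝ) 1, ∃ z', S.hess (z t) z' = p' t ∧
      HasDerivWithinAt (fun t => S.param (z t)) (S.tangentMap (z t) z') (Set.Icc 0 1) t := by
    intro t ht
    obtain ⟨hzD, hzg⟩ := hz t ht
    obtain ⟨Le, hLe⟩ := exists_hessEquiv hS hzD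
    refine ⟨Le.symm (p' t), ?_, ?_⟩
    · rw [← hLe]; exact Le.apply_symm_apply _
    · have h1 := hasFDerivWithinAt_gradientInv hS hzD hLe
      rw [hzg] at h1
      have h2 : HasDerivWithinAt z (Le.symm (p' t)) (Set.Icc 0 1) t :=
        h1.comp_hasDerivWithinAt t (hpd t ht).hasDerivWithinAt hpP
      exact (hasFDerivAt_param hzD).comp_hasDerivWithinAt t h2
  choose! zd hzd1 hzd2 using hz'
  have h01 : (0 : ℝ) ∈ Set.Icc (0 : ℝ) 1 := by simp
  have h11 : (1 : ℝ) ∈ Set.Icc (0 : ℝ) 1 := by simp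
  have hz0 : z 0 = x := by
    have : p 0 = g := by simp [p, b, r, smul_smul, inv_mul_cancel₀ hαp.ne']
    simp only [z, this, hg, gradientInv_gradient hS hx]
  have hz1 : z 1 = y := by
    have : p 1 = h := by
      simp only [p, b, r, one_smul, one_mul, add_sub_cancel, smul_smul, inv_mul_cancel₀ hβp.ne']
    simp only [z, this, hh, gradientInv_gradient hS hy]
  have hderiv : ∀ t ∈ Set.Icc (0 : ℝ) 1, HasDerivWithinAt (fun t => ⟪S.param (z t), ξ⟫)
      ⟪S.tangentMap (z t) (zd t), ξ⟫ (Set.Icc 0 1) t := by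
    intro t ht
    have := (hzd2 t ht).inner ℝ (hasDerivWithinAt_const t (Set.Icc 0 1) ξ)
    simpa using this
  -- The mean value theorem is scalar, which is why a test vector ξ is fixed beforehand and the
  -- intermediate point depends on it.
  obtain ⟨t, ht, hslope⟩ := exists_hasDerivAt_eq_slope (fun t => ⟪S.param (z t), ξ⟫)
    (fun t => ⟪S.tangentMap (z t) (zd t), ξ⟫) zero_lt_one
    (fun t ht => (hderiv t ht).continuousWithinAt)
    (fun t ht => (hderiv t (Set.Ioo_subset_Icc_self ht)).hasDerivAt (Icc_mem_nhds ht.1 ht.2))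
  have htI := Set.Ioo_subset_Icc_self ht
  have hbt := (hb t htI).ne'
  have hrt : r t = b t • p t := by simp only [p, smul_smul, mul_inv_cancel₀ hbt, one_smul]
  refine ⟨t, ht, z t, (hz t htI).1, zd t, b t, hb t htI, ?_, ?_, ?_⟩
  · rw [gaussMap_param, gaussMap_param, normal, normal, normal, (hz t htI).2, smul_sub (b t),
      ← map_smul, ← hrt]
    simp only [r, b, map_add, map_smul, map_sub, ← hα, ← hβ, ← hg, ← hh]
    module
  · intro w
    have h1 : S.gaussMap (S.param y) - S.gaussMap (S.param x) =
        b t • S.frame (p' t) + (β - α) • S.normal (z t) := by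
      rw [gaussMap_param, gaussMap_param, normal, normal, normal, (hz t htI).2, ← map_smul]
      simp only [p', smul_smul, mul_inv_cancel₀ hbt, one_smul, map_sub, map_smul, ← hα, ← hβ,
        ← hg, ← hh]
      module
    rw [h1, inner_add_right, inner_smul_right, inner_smul_right, inner_tangentMap_normal,
      hzd1 t htI, mul_zero, add_zero, tangentMap_apply]
    have := S.inner_frame_add_smul w (p' t) ⟪gradient S.φ (z t), w⟫ 0
    rw [zero_smul, add_zero, mul_zero, add_zero] at this
    rw [this, real_inner_comm]
  · rw [hslope, hz0, hz1, inner_sub_left]; simp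

theorem hess_cauchy_schwarz (hS : S.IsAdmissible) {x : 𝔼} (hx : x ∈ S.D) (v w : 𝔼) :
    ⟪S.hess x v, w⟫ ^ 2 ≤ ⟪S.hess x v, v⟫ * ⟪S.hess x w, w⟫ := by
  have h : ∀ t : ℝ, 0 ≤ ⟪S.hess x w, w⟫ * (t * t) + (2 * ⟪S.hess x v, w⟫) * t +
      ⟪S.hess x v, v⟫ := by
    intro t
    have h1 : 0 ≤ ⟪S.hess x (v + t • w), v + t • w⟫ := by
      rcases eq_or_ne (v + t • w) 0 with h | h
      · rw [h, inner_zero_right]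
      · exact (hess_pos hS hx h).le
    simp only [map_add, map_smul, inner_add_left, inner_add_right, inner_smul_left,
      inner_smul_right, hess_symm hx w v, RCLike.conj_to_real] at h1
    linarith
  have := discrim_le_zero h
  rw [discrim] at this
  linarith

set_option maxHeartbeats 1000000 in
/-- The three pointwise estimates on the velocity `T` along an arc between unit normals `N₁, N₂`,
in terms of the curvature bounds. -/
theorem velocity_estimates (hS : S.IsAdmissible) {lam Lam : ℝ} (hb : S.CurvatureBounds lam Lam)
    {N₁ N₂ : 𝕍} (hN₁ : ‖N₁‖ = 1) (hN₂ : ‖N₂‖ = 1) (hN : 1 / 2 ≤ ⟪N₁, N₂⟫) {t : ℝ}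
    (ht : t ∈ Set.Ioo (0 : ℝ) 1) {z z' : 𝔼} (hz : z ∈ S.D) {c : ℝ} (hc : 0 < c)
    (hcomb : (1 - t) • N₁ + t • N₂ = c • S.normal z)
    (hH : ∀ w, ⟪S.tangentMap z w, N₂ - N₁⟫ = c * ⟪S.hess z z', w⟫) :
    3 / 4 * lam * ‖S.tangentMap z z'‖ ≤ ‖N₂ - N₁‖ ∧
    2 / 3 * ‖N₂ - N₁‖ ^ 2 ≤ Lam * ⟪S.tangentMap z z', N₂ - N₁⟫ ∧
    ⟪S.tangentMap z z', N₁⟫ = -t * ⟪S.tangentMap z z', N₂ - N₁⟫ := by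
  obtain ⟨ht0, ht1⟩ := ht
  have hlam := hb.pos
  have hLam := hb.pos.trans_le hb.le
  have hap := S.areaElement_pos z
  set a := S.areaElement z with ha
  set v := N₂ - N₁ with hv
  set κ := ⟪N₁, N₂⟫ with hκ
  have h11 : ⟪N₁, N₁⟫ = (1 : ℝ) := by rw [real_inner_self_eq_norm_sq, hN₁]; norm_num
  have h22 : ⟪N₂, N₂⟫ = (1 : ℝ) := by rw [real_inner_self_eq_norm_sq, hN₂]; norm_num
  have h21 : ⟪N₂, N₁⟫ = κ := real_inner_comm _ _
  have hκ1 : κ ≤ 1 := by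
    have := real_inner_le_norm N₁ N₂
    rw [hN₁, hN₂] at this; linarith
  have hv2 : ‖v‖ ^ 2 = 2 - 2 * κ := by
    rw [← real_inner_self_eq_norm_sq, hv, inner_sub_left, inner_sub_right, inner_sub_right,
      h11, h22, h21, ← hκ]; ring
  -- `c * a` is the length of the chord point. The cone condition κ ≥ 1/2 keeps its square in [3/4,
  -- 1], which is the source of all numerical constants here.
  have hca : (c * a) ^ 2 = 1 - t * (1 - t) * (2 - 2 * κ) := by
    have h1 : ‖c • S.normal z‖ ^ 2 = (c * a) ^ 2 := by
      rw [norm_smul, norm_normal, Real.norm_of_nonneg hc.le]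
    rw [← h1, ← hcomb, ← real_inner_self_eq_norm_sq]
    simp only [inner_add_left, inner_add_right, inner_smul_left, inner_smul_right, h11, h22, h21,
      ← hκ, RCLike.conj_to_real]
    ring
  have hcap : 0 < c * a := mul_pos hc hap
  have htt : t * (1 - t) ≤ 1 / 4 := by nlinarith only [sq_nonneg (2 * t - 1)]
  have htt0 : 0 < t * (1 - t) := mul_pos ht0 (by linarith)
  have hcalow : 3 / 4 ≤ (c * a) ^ 2 := by rw [hca]; nlinarith only [htt, htt0, hκ1, hN]
  have hcahigh : (c * a) ^ 2 ≤ 1 := by rw [hca]; nlinarith only [htt0, hκ1]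
  have hca34 : 3 / 4 ≤ c * a := by nlinarith only [hcalow, hcap]
  have hca1 : c * a ≤ 1 := by nlinarith only [hcahigh, hcap]
  have hform : ∀ w, c * ⟪S.hess z w, w⟫ = (c * a) * (a⁻¹ * ⟪S.hess z w, w⟫) := by
    intro w; field_simp
  have hT := hH z'
  refine ⟨?_, ?_, ?_⟩
  · have h1 : 3 / 4 * (lam * ‖S.tangentMap z z'‖ ^ 2) ≤ ⟪S.tangentMap z z', v⟫ := by
      rw [hT, hform]
      exact mul_le_mul hca34 (hb.lower z hz z') (by positivity) hcap.le
    have h2 := real_inner_le_norm (S.tangentMap z z') v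
    rcases eq_or_lt_of_le (norm_nonneg (S.tangentMap z z')) with h0 | h0
    · rw [← h0, mul_zero]; exact norm_nonneg _
    · refine le_of_mul_le_mul_left ?_ h0
      linarith
  -- Subtracting `m` times the chord point projects `v = N₂ - N₁` to the tangent space at `z`; the
  -- projection keeps at least 2/3 of the squared length. Cauchy–Schwarz for the Hessian form,
  -- applied to the velocity and this projection, then gives the second estimate.
  · let m := (c * a)⁻¹ ^ 2 * ⟪v, c • S.normal z⟫
    have hnn : ⟪S.normal z, S.normal z⟫ = a ^ 2 := by
      rw [real_inner_self_eq_norm_sq, norm_normal]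
    have horth : ⟪v - m • (c • S.normal z), S.normal z⟫ = 0 := by
      simp only [m, inner_sub_left, inner_smul_left, inner_smul_right, RCLike.conj_to_real, hnn]
      field_simp
      ring
    obtain ⟨w, hw⟩ := S.exists_tangentMap_eq horth
    have hvn : ⟪v, c • S.normal z⟫ = (2 * t - 1) * (1 - κ) := by
      rw [← hcomb, hv]
      simp only [inner_sub_left, inner_add_right, inner_smul_right, h11, h22, h21, ← hκ]
      ring
    have hw2 : ‖S.tangentMap z w‖ ^ 2 = ⟪S.tangentMap z w, v⟫ := by
      rw [← real_inner_self_eq_norm_sq]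
      nth_rw 2 [hw]
      rw [inner_sub_right, inner_smul_right, inner_smul_right, inner_tangentMap_normal]; ring
    have hw3 : 2 / 3 * ‖v‖ ^ 2 ≤ ‖S.tangentMap z w‖ ^ 2 := by
      rw [hw2, hw, inner_sub_left, real_inner_self_eq_norm_sq, inner_smul_left,
        real_inner_comm v (c • S.normal z), RCLike.conj_to_real]
      simp only [m]
      rw [hvn, inv_pow, hv2]
      have h1 : ((c * a) ^ 2)⁻¹ ≤ 4 / 3 := by
        rw [inv_le_comm₀ (by positivity) (by norm_num)]; linarith
      have h2 : ((2 * t - 1) * (1 - κ)) ^ 2 ≤ (1 - κ) / 2 := by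
        have e1 : (2 * t - 1) ^ 2 ≤ 1 := by nlinarith only [htt0]
        have e2 : (1 - κ) ^ 2 ≤ (1 - κ) / 2 := by nlinarith only [hκ1, hN]
        rw [mul_pow]
        calc (2 * t - 1) ^ 2 * (1 - κ) ^ 2 ≤ 1 * ((1 - κ) / 2) :=
              mul_le_mul e1 e2 (sq_nonneg _) zero_le_one
          _ = _ := one_mul _
      have h3 : ((c * a) ^ 2)⁻¹ * ((2 * t - 1) * (1 - κ)) ^ 2 ≤ 4 / 3 * ((1 - κ) / 2) :=
        mul_le_mul h1 h2 (sq_nonneg _) (by norm_num)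
      have h4 : (((c * a) ^ 2)⁻¹ * ((2 * t - 1) * (1 - κ))) * ((2 * t - 1) * (1 - κ)) =
        ((c * a) ^ 2)⁻¹ * ((2 * t - 1) * (1 - κ)) ^ 2 := by ring
      rw [h4]
      linarith
    have h4 := hess_cauchy_schwarz hS hz z' w
    have h5 : c * ⟪S.hess z w, w⟫ ≤ Lam * ‖S.tangentMap z w‖ ^ 2 := by
      rw [hform]
      have := hb.upper z hz w
      have h6 : 0 ≤ Lam * ‖S.tangentMap z w‖ ^ 2 := by positivity
      calc (c * a) * (a⁻¹ * ⟪S.hess z w, w⟫) ≤ (c * a) * (Lam * ‖S.tangentMap z w‖ ^ 2) :=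
            mul_le_mul_of_nonneg_left this hcap.le
        _ ≤ _ := mul_le_of_le_one_left h6 hca1
    have h6 := hH w
    rw [← hw2] at h6
    have hTnn : 0 ≤ ⟪S.tangentMap z z', v⟫ := by
      rw [hT]
      rcases eq_or_ne z' 0 with h | h
      · simp [h]
      · exact (mul_pos hc (hess_pos hS hz h)).le
    have h7 : (‖S.tangentMap z w‖ ^ 2) ^ 2 ≤
        ⟪S.tangentMap z z', v⟫ * (Lam * ‖S.tangentMap z w‖ ^ 2) := by
      calc (‖S.tangentMap z w‖ ^ 2) ^ 2 = c ^ 2 * ⟪S.hess z z', w⟫ ^ 2 := by rw [h6]; ring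
        _ ≤ c ^ 2 * (⟪S.hess z z', z'⟫ * ⟪S.hess z w, w⟫) :=
          mul_le_mul_of_nonneg_left h4 (sq_nonneg _)
        _ = ⟪S.tangentMap z z', v⟫ * (c * ⟪S.hess z w, w⟫) := by rw [hT]; ring
        _ ≤ _ := mul_le_mul_of_nonneg_left h5 hTnn
    refine hw3.trans ?_
    rcases eq_or_lt_of_le (sq_nonneg ‖S.tangentMap z w‖) with h0 | h0
    · rw [← h0]; exact mul_nonneg hLam.le hTnn
    · refine le_of_mul_le_mul_right ?_ h0
      linarith
  -- The velocity is orthogonal to the chord point N₁ + t (N₂ - N₁).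
  · have h1 : ⟪S.tangentMap z z', c • S.normal z⟫ = 0 := by
      rw [inner_smul_right, inner_tangentMap_normal, mul_zero]
    rw [← hcomb, inner_add_right, inner_smul_right, inner_smul_right] at h1
    rw [hv, inner_sub_right]
    linarith

theorem norm_param_sub_le (hS : S.IsAdmissible) {lam Lam : ℝ} (hb : S.CurvatureBounds lam Lam)
    {x y : 𝔼} (hx : x ∈ S.D) (hy : y ∈ S.D) :
    3 / 4 * lam * ‖S.param y - S.param x‖ ≤
      ‖S.gaussMap (S.param y) - S.gaussMap (S.param x)‖ := by
  obtain ⟨t, ht, z, hz, z', c, hc, h1, h2, h3⟩ :=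
    exists_mean_value_on_arc hS hx hy (S.param y - S.param x)
  have h := (velocity_estimates hS hb (S.norm_gaussMap _) (S.norm_gaussMap _)
    (hS.cone _ ⟨x, hx, rfl⟩ _ ⟨y, hy, rfl⟩) ht hz hc h1 h2).1
  refine le_trans (mul_le_mul_of_nonneg_left ?_ (by have := hb.pos; positivity)) h
  have h4 := real_inner_le_norm (S.tangentMap z z') (S.param y - S.param x)
  rw [h3, real_inner_self_eq_norm_sq] at h4
  rcases eq_or_lt_of_le (norm_nonneg (S.param y - S.param x)) with h0 | h0
  · rw [← h0]; exact norm_nonneg _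
  · refine le_of_mul_le_mul_right ?_ h0
    nlinarith

theorem inner_param_sub_gaussMap_sub_ge (hS : S.IsAdmissible) {lam Lam : ℝ}
    (hb : S.CurvatureBounds lam Lam)
    {x y : 𝔼} (hx : x ∈ S.D) (hy : y ∈ S.D) :
    2 / 3 * ‖S.gaussMap (S.param y) - S.gaussMap (S.param x)‖ ^ 2 ≤
      Lam * ⟪S.param y - S.param x, S.gaussMap (S.param y) - S.gaussMap (S.param x)⟫ := by
  obtain ⟨t, ht, z, hz, z', c, hc, h1, h2, h3⟩ :=
    exists_mean_value_on_arc hS hx hy (S.gaussMap (S.param y) - S.gaussMap (S.param x))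
  rw [← h3]
  exact (velocity_estimates hS hb (S.norm_gaussMap _) (S.norm_gaussMap _)
    (hS.cone _ ⟨x, hx, rfl⟩ _ ⟨y, hy, rfl⟩) ht hz hc h1 h2).2.1

theorem norm_gaussMap_sub_le (hS : S.IsAdmissible) {lam Lam : ℝ} (hb : S.CurvatureBounds lam Lam)
    {x y : 𝔼} (hx : x ∈ S.D) (hy : y ∈ S.D) :
    2 / 3 * ‖S.gaussMap (S.param y) - S.gaussMap (S.param x)‖ ≤
      Lam * ‖S.param y - S.param x‖ := by
  have hLam := hb.pos.trans_le hb.le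
  have h1 := inner_param_sub_gaussMap_sub_ge hS hb hx hy
  have h2 := real_inner_le_norm (S.param y - S.param x)
    (S.gaussMap (S.param y) - S.gaussMap (S.param x))
  rcases eq_or_lt_of_le (norm_nonneg (S.gaussMap (S.param y) - S.gaussMap (S.param x)))
    with h0 | h0
  · rw [← h0, mul_zero]; positivity
  · refine le_of_mul_le_mul_right ?_ h0
    nlinarith

/-- Strict convexity: the hypersurface lies strictly on one side of its tangent planes. -/
theorem inner_param_sub_gaussMap_neg (hS : S.IsAdmissible) {lam Lam : ℝ}
    (hb : S.CurvatureBounds lam Lam)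
    {x y : 𝔼} (hx : x ∈ S.D) (hy : y ∈ S.D)
    (hxy : x ≠ y) :
    ⟪S.param y - S.param x, S.gaussMap (S.param x)⟫ < 0 := by
  obtain ⟨t, ht, z, hz, z', c, hc, h1, h2, h3⟩ :=
    exists_mean_value_on_arc hS hx hy (S.gaussMap (S.param x))
  obtain ⟨-, h4, h5⟩ := velocity_estimates hS hb (S.norm_gaussMap _) (S.norm_gaussMap _)
    (hS.cone _ ⟨x, hx, rfl⟩ _ ⟨y, hy, rfl⟩) ht hz hc h1 h2
  rw [← h3, h5]
  have h6 : S.gaussMap (S.param y) - S.gaussMap (S.param x) ≠ 0 := by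
    intro h
    exact hxy (S.param_injective
      (hS.injOn_gaussMap ⟨x, hx, rfl⟩ ⟨y, hy, rfl⟩ (sub_eq_zero.1 h).symm))
  have h7 : 0 < 2 / 3 * ‖S.gaussMap (S.param y) - S.gaussMap (S.param x)‖ ^ 2 := by
    have := norm_pos_iff.2 h6
    positivity
  have h8 := pos_of_mul_pos_right (h7.trans_le h4) (hb.pos.trans_le hb.le).le
  nlinarith [ht.1]

theorem inner_param_sub_normal_neg (hS : S.IsAdmissible) {lam Lam : ℝ}
    (hb : S.CurvatureBounds lam Lam)
    {x y : 𝔼} (hx : x ∈ S.D) (hy : y ∈ S.D)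
    (hxy : x ≠ y) :
    ⟪S.param y - S.param x, S.normal x⟫ < 0 := by
  have := inner_param_sub_gaussMap_neg hS hb hx hy hxy
  rw [gaussMap_param, inner_smul_right] at this
  exact neg_of_mul_neg_right this (inv_pos.2 (S.areaElement_pos x)).le

/-! ### The reflection as the inverse of an explicit map -/

variable (S) in
/-- The (rescaled) distance from the point over `y` to the tangent plane at the point over `x`. -/
def supportGap (x y : 𝔼) : ℝ := ⟪S.param x - S.param y, S.normal x⟫

variable (S) in
/-- The gradient on the segment between those at `x` and `y` whose normal is orthogonal to the
chord joining the points over `x` and `y`. -/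
def midGradient (x y : 𝔼) : 𝔼 := gradient S.φ x +
  (S.supportGap x y / (S.supportGap x y + S.supportGap y x)) • (gradient S.φ y - gradient S.φ x)

variable (S) in
/-- The map `u'' ↦ u` inverse to `u ↦ R_u u'` (with `u'` over `x`), in graph coordinates. -/
def mid (x y : 𝔼) : 𝔼 := S.gradientInv (S.midGradient x y)

theorem supportGap_pos (hS : S.IsAdmissible) {lam Lam : ℝ} (hb : S.CurvatureBounds lam Lam)
    {x y : 𝔼} (hx : x ∈ S.D) (hy : y ∈ S.D) (hxy : x ≠ y) : 0 < S.supportGap x y := by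
  have := inner_param_sub_normal_neg hS hb hx hy hxy
  rw [← neg_sub, inner_neg_left] at this
  rw [supportGap]; linarith

theorem normal_sub_normal (x y : 𝔼) :
    S.normal y - S.normal x = S.frame (gradient S.φ y - gradient S.φ x) := by
  simp [normal]

theorem supportGap_add (x y : 𝔼) :
    S.supportGap x y + S.supportGap y x = ⟪y - x, gradient S.φ y - gradient S.φ x⟫ := by
  have h1 : S.supportGap x y + S.supportGap y x =
      ⟪S.param y - S.param x, S.normal y - S.normal x⟫ := by
    rw [supportGap, supportGap, ← neg_sub (S.param y), inner_neg_left, inner_sub_right]; ring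
  rw [h1, normal_sub_normal, real_inner_comm, ← inner_coord, map_sub, coord_param, coord_param,
    real_inner_comm]

theorem normal_eq_of_gradient_eq {x y z : 𝔼} {t : ℝ}
    (h : gradient S.φ z = gradient S.φ x + t • (gradient S.φ y - gradient S.φ x)) :
    S.normal z = S.normal x + t • (S.normal y - S.normal x) := by
  rw [normal_sub_normal, normal, normal, h, map_add, map_smul]; abel

theorem inner_e_normal (x : 𝔼) : ⟪S.e, S.normal x⟫ = -1 := by
  have := S.inner_frame_add_smul 0 (gradient S.φ x) 1 (-1)
  rw [← normal_eq] at this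
  simpa using this

theorem coord_normal (x : 𝔼) : S.coord (S.normal x) = gradient S.φ x := by
  simp [normal]

theorem not_linearIndependent_gaussMap {x y z : 𝔼} {t : ℝ}
    (h : S.normal x = S.normal y + t • (S.normal z - S.normal y)) :
    ¬ LinearIndependent ℝ
      ![S.gaussMap (S.param x), S.gaussMap (S.param y), S.gaussMap (S.param z)] := by
  intro hli
  rw [Fintype.linearIndependent_iff] at hli
  have := hli ![S.areaElement x, -(1 - t) * S.areaElement y, -t * S.areaElement z] (by
    simp only [Fin.sum_univ_three, Matrix.cons_val, gaussMap_param, smul_smul, mul_assoc,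
      mul_inv_cancel₀ (S.areaElement_pos _).ne', h]
    module) 0
  exact (S.areaElement_pos x).ne' this

/-- All unnormalised normals have `e`-component -1, so a linear relation between them has
coefficients of sum zero, that is, it is an affine relation. The coefficient at `x` is nonzero since
the normals at `y` and `z` differ. -/
theorem exists_normal_eq_of_not_linearIndependent (hS : S.IsAdmissible) {x y z : 𝔼}
    (hy : y ∈ S.D) (hz : z ∈ S.D) (hyz : z ≠ y)
    (h : ¬ LinearIndependent ℝ
      ![S.gaussMap (S.param x), S.gaussMap (S.param y), S.gaussMap (S.param z)]) :
    ∃ t : ℝ, S.normal x = S.normal y + t • (S.normal z - S.normal y) := by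
  rw [Fintype.not_linearIndependent_iff] at h
  obtain ⟨c, hc, i, hi⟩ := h
  simp only [Fin.sum_univ_three, Matrix.cons_val, gaussMap_param, smul_smul] at hc
  set α := c 0 * (S.areaElement x)⁻¹ with hα
  set β := c 1 * (S.areaElement y)⁻¹ with hβ
  set γ := c 2 * (S.areaElement z)⁻¹ with hγ
  have hsum : α + β + γ = 0 := by
    have := congrArg (fun v => ⟪S.e, v⟫) hc
    simp only [inner_add_right, inner_smul_right, inner_e_normal, inner_zero_right] at this
    linarith
  have hα0 : α ≠ 0 := by
    intro h0
    have hβγ : β = -γ := by linarith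
    rw [h0, hβγ, zero_smul, zero_add, neg_smul, neg_add_eq_sub, ← smul_sub, smul_eq_zero] at hc
    have hγ0 : γ = 0 := by
      refine hc.resolve_right fun h1 => hyz (injOn_gradient hS hz hy ?_)
      rw [← coord_normal, ← coord_normal, sub_eq_zero.1 h1]
    have hne : ∀ w, (S.areaElement w)⁻¹ ≠ 0 := fun w => inv_ne_zero (S.areaElement_pos w).ne'
    rw [hγ0, neg_zero] at hβγ
    have h0' : c 0 = 0 := (mul_eq_zero.1 h0).resolve_right (hne x)
    have h1' : c 1 = 0 := (mul_eq_zero.1 hβγ).resolve_right (hne y)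
    have h2' : c 2 = 0 := (mul_eq_zero.1 hγ0).resolve_right (hne z)
    fin_cases i
    · exact hi h0'
    · exact hi h1'
    · exact hi h2'
  refine ⟨-γ / α, ?_⟩
  have hβ' : β = -α - γ := by linarith
  have h2 : S.normal x = α⁻¹ • (α • S.normal x) := by
    rw [smul_smul, inv_mul_cancel₀ hα0, one_smul]
  have h3 : α • S.normal x = (α + γ) • S.normal y - γ • S.normal z := by
    rw [hβ'] at hc
    rw [← sub_eq_zero, ← hc]
    module
  rw [h2, h3]
  have : α⁻¹ • (α + γ) • S.normal y = S.normal y + (γ / α) • S.normal y := by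
    rw [smul_smul, mul_add, inv_mul_cancel₀ hα0, add_smul, one_smul, div_eq_inv_mul]
  rw [smul_sub, this, smul_smul, ← div_eq_inv_mul]
  module

/-- Dependence of the normals puts the normal at `x` on the line through those at `y` and `z`, with
some parameter t. With a, b the two support gaps, the chord is orthogonal to it exactly when a - t
(a + b) = 0, and a + b > 0 by strict convexity. -/
theorem isReflection_iff (hS : S.IsAdmissible) {lam Lam : ℝ} (hb : S.CurvatureBounds lam Lam)
    {x y z : 𝔼} (hy : y ∈ S.D) (hz : z ∈ S.D) :
    S.IsReflection (S.param x) (S.param y) (S.param z) ↔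
      z ≠ y ∧ gradient S.φ x = S.midGradient y z := by
  have hexp : ∀ t : ℝ, S.normal x = S.normal y + t • (S.normal z - S.normal y) →
      ⟪S.param y - S.param z, S.gaussMap (S.param x)⟫ = (S.areaElement x)⁻¹ *
        (S.supportGap y z - t * (S.supportGap y z + S.supportGap z y)) := by
    intro t ht
    rw [gaussMap_param, inner_smul_right, ht, inner_add_right, inner_smul_right, inner_sub_right,
      supportGap, supportGap, ← neg_sub (S.param y) (S.param z), inner_neg_left]
    ring
  constructor
  · rintro ⟨-, h1, h2, h3⟩
    have hzy : z ≠ y := fun h => h1 (by rw [h])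
    refine ⟨hzy, ?_⟩
    obtain ⟨t, ht⟩ := exists_normal_eq_of_not_linearIndependent hS hy hz hzy h3
    rw [hexp t ht, mul_eq_zero, or_iff_right (inv_ne_zero (S.areaElement_pos x).ne')] at h2
    have hpos := add_pos (supportGap_pos hS hb hy hz hzy.symm) (supportGap_pos hS hb hz hy hzy)
    have ht' : t = S.supportGap y z / (S.supportGap y z + S.supportGap z y) := by
      rw [eq_div_iff hpos.ne']; linarith
    have := congrArg S.coord ht
    simpa only [map_add, map_smul, map_sub, coord_normal, ht', midGradient] using this
  · rintro ⟨hzy, h⟩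
    have hn := normal_eq_of_gradient_eq h
    have hpos := add_pos (supportGap_pos hS hb hy hz hzy.symm) (supportGap_pos hS hb hz hy hzy)
    refine ⟨⟨z, hz, rfl⟩, fun h => hzy (S.param_injective h), ?_,
      not_linearIndependent_gaussMap hn⟩
    rw [hexp _ hn, div_mul_cancel₀ _ hpos.ne', sub_self, mul_zero]

/-- The parameter of `midGradient` on the segment. -/
theorem exists_midGradient_eq (hS : S.IsAdmissible) {lam Lam : ℝ} (hb : S.CurvatureBounds lam Lam)
    {y z : 𝔼} (hy : y ∈ S.D) (hz : z ∈ S.D) (hzy : z ≠ y) : ∃ t ∈ Set.Ioo (0 : ℝ) 1,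
      S.midGradient y z = gradient S.φ y + t • (gradient S.φ z - gradient S.φ y) := by
  have h1 := supportGap_pos hS hb hy hz hzy.symm
  have h2 := supportGap_pos hS hb hz hy hzy
  exact ⟨_, ⟨by positivity, (div_lt_one (by positivity)).2 (by linarith)⟩, rfl⟩

theorem midGradient_mem (hS : S.IsAdmissible) {lam Lam : ℝ} (hb : S.CurvatureBounds lam Lam)
    {y z : 𝔼} (hy : y ∈ S.D) (hz : z ∈ S.D) (hzy : z ≠ y) :
    S.midGradient y z ∈ S.gradientImage := by
  obtain ⟨t, ht, h⟩ := exists_midGradient_eq hS hb hy hz hzy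
  rw [h]
  exact (convex_gradientImage hS).add_smul_sub_mem ⟨y, hy, rfl⟩ ⟨z, hz, rfl⟩
    (Set.Ioo_subset_Icc_self ht)

theorem mid_mem (hS : S.IsAdmissible) {lam Lam : ℝ} (hb : S.CurvatureBounds lam Lam)
    {y z : 𝔼} (hy : y ∈ S.D) (hz : z ∈ S.D) (hzy : z ≠ y) : S.mid y z ∈ S.D :=
  gradientInv_mem (midGradient_mem hS hb hy hz hzy)

theorem gradient_mid (hS : S.IsAdmissible) {lam Lam : ℝ} (hb : S.CurvatureBounds lam Lam)
    {y z : 𝔼} (hy : y ∈ S.D) (hz : z ∈ S.D) (hzy : z ≠ y) :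
    gradient S.φ (S.mid y z) = S.midGradient y z :=
  gradient_gradientInv (midGradient_mem hS hb hy hz hzy)

theorem eq_mid_iff (hS : S.IsAdmissible) {lam Lam : ℝ} (hb : S.CurvatureBounds lam Lam)
    {x y z : 𝔼} (hx : x ∈ S.D) (hy : y ∈ S.D) (hz : z ∈ S.D) (hzy : z ≠ y) :
    S.mid y z = x ↔ gradient S.φ x = S.midGradient y z := by
  constructor
  · rintro rfl
    exact gradient_mid hS hb hy hz hzy
  · intro h
    rw [mid, ← h, gradientInv_gradient hS hx]

theorem mid_ne (hS : S.IsAdmissible) {lam Lam : ℝ} (hb : S.CurvatureBounds lam Lam)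
    {y z : 𝔼} (hy : y ∈ S.D) (hz : z ∈ S.D) (hzy : z ≠ y) : S.mid y z ≠ y := by
  intro h
  obtain ⟨t, ht, ht'⟩ := exists_midGradient_eq hS hb hy hz hzy
  rw [eq_mid_iff hS hb hy hy hz hzy, ht'] at h
  have h1 : t • (gradient S.φ z - gradient S.φ y) = 0 := by
    have := h.symm; rwa [add_eq_left] at this
  exact hzy (injOn_gradient hS hz hy (sub_eq_zero.1 ((smul_eq_zero.1 h1).resolve_left ht.1.ne')))

/-- This is the uniqueness of R_u u'. If z₁ and z₂ both reflect `y` in the same `x`, their chord is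
orthogonal to the normal n_x, and each n_{z_i} is n_x plus a positive multiple of n_x - n_y. Strict
convexity at z₁ and at z₂ then assigns opposite signs to the pairing of the chord with n_x - n_y. -/
theorem mid_injOn (hS : S.IsAdmissible) {lam Lam : ℝ} (hb : S.CurvatureBounds lam Lam)
    {y : 𝔼} (hy : y ∈ S.D) : Set.InjOn (S.mid y) (S.D \ {y}) := by
  have key : ∀ {x z₁ z₂ : 𝔼}, z₁ ∈ S.D → z₂ ∈ S.D → z₁ ≠ z₂ → ∀ {s₁ s₂ : ℝ}, 0 < s₁ → s₁ ≤ s₂ →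
      S.normal z₁ = S.normal x + s₁ • (S.normal x - S.normal y) →
      S.normal z₂ = S.normal x + s₂ • (S.normal x - S.normal y) →
      ⟪S.param z₂ - S.param z₁, S.normal x⟫ ≠ 0 := by
    intro x z₁ z₂ hz₁ hz₂ hne s₁ s₂ hs₁ hs h₁ h₂ h0
    have hlt : s₁ < s₂ := by
      refine lt_of_le_of_ne hs fun h => hne (injOn_gradient hS hz₁ hz₂ ?_)
      rw [← coord_normal, ← coord_normal, h₁, h₂, h]
    have e1 := inner_param_sub_normal_neg hS hb hz₁ hz₂ hne
    have e2 := inner_param_sub_normal_neg hS hb hz₂ hz₁ hne.symm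
    rw [← neg_sub (S.param z₂), inner_neg_left] at e2
    rw [h₁, inner_add_right, h0, zero_add, inner_smul_right] at e1
    rw [h₂, inner_add_right, h0, zero_add, inner_smul_right] at e2
    have e3 : ⟪S.param z₂ - S.param z₁, S.normal x - S.normal y⟫ < 0 :=
      neg_of_mul_neg_right e1 hs₁.le
    nlinarith
  rintro z₁ ⟨hz₁, hy₁⟩ z₂ ⟨hz₂, hy₂⟩ h
  by_contra hne
  have hx := mid_mem hS hb hy hz₁ hy₁
  have g₁ := (eq_mid_iff hS hb hx hy hz₁ hy₁).1 rfl
  have g₂ := (eq_mid_iff hS hb hx hy hz₂ hy₂).1 h.symm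
  set x := S.mid y z₁
  have r₁ := ((isReflection_iff hS hb hy hz₁).2 ⟨hy₁, g₁⟩).2.2.1
  have r₂ := ((isReflection_iff hS hb hy hz₂).2 ⟨hy₂, g₂⟩).2.2.1
  rw [gaussMap_param, inner_smul_right, mul_eq_zero,
    or_iff_right (inv_ne_zero (S.areaElement_pos x).ne')] at r₁ r₂
  have h12 : ⟪S.param z₂ - S.param z₁, S.normal x⟫ = 0 := by
    have : S.param z₂ - S.param z₁ = (S.param y - S.param z₁) - (S.param y - S.param z₂) := by abel
    rw [this, inner_sub_left, r₁, r₂, sub_zero]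
  have hs : ∀ {z}, z ∈ S.D → z ≠ y → gradient S.φ x = S.midGradient y z →
      ∃ s : ℝ, 0 < s ∧ S.normal z = S.normal x + s • (S.normal x - S.normal y) := by
    intro z hz hzy hg
    obtain ⟨t, ht, ht'⟩ := exists_midGradient_eq hS hb hy hz hzy
    rw [ht'] at hg
    have hn := normal_eq_of_gradient_eq hg
    have ht0 := ht.1
    have ht1 := ht.2
    -- Solve n_x = n_y + t (n_z - n_y) for n_z.
    refine ⟨(1 - t) / t, div_pos (by linarith) ht0, ?_⟩
    rw [hn]
    have e : (1 - t) / t * t = 1 - t := by field_simp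
    rw [add_sub_cancel_left, smul_smul, e]
    module
  obtain ⟨s₁, hs₁, e₁⟩ := hs hz₁ hy₁ g₁
  obtain ⟨s₂, hs₂, e₂⟩ := hs hz₂ hy₂ g₂
  rcases le_total s₁ s₂ with hle | hle
  · exact key hz₁ hz₂ hne hs₁ hle e₁ e₂ h12
  · refine key hz₂ hz₁ (Ne.symm hne) hs₂ hle e₂ e₁ ?_
    rw [← neg_sub, inner_neg_left, h12, neg_zero]

/-- By injectivity of `mid`, the point chosen in the definition of `reflection` is the only
candidate. -/
theorem reflection_mid (hS : S.IsAdmissible) {lam Lam : ℝ} (hb : S.CurvatureBounds lam Lam)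
    {y z : 𝔼} (hy : y ∈ S.D) (hz : z ∈ S.D) (hzy : z ≠ y) :
    S.reflection (S.param (S.mid y z)) (S.param y) = S.param z := by
  have hx := mid_mem hS hb hy hz hzy
  have hex : ∃ u, S.IsReflection (S.param (S.mid y z)) (S.param y) u :=
    ⟨_, (isReflection_iff hS hb hy hz).2 ⟨hzy, gradient_mid hS hb hy hz hzy⟩⟩
  rw [reflection, if_neg fun h => mid_ne hS hb hy hz hzy (S.param_injective h).symm, dif_pos hex]
  have hspec := hex.choose_spec
  obtain ⟨z', hz', h⟩ := hspec.1
  rw [← h] at hspec ⊢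
  obtain ⟨h1, h2⟩ := (isReflection_iff hS hb hy hz').1 hspec
  rw [mid_injOn hS hb hy ⟨hz', h1⟩ ⟨hz, hzy⟩ ((eq_mid_iff hS hb hx hy hz' h1).2 h2)]

theorem exists_mid_eq (hS : S.IsAdmissible) {lam Lam : ℝ} (hb : S.CurvatureBounds lam Lam)
    {x y : 𝔼} (hx : x ∈ S.D) (hy : y ∈ S.D) (hxy : x ≠ y)
    (h : S.param y ∈ S.reflectionDomain (S.param x)) :
    ∃ z ∈ S.D, z ≠ y ∧ S.mid y z = x := by
  obtain ⟨-, h | ⟨_, h⟩⟩ := h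
  · exact absurd (S.param_injective h).symm hxy
  · obtain ⟨z, hz, rfl⟩ := h.1
    obtain ⟨h1, h2⟩ := (isReflection_iff hS hb hy hz).1 h
    exact ⟨z, hz, h1, (eq_mid_iff hS hb hx hy hz h1).2 h2⟩

theorem mem_reflectionDomain_mid (hS : S.IsAdmissible) {lam Lam : ℝ}
    (hb : S.CurvatureBounds lam Lam) {y z : 𝔼} (hy : y ∈ S.D) (hz : z ∈ S.D) (hzy : z ≠ y) :
    S.param y ∈ S.reflectionDomain (S.param (S.mid y z)) :=
  ⟨⟨y, hy, rfl⟩, Or.inr ⟨_, (isReflection_iff hS hb hy hz).2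
    ⟨hzy, gradient_mid hS hb hy hz hzy⟩⟩⟩

/-- Divided by α + β, the combination lies on the chord, within |N₂ - N₁| of N₁; renormalising to
length one moves it by at most the same amount again. -/
theorem norm_normalize_sub_le {F : Type*} [NormedAddCommGroup F] [NormedSpace ℝ F] {N₁ N₂ : F}
    (h₁ : ‖N₁‖ = 1) {α β : ℝ} (hα : 0 ≤ α) (hβ : 0 ≤ β)
    (h0 : α • N₁ + β • N₂ ≠ 0) :
    ‖‖α • N₁ + β • N₂‖⁻¹ • (α • N₁ + β • N₂) - N₁‖ ≤ 2 * ‖N₂ - N₁‖ := by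
  set v := α • N₁ + β • N₂ with hv
  have hA : 0 < α + β := by
    refine lt_of_le_of_ne (add_nonneg hα hβ) fun h => h0 ?_
    have h1 : α = 0 := by linarith
    have h2 : β = 0 := by linarith
    rw [hv, h1, h2]; simp
  have hvp : 0 < ‖v‖ := norm_pos_iff.2 h0
  have h1 : ‖v - (α + β) • N₁‖ ≤ (α + β) * ‖N₂ - N₁‖ := by
    have : v - (α + β) • N₁ = β • (N₂ - N₁) := by rw [hv]; module
    rw [this, norm_smul, Real.norm_of_nonneg hβ]
    exact mul_le_mul_of_nonneg_right (by linarith) (norm_nonneg _)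
  have h2 : |(α + β) - ‖v‖| ≤ (α + β) * ‖N₂ - N₁‖ := by
    refine le_trans ?_ h1
    have h3 : ‖(α + β) • N₁‖ = α + β := by rw [norm_smul, h₁, Real.norm_of_nonneg hA.le, mul_one]
    have := abs_norm_sub_norm_le ((α + β) • N₁) v
    rwa [h3, norm_sub_rev] at this
  have h3 : (α + β) • (‖v‖⁻¹ • v - N₁) = (((α + β) - ‖v‖) * ‖v‖⁻¹) • v + (v - (α + β) • N₁) := by
    rw [sub_mul, mul_inv_cancel₀ hvp.ne']; module
  have h4 : ‖(α + β) • (‖v‖⁻¹ • v - N₁)‖ ≤ (α + β) * (2 * ‖N₂ - N₁‖) := by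
    rw [h3]
    refine (norm_add_le _ _).trans ?_
    rw [norm_smul, norm_mul, norm_inv, norm_norm, mul_assoc, inv_mul_cancel₀ hvp.ne', mul_one,
      Real.norm_eq_abs]
    linarith
  rw [norm_smul, Real.norm_of_nonneg hA.le] at h4
  exact le_of_mul_le_mul_left h4 hA

/-- With u, u', u'' over `mid y z`, `y`, `z`: (3/4) lam |u - u'| ≤ |N(u) - N(u')| ≤ 2 |N(u'') -
N(u')| ≤ 3 Lam |u'' - u'|. The middle inequality holds because N(u) lies on the arc between the
other two normals. -/
theorem norm_param_mid_sub_le (hS : S.IsAdmissible) {lam Lam : ℝ}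
    (hb : S.CurvatureBounds lam Lam) {y z : 𝔼} (hy : y ∈ S.D) (hz : z ∈ S.D) (hzy : z ≠ y) :
    lam * ‖S.param (S.mid y z) - S.param y‖ ≤ 4 * Lam * ‖S.param y - S.param z‖ := by
  have hx := mid_mem hS hb hy hz hzy
  have hg := gradient_mid hS hb hy hz hzy
  set x := S.mid y z
  obtain ⟨t, ht, ht'⟩ := exists_midGradient_eq hS hb hy hz hzy
  rw [ht'] at hg
  have hn := normal_eq_of_gradient_eq hg
  have e : ∀ w, S.normal w = S.areaElement w • S.gaussMap (S.param w) := fun w => by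
    rw [gaussMap_param, smul_smul, mul_inv_cancel₀ (S.areaElement_pos w).ne', one_smul]
  have hn' : S.normal x = ((1 - t) * S.areaElement y) • S.gaussMap (S.param y) +
      (t * S.areaElement z) • S.gaussMap (S.param z) := by
    rw [hn, mul_smul, mul_smul, ← e, ← e]; module
  have hx0 : S.normal x ≠ 0 := by
    rw [← norm_ne_zero_iff, norm_normal]; exact (S.areaElement_pos x).ne'
  have h1 := norm_normalize_sub_le (S.norm_gaussMap (S.param y)) (N₂ := S.gaussMap (S.param z))
    (mul_nonneg (sub_nonneg.2 ht.2.le) (S.areaElement_pos y).le)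
    (mul_nonneg ht.1.le (S.areaElement_pos z).le) (by rwa [← hn'])
  rw [← hn', norm_normal, ← gaussMap_param] at h1
  have h2 := norm_param_sub_le hS hb hy hx
  have h3 := norm_gaussMap_sub_le hS hb hy hz
  rw [norm_sub_rev (S.param z)] at h3
  linarith

/-! ### The derivative of the reflection -/

variable (S) in
/-- The derivative of `z ↦ supportGap y z / (supportGap y z + supportGap z y)`. -/
def midWeightDeriv (y z : 𝔼) : 𝔼 →L[ℝ] ℝ :=
  (S.supportGap y z + S.supportGap z y)⁻¹ • innerSL ℝ (gradient S.φ z - gradient S.φ y) -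
    (S.supportGap y z / (S.supportGap y z + S.supportGap z y) ^ 2) •
      (innerSL ℝ (gradient S.φ z - gradient S.φ y) + (innerSL ℝ (z - y)).comp (S.hess z))

variable (S) in
/-- The derivative of `z ↦ midGradient y z`. -/
def midGradientDeriv (y z : 𝔼) : 𝔼 →L[ℝ] 𝔼 :=
  (S.supportGap y z / (S.supportGap y z + S.supportGap z y)) • S.hess z +
    (S.midWeightDeriv y z).smulRight (gradient S.φ z - gradient S.φ y)

theorem inner_tangentMap_normal' (y z w : 𝔼) :
    ⟪S.tangentMap z w, S.normal y⟫ = -⟪gradient S.φ z - gradient S.φ y, w⟫ := by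
  rw [tangentMap_apply, normal_eq, inner_frame_add_smul, inner_sub_left,
    real_inner_comm w (gradient S.φ y)]
  ring

theorem hasFDerivAt_supportGap {y z : 𝔼} (hz : z ∈ S.D) :
    HasFDerivAt (S.supportGap y) (innerSL ℝ (gradient S.φ z - gradient S.φ y)) z := by
  have h := ((hasFDerivAt_param hz).const_sub (S.param y)).inner ℝ
    (hasFDerivAt_const (S.normal y) z)
  refine h.congr_fderiv ?_
  ext1 w
  have h1 := inner_tangentMap_normal' (S := S) y z w
  generalize gradient S.φ z - gradient S.φ y = r at h1 ⊢
  simp [fderivInnerCLM_apply, h1]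

theorem hasFDerivAt_midGradient (hS : S.IsAdmissible) {lam Lam : ℝ}
    (hb : S.CurvatureBounds lam Lam) {y z : 𝔼} (hy : y ∈ S.D) (hz : z ∈ S.D) (hzy : z ≠ y) :
    HasFDerivAt (S.midGradient y) (S.midGradientDeriv y z) z := by
  have hpos := add_pos (supportGap_pos hS hb hy hz hzy.symm) (supportGap_pos hS hb hz hy hzy)
  have hr := (hasFDerivAt_gradient hz).sub_const (gradient S.φ y)
  have h1 := hasFDerivAt_supportGap (y := y) hz
  have h2 : HasFDerivAt (fun z => S.supportGap y z + S.supportGap z y)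
      (innerSL ℝ (gradient S.φ z - gradient S.φ y) + (innerSL ℝ (z - y)).comp (S.hess z)) z := by
    simp only [supportGap_add]
    have h := ((hasFDerivAt_id z).sub_const y).inner ℝ hr
    refine h.congr_fderiv ?_
    ext1 w
    rw [id]
    generalize gradient S.φ z - gradient S.φ y = r
    generalize z - y = v
    simp [fderivInnerCLM_apply, real_inner_comm w]
    ring
  have h3 := (h1.mul ((hasFDerivAt_inv hpos.ne').comp z h2)).smul hr
  have h4 := h3.const_add (gradient S.φ y)
  refine h4.congr_fderiv ?_
  ext1 w
  rw [midGradientDeriv, midWeightDeriv]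
  simp only [Pi.mul_apply, Function.comp_apply, div_eq_mul_inv]
  generalize gradient S.φ z - gradient S.φ y = r
  generalize z - y = v
  generalize S.supportGap y z + S.supportGap z y = q
  simp only [add_apply, smul_apply, sub_apply, ContinuousLinearMap.smulRight_apply,
    ContinuousLinearMap.comp_apply, ContinuousLinearMap.toSpanSingleton_apply,
    innerSL_apply_apply, smul_eq_mul]
  congr 2
  ring

/-- A vector `w` in the kernel has Hess(z) w = c r, where r is the difference of gradients.
Inserting this into the derivative of the weight cancels c and leaves b ⟨r, w⟩ = 0 with b > 0. Hence
⟨Hess(z) w, w⟩ = 0, and positivity of the Hessian forces w = 0. -/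
theorem midGradientDeriv_eq_zero (hS : S.IsAdmissible) {lam Lam : ℝ}
    (hb : S.CurvatureBounds lam Lam) {y z : 𝔼} (hy : y ∈ S.D) (hz : z ∈ S.D) (hzy : z ≠ y)
    (w : 𝔼) (hw : S.midGradientDeriv y z w = 0) : w = 0 := by
  have ha := supportGap_pos hS hb hy hz hzy.symm
  have hb' := supportGap_pos hS hb hz hy hzy
  have hq := S.supportGap_add y z
  set a := S.supportGap y z with ha_def
  set b := S.supportGap z y
  set r := gradient S.φ z - gradient S.φ y with hr
  set δ := S.midWeightDeriv y z w with hδ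
  have hpos : 0 < a + b := add_pos ha hb'
  have h1 : (a / (a + b)) • S.hess z w + δ • r = 0 := by
    simpa [midGradientDeriv] using hw
  obtain ⟨c, hc⟩ : ∃ c, c = -δ / (a / (a + b)) := ⟨_, rfl⟩
  have h2 : S.hess z w = c • r := by
    have h3 : (a / (a + b)) • S.hess z w = (-δ) • r := by
      rw [neg_smul]; exact eq_neg_of_add_eq_zero_left h1
    rw [hc, div_eq_inv_mul, mul_smul, ← h3, smul_smul, inv_mul_cancel₀ (by positivity), one_smul]
  have hδ' : δ = (a + b)⁻¹ * ⟪r, w⟫ - (a / (a + b) ^ 2) * (⟪r, w⟫ + c * (a + b)) := by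
    rw [hq]
    have : ⟪z - y, S.hess z w⟫ = c * ⟪z - y, r⟫ := by rw [h2, inner_smul_right]
    rw [← this, ← hq]
    rw [hδ, midWeightDeriv, ← hr, ← ha_def]
    generalize z - y = v
    simp only [add_apply, smul_apply, sub_apply, ContinuousLinearMap.comp_apply,
      innerSL_apply_apply, smul_eq_mul]
    rfl
  have hκ : ⟪r, w⟫ = 0 := by
    have h4 : δ = -c * (a / (a + b)) := by rw [hc]; field_simp
    rw [h4] at hδ'
    have h5 : b * ⟪r, w⟫ = 0 := by
      field_simp at hδ'
      linarith
    exact (mul_eq_zero.1 h5).resolve_left hb'.ne'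
  by_contra hw0
  have := hess_pos hS hz hw0
  rw [h2, inner_smul_left, hκ, mul_zero] at this
  exact this.false

theorem hasFDerivWithinAt_mid (hS : S.IsAdmissible) {lam Lam : ℝ}
    (hb : S.CurvatureBounds lam Lam) {y z : 𝔼} (hy : y ∈ S.D) (hz : z ∈ S.D) (hzy : z ≠ y)
    {Le Me : 𝔼 ≃L[ℝ] 𝔼} (hLe : (Le : 𝔼 →L[ℝ] 𝔼) = S.hess (S.mid y z))
    (hMe : (Me : 𝔼 →L[ℝ] 𝔼) = S.midGradientDeriv y z) :
    HasFDerivWithinAt (S.mid y) ((Me.trans Le.symm : 𝔼 ≃L[ℝ] 𝔼) : 𝔼 →L[ℝ] 𝔼) (S.D \ {y}) z := by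
  have h1 := hasFDerivWithinAt_gradientInv hS (mid_mem hS hb hy hz hzy) hLe
  rw [gradient_mid hS hb hy hz hzy] at h1
  have h2 := (hasFDerivAt_midGradient hS hb hy hz hzy).hasFDerivWithinAt (s := S.D \ {y})
  rw [← hMe] at h2
  exact h1.comp z h2 fun w hw => midGradient_mem hS hb hy hw.1 hw.2

/-! ### Joint continuity of the inverse map and of the reflection -/

theorem continuousOn_normal : ContinuousOn S.normal S.D :=
  (S.frame.continuous.comp_continuousOn continuousOn_gradient).sub continuousOn_const

variable (S) in
/-- The pairs of distinct points of the parameter domain. -/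
def offDiag : Set (𝔼 × 𝔼) := {p | p.1 ∈ S.D ∧ p.2 ∈ S.D ∧ p.2 ≠ p.1}

theorem continuousOn_supportGap :
    ContinuousOn (fun p : 𝔼 × 𝔼 => S.supportGap p.1 p.2) S.offDiag := by
  have h1 : ContinuousOn (fun p : 𝔼 × 𝔼 => S.param p.1) S.offDiag :=
    continuousOn_param.comp continuousOn_fst fun p hp => hp.1
  have h2 : ContinuousOn (fun p : 𝔼 × 𝔼 => S.param p.2) S.offDiag :=
    continuousOn_param.comp continuousOn_snd fun p hp => hp.2.1
  have h3 : ContinuousOn (fun p : 𝔼 × 𝔼 => S.normal p.1) S.offDiag :=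
    continuousOn_normal.comp continuousOn_fst fun p hp => hp.1
  exact ContinuousOn.inner (𝕜 := ℝ) (h1.sub h2) h3

theorem continuousOn_supportGap_swap :
    ContinuousOn (fun p : 𝔼 × 𝔼 => S.supportGap p.2 p.1) S.offDiag :=
  ContinuousOn.comp (g := fun p : 𝔼 × 𝔼 => S.supportGap p.1 p.2) (f := Prod.swap)
    continuousOn_supportGap continuous_swap.continuousOn
    fun _ hp => ⟨hp.2.1, hp.1, hp.2.2.symm⟩

theorem supportGap_add_ne (hS : S.IsAdmissible) {lam Lam : ℝ} (hb : S.CurvatureBounds lam Lam)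
    {p : 𝔼 × 𝔼} (hp : p ∈ S.offDiag) : S.supportGap p.1 p.2 + S.supportGap p.2 p.1 ≠ 0 :=
  (add_pos (supportGap_pos hS hb hp.1 hp.2.1 hp.2.2.symm)
    (supportGap_pos hS hb hp.2.1 hp.1 hp.2.2)).ne'

theorem continuousOn_midWeight (hS : S.IsAdmissible) {lam Lam : ℝ}
    (hb : S.CurvatureBounds lam Lam) : ContinuousOn (fun p : 𝔼 × 𝔼 =>
      S.supportGap p.1 p.2 / (S.supportGap p.1 p.2 + S.supportGap p.2 p.1)) S.offDiag :=
  continuousOn_supportGap.div (continuousOn_supportGap.add continuousOn_supportGap_swap)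
    fun _ hp => supportGap_add_ne hS hb hp

theorem continuousOn_gradient_sub :
    ContinuousOn (fun p : 𝔼 × 𝔼 => gradient S.φ p.2 - gradient S.φ p.1) S.offDiag :=
  (continuousOn_gradient.comp continuousOn_snd fun _ hp => hp.2.1).sub
    (continuousOn_gradient.comp continuousOn_fst fun _ hp => hp.1)

theorem continuousOn_mid (hS : S.IsAdmissible) {lam Lam : ℝ} (hb : S.CurvatureBounds lam Lam) :
    ContinuousOn (fun p : 𝔼 × 𝔼 => S.mid p.1 p.2) S.offDiag := by
  have h : ContinuousOn (fun p : 𝔼 × 𝔼 => S.midGradient p.1 p.2) S.offDiag := by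
    have h1 : ContinuousOn (fun p : 𝔼 × 𝔼 => gradient S.φ p.1) S.offDiag :=
      continuousOn_gradient.comp continuousOn_fst fun _ hp => hp.1
    exact h1.add ((continuousOn_midWeight hS hb).smul continuousOn_gradient_sub)
  exact ContinuousOn.comp (g := S.gradientInv) (continuousOn_gradientInv hS) h
    fun p hp => midGradient_mem hS hb hp.1 hp.2.1 hp.2.2

theorem continuousOn_hess_snd :
    ContinuousOn (fun p : 𝔼 × 𝔼 => S.hess p.2) S.offDiag :=
  continuousOn_hess.comp continuousOn_snd fun _ hp => hp.2.1

theorem continuousOn_midWeightDeriv (hS : S.IsAdmissible) {lam Lam : ℝ}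
    (hb : S.CurvatureBounds lam Lam) :
    ContinuousOn (fun p : 𝔼 × 𝔼 => S.midWeightDeriv p.1 p.2) S.offDiag := by
  have hq : ContinuousOn (fun p : 𝔼 × 𝔼 => S.supportGap p.1 p.2 + S.supportGap p.2 p.1)
    S.offDiag := continuousOn_supportGap.add continuousOn_supportGap_swap
  have hir : ContinuousOn (fun p : 𝔼 × 𝔼 => innerSL ℝ (gradient S.φ p.2 - gradient S.φ p.1))
    S.offDiag := (innerSL ℝ (E := 𝔼)).continuous.comp_continuousOn continuousOn_gradient_sub
  have hzy : Continuous (fun p : 𝔼 × 𝔼 => innerSL ℝ (p.2 - p.1)) :=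
    (innerSL ℝ (E := 𝔼)).continuous.comp (continuous_snd.sub continuous_fst)
  have hc : ContinuousOn (fun p : 𝔼 × 𝔼 => (innerSL ℝ (p.2 - p.1)).comp (S.hess p.2))
    S.offDiag := hzy.continuousOn.clm_comp continuousOn_hess_snd
  have hq2 : ContinuousOn (fun p : 𝔼 × 𝔼 =>
      S.supportGap p.1 p.2 / (S.supportGap p.1 p.2 + S.supportGap p.2 p.1) ^ 2) S.offDiag :=
    continuousOn_supportGap.div (hq.pow 2)
      fun p hp => pow_ne_zero 2 (supportGap_add_ne hS hb hp)
  exact ((hq.inv₀ fun p hp => supportGap_add_ne hS hb hp).smul hir).sub (hq2.smul (hir.add hc))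

theorem continuousOn_midGradientDeriv (hS : S.IsAdmissible) {lam Lam : ℝ}
    (hb : S.CurvatureBounds lam Lam) :
    ContinuousOn (fun p : 𝔼 × 𝔼 => S.midGradientDeriv p.1 p.2) S.offDiag := by
  have h1 : ContinuousOn (fun p : 𝔼 × 𝔼 => (S.midWeightDeriv p.1 p.2).smulRight
      (gradient S.φ p.2 - gradient S.φ p.1)) S.offDiag :=
    continuousOn_clm_apply.2 fun w =>
      ContinuousOn.smul (f := fun p : 𝔼 × 𝔼 => S.midWeightDeriv p.1 p.2 w)
        ((continuousOn_midWeightDeriv hS hb).clm_apply continuousOn_const) continuousOn_gradient_sub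
  exact ((continuousOn_midWeight hS hb).smul continuousOn_hess_snd).add h1

variable (S) in
/-- The pairs `(u, u')` off the diagonal, in graph coordinates, for which `R_u u'` exists. -/
def coordPairs : Set (𝔼 × 𝔼) := (fun p : 𝔼 × 𝔼 => (S.mid p.1 p.2, p.1)) '' S.offDiag

theorem injOn_mid_prod (hS : S.IsAdmissible) {lam Lam : ℝ} (hb : S.CurvatureBounds lam Lam) :
    Set.InjOn (fun p : 𝔼 × 𝔼 => (S.mid p.1 p.2, p.1)) S.offDiag := by
  rintro ⟨y, z⟩ ⟨hy, hz, hzy⟩ ⟨y', z'⟩ ⟨hy', hz', hzy'⟩ h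
  obtain ⟨h1, h2⟩ := Prod.mk.inj h
  dsimp only at h1 h2 hy hz hzy hy' hz' hzy'
  subst h2
  rw [mid_injOn hS hb hy ⟨hz, hzy⟩ ⟨hz', hzy'⟩ h1]

theorem measurableSet_offDiag : MeasurableSet S.offDiag := by
  have hD := S.isCompact_D.isClosed.measurableSet
  have : S.offDiag = (S.D ×ˢ S.D) \ {p | p.2 = p.1} := by
    ext p; simp [offDiag, and_assoc]
  rw [this]
  exact (hD.prod hD).diff (measurableSet_eq_fun measurable_snd measurable_fst)

/-- The Lusin–Souslin theorem: an injective continuous image of a Borel set is Borel. -/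
theorem measurableSet_coordPairs (hS : S.IsAdmissible) {lam Lam : ℝ}
    (hb : S.CurvatureBounds lam Lam) : MeasurableSet S.coordPairs :=
  measurableSet_offDiag.image_of_continuousOn_injOn
    ((continuousOn_mid hS hb).prodMk continuousOn_fst) (injOn_mid_prod hS hb)

variable (S) in
/-- The map `(u, u') ↦ R_u u'` in graph coordinates. -/
def coordReflection (p : 𝔼 × 𝔼) : 𝔼 := S.coord (S.reflection (S.param p.1) (S.param p.2))

theorem coordReflection_mid (hS : S.IsAdmissible) {lam Lam : ℝ} (hb : S.CurvatureBounds lam Lam)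
    {y z : 𝔼} (hy : y ∈ S.D) (hz : z ∈ S.D) (hzy : z ≠ y) :
    S.coordReflection (S.mid y z, y) = z := by
  rw [coordReflection, reflection_mid hS hb hy hz hzy, coord_param]

/-- A compactness argument: along an ultrafilter the reflected points converge to some `w` in `D`,
and continuity and injectivity of `mid` identify `w`. As `mid` is controlled only off the diagonal,
`w = y` has to be excluded first. -/
theorem continuousOn_coordReflection (hS : S.IsAdmissible) {lam Lam : ℝ}
    (hb : S.CurvatureBounds lam Lam) : ContinuousOn S.coordReflection S.coordPairs := by
  rintro _ ⟨⟨y, z⟩, ⟨hy, hz, hzy⟩, rfl⟩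
  rw [ContinuousWithinAt, Filter.tendsto_iff_ultrafilter]
  intro F hF
  dsimp only at hy hz hzy hF ⊢
  rw [coordReflection_mid hS hb hy hz hzy]
  have hFΓ : ∀ᶠ p in (F : Filter (𝔼 × 𝔼)), p ∈ S.coordPairs := hF (self_mem_nhdsWithin)
  have hFt : Filter.Tendsto id (F : Filter (𝔼 × 𝔼)) (nhds (S.mid y z, y)) :=
    hF.trans nhdsWithin_le_nhds
  have hmem : ∀ p ∈ S.coordPairs, p.2 ∈ S.D ∧ S.coordReflection p ∈ S.D ∧
      S.coordReflection p ≠ p.2 ∧ S.mid p.2 (S.coordReflection p) = p.1 ∧ p.1 ∈ S.D := by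
    rintro _ ⟨⟨y, z⟩, ⟨hy, hz, hzy⟩, rfl⟩
    dsimp only at hy hz hzy ⊢
    rw [coordReflection_mid hS hb hy hz hzy]
    exact ⟨hy, hz, hzy, rfl, mid_mem hS hb hy hz hzy⟩
  obtain ⟨w, hw, hFw⟩ := S.isCompact_D.ultrafilter_le_nhds (F.map S.coordReflection)
    (Filter.le_principal_iff.2 (hFΓ.mono fun p hp => (hmem p hp).2.1))
  have hFw' : Filter.Tendsto S.coordReflection F (nhds w) := hFw
  have hlim : ∀ {f : 𝔼 × 𝔼 → 𝔼} {a : 𝔼}, a ∈ S.D → Filter.Tendsto f F (nhds a) →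
      (∀ p ∈ S.coordPairs, f p ∈ S.D) →
      Filter.Tendsto (fun p => S.param (f p)) F (nhds (S.param a)) := by
    intro f a ha hf hfD
    exact (continuousOn_param a ha).tendsto.comp
      (tendsto_nhdsWithin_iff.2 ⟨hf, hFΓ.mono hfD⟩)
  have h1 : Filter.Tendsto (fun p : 𝔼 × 𝔼 => p.1) F (nhds (S.mid y z)) :=
    (continuous_fst.tendsto _).comp hFt
  have h2 : Filter.Tendsto (fun p : 𝔼 × 𝔼 => p.2) F (nhds y) :=
    (continuous_snd.tendsto _).comp hFt
  have hxD := mid_mem hS hb hy hz hzy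
  have l1 := hlim hxD h1 fun p hp => (hmem p hp).2.2.2.2
  have l2 := hlim hy h2 fun p hp => (hmem p hp).1
  have l3 := hlim hw hFw' fun p hp => (hmem p hp).2.1
  have hle : lam * ‖S.param (S.mid y z) - S.param y‖ ≤ 4 * Lam * ‖S.param y - S.param w‖ := by
    refine le_of_tendsto_of_tendsto ((l1.sub l2).norm.const_mul lam)
      ((l2.sub l3).norm.const_mul (4 * Lam)) (hFΓ.mono fun p hp => ?_)
    obtain ⟨m1, m2, m3, m4, -⟩ := hmem p hp
    have := norm_param_mid_sub_le hS hb m1 m2 m3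
    rwa [m4] at this
  -- In the limit the comparison of distances reads lam |u - u'| ≤ 4 Lam |u' - w|, with u ≠ u'.
  have hwy : w ≠ y := by
    rintro rfl
    rw [sub_self, norm_zero, mul_zero] at hle
    have h3 : 0 < ‖S.param (S.mid w z) - S.param w‖ :=
      norm_pos_iff.2 (sub_ne_zero.2 fun h => mid_ne hS hb hy hz hzy (S.param_injective h))
    have := mul_pos hb.pos h3
    linarith
  have hmidlim : Filter.Tendsto (fun p : 𝔼 × 𝔼 => S.mid p.2 (S.coordReflection p)) F
      (nhds (S.mid y w)) := by
    have hc := (continuousOn_mid hS hb) (y, w) ⟨hy, hw, hwy⟩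
    exact Filter.Tendsto.comp (g := fun p : 𝔼 × 𝔼 => S.mid p.1 p.2)
      (f := fun p : 𝔼 × 𝔼 => (p.2, S.coordReflection p)) hc
      (tendsto_nhdsWithin_iff.2 ⟨h2.prodMk_nhds hFw',
      hFΓ.mono fun p hp => ⟨(hmem p hp).1, (hmem p hp).2.1, (hmem p hp).2.2.1⟩⟩)
  have heq : S.mid y w = S.mid y z :=
    tendsto_nhds_unique (hmidlim.congr' (hFΓ.mono fun p hp => (hmem p hp).2.2.2.1)) h1
  rw [← mid_injOn hS hb hy ⟨hw, hwy⟩ ⟨hz, hzy⟩ heq]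
  exact hFw'

/-! ### The Jacobian factor in terms of the inverse map -/

theorem mem_reflectionInCoordDomain_iff (hS : S.IsAdmissible) {lam Lam : ℝ}
    (hb : S.CurvatureBounds lam Lam) {x y : 𝔼} (hy : y ∈ S.D) (hxy : x ≠ y) :
    x ∈ S.reflectionInCoordDomain (S.param y) ↔ (x, y) ∈ S.coordPairs := by
  constructor
  · rintro ⟨hx, h⟩
    obtain ⟨z, hz, hzy, rfl⟩ := exists_mid_eq hS hb hx hy hxy h
    exact ⟨(y, z), ⟨hy, hz, hzy⟩, rfl⟩
  · rintro ⟨⟨y', z⟩, ⟨hy', hz, hzy⟩, h⟩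
    obtain ⟨rfl, rfl⟩ := Prod.mk.inj h
    exact ⟨mid_mem hS hb hy hz hzy, mem_reflectionDomain_mid hS hb hy hz hzy⟩

/-- The reflection is a continuous left inverse of a differentiable map with invertible derivative
Hess(mid)⁻¹ ∘ D(midGradient), so its derivative is the inverse of that map. -/
theorem reflectionInCoord_fderiv (hS : S.IsAdmissible) {lam Lam : ℝ}
    (hb : S.CurvatureBounds lam Lam) {y z : 𝔼} (hy : y ∈ S.D) (hz : z ∈ S.D) (hzy : z ≠ y) :
    HasFDerivWithinAt (S.reflectionInCoord (S.param y))
      (fderivWithin ℝ (S.reflectionInCoord (S.param y))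
        (S.reflectionInCoordDomain (S.param y)) (S.mid y z))
      (S.reflectionInCoordDomain (S.param y)) (S.mid y z) ∧
    (fderivWithin ℝ (S.reflectionInCoord (S.param y))
        (S.reflectionInCoordDomain (S.param y)) (S.mid y z)).det =
      (S.midGradientDeriv y z).det⁻¹ * (S.hess (S.mid y z)).det := by
  obtain ⟨Le, hLe⟩ := exists_hessEquiv hS (mid_mem hS hb hy hz hzy)
  obtain ⟨Me, hMe⟩ := exists_continuousLinearEquiv _ (midGradientDeriv_eq_zero hS hb hy hz hzy)
  have hmid := hasFDerivWithinAt_mid hS hb hy hz hzy hLe hMe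
  have hne := mid_ne hS hb hy hz hzy
  set x := S.mid y z with hx
  set E := S.reflectionInCoordDomain (S.param y) with hE
  have hxE : x ∈ E := (mem_reflectionInCoordDomain_iff hS hb hy hne).2 ⟨(y, z), ⟨hy, hz, hzy⟩, rfl⟩
  have hρ : S.reflectionInCoord (S.param y) x = z := coordReflection_mid hS hb hy hz hzy
  have hEmem : ∀ w ∈ E \ {y}, S.reflectionInCoord (S.param y) w ∈ S.D \ {y} ∧
      S.mid y (S.reflectionInCoord (S.param y) w) = w := by
    rintro w ⟨hw, hwy⟩
    obtain ⟨⟨y', z'⟩, ⟨hy', hz', hzy'⟩, h⟩ := (mem_reflectionInCoordDomain_iff hS hb hy hwy).1 hw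
    obtain ⟨rfl, rfl⟩ := Prod.mk.inj h
    have h1 : S.reflectionInCoord (S.param y') (S.mid y' z') = z' :=
      coordReflection_mid hS hb hy hz' hzy'
    dsimp only at h1 ⊢
    rw [h1]
    exact ⟨⟨hz', hzy'⟩, rfl⟩
  have hder : HasFDerivWithinAt (S.reflectionInCoord (S.param y))
      ((Me.trans Le.symm).symm : 𝔼 →L[ℝ] 𝔼) (E \ {y}) x := by
    refine HasFDerivWithinAt.of_local_left_inverse (f := S.mid y) (t := S.D \ {y}) ?_ ?_
      ⟨hxE, hne⟩ (eventually_nhdsWithin_of_forall fun w hw => (hEmem w hw).2)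
    · refine tendsto_nhdsWithin_iff.2 ⟨?_, eventually_nhdsWithin_of_forall
        fun w hw => (hEmem w hw).1⟩
      have hc := continuousOn_coordReflection hS hb (x, y) ⟨(y, z), ⟨hy, hz, hzy⟩, rfl⟩
      have hm : Set.MapsTo (fun w : 𝔼 => (w, y)) (E \ {y}) S.coordPairs := fun w hw =>
        (mem_reflectionInCoordDomain_iff hS hb hy hw.2).1 hw.1
      exact (hc.comp (f := fun w : 𝔼 => (w, y))
        (continuous_id.prodMk continuous_const).continuousWithinAt hm).tendsto
    · rw [hρ]; exact hmid
  have hder' : HasFDerivWithinAt (S.reflectionInCoord (S.param y))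
      ((Me.trans Le.symm).symm : 𝔼 →L[ℝ] 𝔼) E x :=
    hder.mono_of_mem_nhdsWithin (Filter.inter_mem self_mem_nhdsWithin
      (mem_nhdsWithin_of_mem_nhds (isOpen_compl_singleton.mem_nhds hne)))
  -- The `fderivWithin` in the definition of the Jacobian is determined only where the domain has
  -- enough tangent directions. Near `x` the domain contains the image under `mid` of `D` without
  -- `y`, and it inherits them from `D`.
  have huniq : UniqueDiffWithinAt ℝ E x := by
    have h1 : UniqueDiffWithinAt ℝ (S.D \ {y}) z := by
      have := (uniqueDiffOn_D hS z hz).inter (isOpen_compl_singleton.mem_nhds hzy)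
      exact this
    refine (hmid.uniqueDiffWithinAt h1 (Me.trans Le.symm).surjective.denseRange).mono ?_
    rintro _ ⟨w, hw, rfl⟩
    exact ⟨mid_mem hS hb hy hw.1 hw.2, mem_reflectionDomain_mid hS hb hy hw.1 hw.2⟩
  have hf := hder'.fderivWithin huniq
  refine ⟨by rw [hf]; exact hder', ?_⟩
  rw [hf]
  have h1 : ((Me.trans Le.symm).symm : 𝔼 →L[ℝ] 𝔼).det =
      (Me.symm : 𝔼 →L[ℝ] 𝔼).det * (Le : 𝔼 →L[ℝ] 𝔼).det := by
    simp only [ContinuousLinearMap.det]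
    rw [← LinearMap.det_comp]
    rfl
  rw [h1, ← hLe, ← hMe]
  congr 1
  exact Me.det_coe_symm

theorem jacobian_mid (hS : S.IsAdmissible) {lam Lam : ℝ}
    (hb : S.CurvatureBounds lam Lam) {y z : 𝔼} (hy : y ∈ S.D) (hz : z ∈ S.D) (hzy : z ≠ y) :
    S.jacobian (S.param (S.mid y z)) (S.param y) =
      |(S.midGradientDeriv y z).det⁻¹ * (S.hess (S.mid y z)).det| *
        (S.areaElement z / S.areaElement (S.mid y z)) := by
  rw [jacobian, coord_param, (reflectionInCoord_fderiv hS hb hy hz hzy).2,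
    reflection_mid hS hb hy hz hzy, coord_param]

theorem midGradientDeriv_det_ne_zero (hS : S.IsAdmissible) {lam Lam : ℝ}
    (hb : S.CurvatureBounds lam Lam) {y z : 𝔼} (hy : y ∈ S.D) (hz : z ∈ S.D) (hzy : z ≠ y) :
    (S.midGradientDeriv y z).det ≠ 0 := by
  obtain ⟨Me, hMe⟩ := exists_continuousLinearEquiv _ (midGradientDeriv_eq_zero hS hb hy hz hzy)
  rw [← hMe]
  exact (LinearEquiv.isUnit_det' Me.toLinearEquiv).ne_zero

/-! ### The surface measure -/

theorem measurableSet_D : MeasurableSet S.D := S.isCompact_D.isClosed.measurableSet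

theorem isCompact_carrier : IsCompact S.carrier :=
  S.isCompact_D.image_of_continuousOn continuousOn_param

theorem aemeasurable_areaElement :
    AEMeasurable (fun x => ENNReal.ofReal (S.areaElement x)) (volume.restrict S.D) :=
  (continuousOn_areaElement.aemeasurable measurableSet_D).ennreal_ofReal

theorem lintegral_surfaceMeasure {f : 𝕍 → ℝ≥0∞} (hf : Measurable f) :
    ∫⁻ u, f u ∂S.surfaceMeasure =
      ∫⁻ x in S.D, f (S.param x) * ENNReal.ofReal (S.areaElement x) := by
  have hp : AEMeasurable S.param (volume.restrict S.D) :=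
    continuousOn_param.aemeasurable measurableSet_D
  have hp' := hp.mono_ac (withDensity_absolutelyContinuous (volume.restrict S.D)
    fun x => ENNReal.ofReal (S.areaElement x))
  rw [surfaceMeasure, lintegral_map' hf.aemeasurable hp']
  refine (lintegral_withDensity_eq_lintegral_mul₀ aemeasurable_areaElement
    (hf.comp_aemeasurable hp)).trans ?_
  simp only [Pi.mul_apply, mul_comm, Function.comp_apply]

theorem surfaceMeasure_apply {A : Set 𝕍} (hA : MeasurableSet A) :
    S.surfaceMeasure A = ∫⁻ x in S.D ∩ S.param ⁻¹' A, ENNReal.ofReal (S.areaElement x) := by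
  -- Nothing is known about φ away from a neighbourhood of `D`, so `param` is replaced by a globally
  -- measurable map.
  obtain ⟨m, hm, hme⟩ : ∃ m : 𝔼 → 𝕍, Measurable m ∧ ∀ x ∈ S.D, m x = S.param x := by
    classical
    exact ⟨_, continuousOn_param.measurable_piecewise (continuousOn_const (c := (0 : 𝕍)))
      measurableSet_D, fun x hx => Set.piecewise_eq_of_mem _ _ _ hx⟩
  have hset : S.D ∩ S.param ⁻¹' A = S.D ∩ m ⁻¹' A := by
    ext x
    simp only [Set.mem_inter_iff, Set.mem_preimage]
    exact and_congr_right fun hx => by rw [hme x hx]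
  rw [← lintegral_indicator_one hA, lintegral_surfaceMeasure (measurable_one.indicator hA),
    hset, Set.inter_comm, ← Measure.restrict_restrict (hm hA), ← lintegral_indicator (hm hA)]
  refine setLIntegral_congr_fun measurableSet_D fun x hx => ?_
  have h : x ∈ m ⁻¹' A ↔ S.param x ∈ A := by rw [Set.mem_preimage, hme x hx]
  by_cases hxA : S.param x ∈ A
  · simp [hxA, h.2 hxA]
  · simp [hxA, mt h.1 hxA]

theorem surfaceMeasure_compl_carrier : S.surfaceMeasure S.carrierᶜ = 0 := by
  rw [surfaceMeasure_apply isCompact_carrier.isClosed.measurableSet.compl]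
  have : S.D ∩ S.param ⁻¹' S.carrierᶜ = ∅ := by
    ext x
    simp only [Set.mem_inter_iff, Set.mem_preimage, Set.mem_compl_iff, Set.mem_empty_iff_false,
      iff_false, not_and, not_not]
    exact fun hx => ⟨x, hx, rfl⟩
  rw [this]; simp

theorem ae_mem_carrier : ∀ᵐ u ∂S.surfaceMeasure, u ∈ S.carrier :=
  surfaceMeasure_compl_carrier

/-! ### Balls on the hypersurface -/

/-- The image of the unit ball contains the ball of radius c; compare volumes. -/
theorem pow_finrank_le_abs_det {F : Type*} [NormedAddCommGroup F] [NormedSpace ℝ F]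
    [FiniteDimensional ℝ F] (L : F →ₗ[ℝ] F) {c : ℝ} (hc : 0 < c) (hL : ∀ w, c * ‖w‖ ≤ ‖L w‖) :
    c ^ Module.finrank ℝ F ≤ |LinearMap.det L| := by
  let _ : MeasurableSpace F := borel F
  have : BorelSpace F := ⟨rfl⟩
  let μ : Measure F := Measure.addHaar
  have hinj : Function.Injective L := (injective_iff_map_eq_zero _).2 fun w hw => by
    have := hL w
    rw [hw, norm_zero] at this
    exact norm_le_zero_iff.1 (le_of_mul_le_mul_left (by simpa using this) hc)
  have hsurj := LinearMap.injective_iff_surjective.1 hinj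
  have hsub : Metric.closedBall (0 : F) c ⊆ L '' Metric.closedBall 0 1 := by
    intro y hy
    obtain ⟨w, rfl⟩ := hsurj y
    refine ⟨w, ?_, rfl⟩
    rw [mem_closedBall_zero_iff] at hy ⊢
    have := (hL w).trans hy
    exact le_of_mul_le_mul_left (by simpa using this) hc
  have h := measure_mono (μ := μ) hsub
  rw [Measure.addHaar_image_linearMap, Measure.addHaar_closedBall _ _ hc.le,
    Measure.addHaar_closedBall _ _ zero_le_one, one_pow, ENNReal.ofReal_one, one_mul] at h
  have h0 : μ (Metric.ball (0 : F) 1) ≠ 0 := (Metric.measure_ball_pos μ 0 one_pos).ne'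
  have h1 : μ (Metric.ball (0 : F) 1) ≠ ⊤ := measure_ball_lt_top.ne
  exact (ENNReal.ofReal_le_ofReal_iff (abs_nonneg _)).1
    ((ENNReal.mul_le_mul_iff_left h0 h1).1 h)

variable (S) in
/-- The orthogonal projection along the normal at the point over `y`, as a map to `ℝⁿ⁻¹`. -/
def normalProj (y : 𝔼) : 𝕍 →L[ℝ] 𝔼 :=
  S.coord.comp ((ℝ ∙ (S.e - S.gaussMap (S.param y)))ᗮ.reflection.toContinuousLinearEquiv :
    𝕍 →L[ℝ] 𝕍)

variable (S) in
theorem norm_sq_eq_normalProj (y : 𝔼) (v : 𝕍) :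
    ‖v‖ ^ 2 = ‖S.normalProj y v‖ ^ 2 + ⟪S.gaussMap (S.param y), v⟫ ^ 2 := by
  set K := (ℝ ∙ (S.e - S.gaussMap (S.param y)))ᗮ with hK
  have he : K.reflection S.e = S.gaussMap (S.param y) :=
    Submodule.reflection_sub (by rw [S.norm_e, norm_gaussMap])
  have h1 : ⟪S.gaussMap (S.param y), v⟫ = ⟪S.e, K.reflection v⟫ := by
    have := K.reflection.inner_map_map S.e (K.reflection v)
    rwa [Submodule.reflection_reflection, he] at this
  have h2 : S.normalProj y v = S.coord (K.reflection v) := rfl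
  rw [h1, h2, ← norm_sq_frame_add_smul, frame_coord_add, LinearIsometryEquiv.norm_map]

theorem normalProj_eq_zero {y : 𝔼} {v : 𝕍} (h : S.normalProj y v = 0) :
    v = ⟪S.gaussMap (S.param y), v⟫ • S.gaussMap (S.param y) := by
  have h1 : S.normalProj y (S.gaussMap (S.param y)) = 0 := by
    have := S.norm_sq_eq_normalProj y (S.gaussMap (S.param y))
    rw [real_inner_self_eq_norm_sq, norm_gaussMap] at this
    have h2 : ‖S.normalProj y (S.gaussMap (S.param y))‖ ^ 2 = 0 := by linarith
    simpa using h2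
  have h2 := S.norm_sq_eq_normalProj y
    (v - ⟪S.gaussMap (S.param y), v⟫ • S.gaussMap (S.param y))
  rw [map_sub, map_smul, h, h1, inner_sub_right, inner_smul_right, real_inner_self_eq_norm_sq,
    norm_gaussMap] at h2
  have h3 : ‖v - ⟪S.gaussMap (S.param y), v⟫ • S.gaussMap (S.param y)‖ ^ 2 = 0 := by
    rw [h2]; simp
  rw [sq_eq_zero_iff, norm_eq_zero, sub_eq_zero] at h3
  exact h3

/-- Two points with the same projection differ by t N₀. Strict convexity at the two points makes
t⟨N₀, N⟩ negative for one normal and positive for the other, whereas by the cone condition both ⟨N₀,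
N⟩ are positive. -/
theorem injOn_normalProj (hS : S.IsAdmissible) {lam Lam : ℝ} (hb : S.CurvatureBounds lam Lam)
    {y₀ : 𝔼} (hy₀ : y₀ ∈ S.D) : Set.InjOn (fun x => S.normalProj y₀ (S.param x)) S.D := by
  intro x hx y hy h
  by_contra hxy
  have h0 : S.normalProj y₀ (S.param y - S.param x) = 0 := by
    rw [map_sub]; exact sub_eq_zero.2 h.symm
  have h1 := normalProj_eq_zero h0
  set t := ⟪S.gaussMap (S.param y₀), S.param y - S.param x⟫
  have e1 := inner_param_sub_gaussMap_neg hS hb hx hy hxy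
  have e2 := inner_param_sub_gaussMap_neg hS hb hy hx (Ne.symm hxy)
  rw [← neg_sub (S.param y), h1, inner_neg_left, inner_smul_left, RCLike.conj_to_real] at e2
  rw [h1, inner_smul_left, RCLike.conj_to_real] at e1
  have c1 := hS.cone _ ⟨y₀, hy₀, rfl⟩ _ ⟨x, hx, rfl⟩
  have c2 := hS.cone _ ⟨y₀, hy₀, rfl⟩ _ ⟨y, hy, rfl⟩
  nlinarith

/-- A vector orthogonal to N has N₀-component of square at most (1 - ⟨N₀, N⟩²)|T|² ≤ (3/4)|T|², so
at least a quarter of its squared length survives the projection. -/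
theorem norm_tangentMap_le_normalProj (hS : S.IsAdmissible) {y₀ x : 𝔼} (hy₀ : y₀ ∈ S.D)
    (hx : x ∈ S.D) (w : 𝔼) :
    1 / 2 * ‖S.tangentMap x w‖ ≤ ‖S.normalProj y₀ (S.tangentMap x w)‖ := by
  set N₀ := S.gaussMap (S.param y₀) with hN₀
  set N := S.gaussMap (S.param x) with hN
  set T := S.tangentMap x w
  have h1 := S.norm_sq_eq_normalProj y₀ T
  have hc := hS.cone _ ⟨y₀, hy₀, rfl⟩ _ ⟨x, hx, rfl⟩
  rw [← hN₀, ← hN] at hc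
  have hTN : ⟪N, T⟫ = 0 := by
    rw [hN, gaussMap_param, inner_smul_left, real_inner_comm, inner_tangentMap_normal, mul_zero]
  have h2 : ⟪N₀, T⟫ = ⟪N₀ - ⟪N₀, N⟫ • N, T⟫ := by
    rw [inner_sub_left, inner_smul_left, hTN, mul_zero, sub_zero]
  have h3 : ‖N₀ - ⟪N₀, N⟫ • N‖ ^ 2 = 1 - ⟪N₀, N⟫ ^ 2 := by
    rw [norm_sub_sq_real, norm_smul, mul_pow, inner_smul_right, hN, hN₀, norm_gaussMap,
      norm_gaussMap, Real.norm_eq_abs, sq_abs]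
    ring
  have h4 : ⟪N₀, T⟫ ^ 2 ≤ 3 / 4 * ‖T‖ ^ 2 := by
    have h5 := abs_real_inner_le_norm (N₀ - ⟪N₀, N⟫ • N) T
    rw [← h2] at h5
    have h6 := pow_le_pow_left₀ (abs_nonneg _) h5 2
    rw [sq_abs, mul_pow, h3] at h6
    refine h6.trans (mul_le_mul_of_nonneg_right ?_ (sq_nonneg _))
    nlinarith
  refine le_of_sq_le_sq ?_ (norm_nonneg _)
  rw [mul_pow]
  linarith

/-- The area element is the determinant of an isometric model of the tangent map. Relative to that
model, the projection shrinks no vector by more than 1/2 in each of the n - 1 dimensions. -/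
theorem areaElement_le_abs_det (hS : S.IsAdmissible) {y₀ x : 𝔼} (hy₀ : y₀ ∈ S.D)
    (hx : x ∈ S.D) :
    (1 / 2) ^ (n - 1) * S.areaElement x ≤ |((S.normalProj y₀).comp (S.tangentMap x)).det| := by
  set a := S.areaElement x with ha
  have hap : 0 < a := S.areaElement_pos x
  set g := gradient S.φ x with hg
  have hga : ‖g‖ ^ 2 = a ^ 2 - 1 := by rw [ha, areaElement_sq]; ring
  -- `R` is the square root of the first fundamental form 1 + g ⊗ g, so |R w| is the length of the
  -- tangent vector of `w`; its determinant is 1 + |g|²/(1 + a) = a.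
  let R : 𝔼 →ₗ[ℝ] 𝔼 := LinearMap.transvection ((innerSL ℝ g : 𝔼 →L[ℝ] ℝ) : 𝔼 →ₗ[ℝ] ℝ)
    ((1 + a)⁻¹ • g)
  have hRapp : ∀ w, R w = w + (⟪g, w⟫ * (1 + a)⁻¹) • g := fun w => by
    simp [R, LinearMap.transvection.apply, smul_smul]
  have hRdet : LinearMap.det R = a := by
    rw [LinearMap.transvection.det]
    simp only [ContinuousLinearMap.coe_coe, innerSL_apply_apply, inner_smul_right,
      real_inner_self_eq_norm_sq, hga]
    field_simp
    ring
  have hRnorm : ∀ w, ‖R w‖ = ‖S.tangentMap x w‖ := by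
    intro w
    refine (sq_eq_sq₀ (norm_nonneg _) (norm_nonneg _)).1 ?_
    rw [hRapp, norm_add_sq_real, norm_smul, mul_pow, hga, inner_smul_right, norm_sq_tangentMap,
      ← hg, Real.norm_eq_abs, sq_abs, real_inner_comm]
    field_simp
    ring
  have hRinj : Function.Injective R := (injective_iff_map_eq_zero _).2 fun w hw => by
    have := S.norm_le_norm_tangentMap x w
    rw [← hRnorm, hw, norm_zero] at this
    exact norm_le_zero_iff.1 this
  let Re := LinearEquiv.ofInjectiveEndo R hRinj
  have hRe : ∀ w, Re w = R w := fun w => rfl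
  let B : 𝔼 →ₗ[ℝ] 𝔼 := ((S.normalProj y₀).comp (S.tangentMap x) : 𝔼 →L[ℝ] 𝔼)
  have hB : B = (B.comp (Re.symm : 𝔼 →ₗ[ℝ] 𝔼)).comp R := by
    ext1 w
    simp only [LinearMap.comp_apply, LinearEquiv.coe_coe]
    rw [← hRe, Re.symm_apply_apply]
  have hdet := pow_finrank_le_abs_det (B.comp (Re.symm : 𝔼 →ₗ[ℝ] 𝔼)) (c := 1 / 2) (by norm_num)
    (fun w => by
      obtain ⟨v, rfl⟩ := Re.surjective w
      simp only [LinearMap.comp_apply, LinearEquiv.coe_coe, Re.symm_apply_apply]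
      rw [hRe, hRnorm]
      exact norm_tangentMap_le_normalProj hS hy₀ hx v)
  rw [finrank_euclideanSpace_fin] at hdet
  change _ ≤ |LinearMap.det B|
  rw [hB, LinearMap.det_comp, abs_mul, hRdet, abs_of_pos hap]
  exact mul_le_mul_of_nonneg_right hdet hap.le

/-- The hypersurface has at most Euclidean volume growth, with a constant depending only on the
dimension. -/
theorem surfaceMeasure_closedBall_le (hS : S.IsAdmissible) {lam Lam : ℝ}
    (hb : S.CurvatureBounds lam Lam) (z : 𝕍) {r : ℝ} (hr : 0 ≤ r) :
    S.surfaceMeasure (Metric.closedBall z r) ≤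
      (2 ^ (n - 1) * volume (Metric.ball (0 : 𝔼) 1)) * ENNReal.ofReal (r ^ (n - 1)) := by
  rw [surfaceMeasure_apply Metric.isClosed_closedBall.measurableSet]
  set A := S.D ∩ S.param ⁻¹' Metric.closedBall z r with hA
  have hAm : MeasurableSet A := (continuousOn_param.preimage_isClosed_of_isClosed
    S.isCompact_D.isClosed Metric.isClosed_closedBall).measurableSet
  rcases S.D.eq_empty_or_nonempty with h0 | ⟨y₀, hy₀⟩
  · simp [hA, h0]
  have hder : ∀ x ∈ A, HasFDerivWithinAt (fun x => S.normalProj y₀ (S.param x))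
      ((S.normalProj y₀).comp (S.tangentMap x)) A x := fun x hx =>
    ((S.normalProj y₀).hasFDerivAt.comp x (hasFDerivAt_param hx.1)).hasFDerivWithinAt
  have hle : ∀ x ∈ A, ENNReal.ofReal (S.areaElement x) ≤
      2 ^ (n - 1) * ENNReal.ofReal |((S.normalProj y₀).comp (S.tangentMap x)).det| := by
    intro x hx
    have h1 := areaElement_le_abs_det hS hy₀ hx.1
    have h2 : S.areaElement x ≤
        2 ^ (n - 1) * |((S.normalProj y₀).comp (S.tangentMap x)).det| := by
      have := mul_le_mul_of_nonneg_left h1 (by positivity : (0 : ℝ) ≤ 2 ^ (n - 1))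
      rwa [← mul_assoc, ← mul_pow, mul_one_div_cancel two_ne_zero, one_pow, one_mul] at this
    refine (ENNReal.ofReal_le_ofReal h2).trans ?_
    rw [ENNReal.ofReal_mul (by positivity), ENNReal.ofReal_pow zero_le_two, ENNReal.ofReal_ofNat]
  have himg : (fun x => S.normalProj y₀ (S.param x)) '' A ⊆
      Metric.closedBall (S.normalProj y₀ z) r := by
    rintro _ ⟨x, hx, rfl⟩
    have h1 : ‖S.param x - z‖ ≤ r := mem_closedBall_iff_norm.1 hx.2
    rw [mem_closedBall_iff_norm]
    dsimp only
    rw [← map_sub]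
    refine le_trans (le_of_sq_le_sq ?_ (norm_nonneg _)) h1
    rw [S.norm_sq_eq_normalProj y₀ (S.param x - z)]
    linarith [sq_nonneg ⟪S.gaussMap (S.param y₀), S.param x - z⟫]
  calc ∫⁻ x in A, ENNReal.ofReal (S.areaElement x)
      ≤ ∫⁻ x in A, 2 ^ (n - 1) *
          ENNReal.ofReal |((S.normalProj y₀).comp (S.tangentMap x)).det| :=
        setLIntegral_mono' hAm hle
    _ = 2 ^ (n - 1) * ∫⁻ x in A,
          ENNReal.ofReal |((S.normalProj y₀).comp (S.tangentMap x)).det| :=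
        lintegral_const_mul' _ _ (by finiteness)
    _ = 2 ^ (n - 1) * volume ((fun x => S.normalProj y₀ (S.param x)) '' A) := by
        rw [lintegral_abs_det_fderiv_eq_addHaar_image volume hAm hder
          ((injOn_normalProj hS hb hy₀).mono Set.inter_subset_left)]
    _ ≤ 2 ^ (n - 1) * volume (Metric.closedBall (S.normalProj y₀ z) r) := by gcongr
    _ = _ := by
        rw [Measure.addHaar_closedBall _ _ hr, finrank_euclideanSpace_fin]
        ring

theorem isFiniteMeasure_surfaceMeasure (hS : S.IsAdmissible) {lam Lam : ℝ}
    (hb : S.CurvatureBounds lam Lam) : IsFiniteMeasure S.surfaceMeasure := by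
  obtain ⟨r, hr⟩ := (isCompact_carrier (S := S)).isBounded.subset_closedBall 0
  refine ⟨?_⟩
  rw [← measure_add_measure_compl (isCompact_carrier (S := S)).isClosed.measurableSet,
    surfaceMeasure_compl_carrier, add_zero]
  have h1 : S.carrier ⊆ Metric.closedBall 0 (max r 0) :=
    hr.trans (Metric.closedBall_subset_closedBall (le_max_left _ _))
  refine (measure_mono h1).trans_lt
    ((surfaceMeasure_closedBall_le hS hb 0 (le_max_right _ _)).trans_lt ?_)
  have : volume (Metric.ball (0 : 𝔼) 1) ≠ ⊤ := measure_ball_lt_top.ne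
  finiteness

/-! ### The reflection kernel on pairs of points -/

variable (S) in
/-- The pairs `(u, u')` of distinct points of the hypersurface for which `R_u u'` exists. -/
def reflectionPairs : Set (𝕍 × 𝕍) :=
  {p | p.1 ∈ S.carrier ∧ p.2 ∈ S.reflectionDomain p.1 ∧ p.1 ≠ p.2}

/-- Pairs (u, u') are parametrised by (u', u''), the coordinates in which everything is explicit. -/
theorem mem_reflectionPairs_iff (hS : S.IsAdmissible) {lam Lam : ℝ}
    (hb : S.CurvatureBounds lam Lam) {p : 𝕍 × 𝕍} : p ∈ S.reflectionPairs ↔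
      ∃ y ∈ S.D, ∃ z ∈ S.D, z ≠ y ∧ p = (S.param (S.mid y z), S.param y) := by
  constructor
  · rintro ⟨⟨x, hx, h1⟩, h2, h3⟩
    obtain ⟨y, hy, h4⟩ := h2.1
    rw [← h1, ← h4] at h2 h3
    obtain ⟨z, hz, hzy, h5⟩ := exists_mid_eq hS hb hx hy (fun h => h3 (by rw [h])) h2
    exact ⟨y, hy, z, hz, hzy, Prod.ext (by rw [h5, h1]) h4.symm⟩
  · rintro ⟨y, hy, z, hz, hzy, rfl⟩
    exact ⟨⟨_, mid_mem hS hb hy hz hzy, rfl⟩, mem_reflectionDomain_mid hS hb hy hz hzy,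
      fun h => mid_ne hS hb hy hz hzy (S.param_injective h)⟩

theorem mapsTo_coord_reflectionPairs (hS : S.IsAdmissible) {lam Lam : ℝ}
    (hb : S.CurvatureBounds lam Lam) :
    Set.MapsTo (fun p : 𝕍 × 𝕍 => (S.coord p.1, S.coord p.2)) S.reflectionPairs S.coordPairs := by
  intro p hp
  obtain ⟨y, hy, z, hz, hzy, rfl⟩ := (mem_reflectionPairs_iff hS hb).1 hp
  dsimp only
  rw [coord_param, coord_param]
  exact ⟨(y, z), ⟨hy, hz, hzy⟩, rfl⟩

theorem continuous_coord_prod :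
    Continuous (fun p : 𝕍 × 𝕍 => (S.coord p.1, S.coord p.2)) :=
  (S.coord.continuous.comp continuous_fst).prodMk (S.coord.continuous.comp continuous_snd)

theorem measurableSet_reflectionPairs (hS : S.IsAdmissible) {lam Lam : ℝ}
    (hb : S.CurvatureBounds lam Lam) : MeasurableSet S.reflectionPairs := by
  have hc := (isCompact_carrier (S := S)).isClosed.measurableSet
  have : S.reflectionPairs = (S.carrier ×ˢ S.carrier) ∩
      (fun p : 𝕍 × 𝕍 => (S.coord p.1, S.coord p.2)) ⁻¹' S.coordPairs := by
    ext p
    constructor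
    · exact fun hp => ⟨⟨hp.1, hp.2.1.1⟩, mapsTo_coord_reflectionPairs hS hb hp⟩
    · rintro ⟨⟨⟨x, hx, h1⟩, ⟨x', hx', h2⟩⟩, ⟨⟨y, z⟩, ⟨hy, hz, hzy⟩, h⟩⟩
      dsimp only at h
      rw [← h1, ← h2, coord_param, coord_param] at h
      obtain ⟨h3, h4⟩ := Prod.mk.inj h
      dsimp only at h3 h4 hy hz hzy
      refine (mem_reflectionPairs_iff hS hb).2 ⟨y, hy, z, hz, hzy, Prod.ext ?_ ?_⟩
      · rw [h3, h1]
      · rw [h4, h2]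
  rw [this]
  exact (hc.prod hc).inter
    ((measurableSet_coordPairs hS hb).preimage continuous_coord_prod.measurable)

theorem mapsTo_coordReflection (hS : S.IsAdmissible) {lam Lam : ℝ}
    (hb : S.CurvatureBounds lam Lam) : Set.MapsTo S.coordReflection S.coordPairs S.D := by
  rintro _ ⟨⟨y, z⟩, ⟨hy, hz, hzy⟩, rfl⟩
  dsimp only at hy hz hzy ⊢
  rw [coordReflection_mid hS hb hy hz hzy]
  exact hz

theorem continuousOn_reflection (hS : S.IsAdmissible) {lam Lam : ℝ}
    (hb : S.CurvatureBounds lam Lam) :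
    ContinuousOn (fun p : 𝕍 × 𝕍 => S.reflection p.1 p.2) S.reflectionPairs := by
  have h := continuousOn_param.comp ((continuousOn_coordReflection hS hb).comp
    (continuous_coord_prod (S := S)).continuousOn (mapsTo_coord_reflectionPairs hS hb))
    ((mapsTo_coordReflection hS hb).comp (mapsTo_coord_reflectionPairs hS hb))
  refine h.congr fun p hp => ?_
  obtain ⟨y, hy, z, hz, hzy, rfl⟩ := (mem_reflectionPairs_iff hS hb).1 hp
  simp only [Function.comp_apply, coord_param]
  rw [coordReflection_mid hS hb hy hz hzy, reflection_mid hS hb hy hz hzy]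

/-- In place of the derivative of R, the formula of `jacobian_mid` is used, whose ingredients depend
continuously on the pair. -/
theorem continuousOn_jacobian (hS : S.IsAdmissible) {lam Lam : ℝ}
    (hb : S.CurvatureBounds lam Lam) :
    ContinuousOn (fun p : 𝕍 × 𝕍 => S.jacobian p.1 p.2) S.reflectionPairs := by
  have hm := mapsTo_coord_reflectionPairs hS hb
  have hρ : ContinuousOn (fun p : 𝕍 × 𝕍 => S.coordReflection (S.coord p.1, S.coord p.2))
      S.reflectionPairs :=
    (continuousOn_coordReflection hS hb).comp continuous_coord_prod.continuousOn hm
  have hρm : Set.MapsTo (fun p : 𝕍 × 𝕍 => S.coordReflection (S.coord p.1, S.coord p.2))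
      S.reflectionPairs S.D := (mapsTo_coordReflection hS hb).comp hm
  have hx : ContinuousOn (fun p : 𝕍 × 𝕍 => S.coord p.1) S.reflectionPairs :=
    (S.coord.continuous.comp continuous_fst).continuousOn
  have hy : ContinuousOn (fun p : 𝕍 × 𝕍 => S.coord p.2) S.reflectionPairs :=
    (S.coord.continuous.comp continuous_snd).continuousOn
  have hxm : Set.MapsTo (fun p : 𝕍 × 𝕍 => S.coord p.1) S.reflectionPairs S.D := by
    rintro p ⟨⟨x, hx, h⟩, -⟩
    dsimp only
    rwa [← h, coord_param]
  have hoff : Set.MapsTo (fun p : 𝕍 × 𝕍 =>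
      (S.coord p.2, S.coordReflection (S.coord p.1, S.coord p.2))) S.reflectionPairs S.offDiag := by
    intro p hp
    obtain ⟨y, hy, z, hz, hzy, rfl⟩ := (mem_reflectionPairs_iff hS hb).1 hp
    simp only [coord_param]
    rw [coordReflection_mid hS hb hy hz hzy]
    exact ⟨hy, hz, hzy⟩
  have hM' : ContinuousOn (fun p : 𝕍 × 𝕍 => S.midGradientDeriv (S.coord p.2)
      (S.coordReflection (S.coord p.1, S.coord p.2))) S.reflectionPairs :=
    ContinuousOn.comp (g := fun q : 𝔼 × 𝔼 => S.midGradientDeriv q.1 q.2)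
      (f := fun p : 𝕍 × 𝕍 => (S.coord p.2, S.coordReflection (S.coord p.1, S.coord p.2)))
      (continuousOn_midGradientDeriv hS hb) (hy.prodMk hρ) hoff
  have hM : ContinuousOn (fun p : 𝕍 × 𝕍 => (S.midGradientDeriv (S.coord p.2)
      (S.coordReflection (S.coord p.1, S.coord p.2))).det⁻¹) S.reflectionPairs :=
    ContinuousOn.inv₀ (ContinuousLinearMap.continuous_det.comp_continuousOn hM') fun p hp =>
      midGradientDeriv_det_ne_zero hS hb (hoff hp).1 (hoff hp).2.1 (hoff hp).2.2
  have hH' : ContinuousOn (fun p : 𝕍 × 𝕍 => S.hess (S.coord p.1)) S.reflectionPairs :=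
    ContinuousOn.comp (g := S.hess) continuousOn_hess hx hxm
  have hH : ContinuousOn (fun p : 𝕍 × 𝕍 => (S.hess (S.coord p.1)).det) S.reflectionPairs :=
    ContinuousLinearMap.continuous_det.comp_continuousOn hH'
  have ha1 : ContinuousOn (fun p : 𝕍 × 𝕍 => S.areaElement (S.coord p.1)) S.reflectionPairs :=
    ContinuousOn.comp (g := S.areaElement) continuousOn_areaElement hx hxm
  have ha2 : ContinuousOn (fun p : 𝕍 × 𝕍 => S.areaElement
      (S.coordReflection (S.coord p.1, S.coord p.2))) S.reflectionPairs :=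
    ContinuousOn.comp (g := S.areaElement) continuousOn_areaElement hρ hρm
  have h : ContinuousOn (fun p : 𝕍 × 𝕍 => |(S.midGradientDeriv (S.coord p.2)
      (S.coordReflection (S.coord p.1, S.coord p.2))).det⁻¹ * (S.hess (S.coord p.1)).det| *
      (S.areaElement (S.coordReflection (S.coord p.1, S.coord p.2)) /
        S.areaElement (S.coord p.1))) S.reflectionPairs :=
    (hM.mul hH).abs.mul (ha2.div ha1 fun p _ => (S.areaElement_pos _).ne')
  refine h.congr fun p hp => ?_
  obtain ⟨y, hy, z, hz, hzy, rfl⟩ := (mem_reflectionPairs_iff hS hb).1 hp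
  simp only [coord_param]
  rw [coordReflection_mid hS hb hy hz hzy, jacobian_mid hS hb hy hz hzy]

open Classical in
variable (S) in
/-- The map `(u, u') ↦ R_u u'`, set to zero where `R_u u'` does not exist. -/
def reflectionExt : 𝕍 × 𝕍 → 𝕍 :=
  S.reflectionPairs.piecewise (fun p => S.reflection p.1 p.2) fun _ => 0

open Classical in
variable (S) in
/-- The Jacobian factor, set to zero where `R_u u'` does not exist and on the diagonal. -/
def jacobianExt : 𝕍 × 𝕍 → ℝ :=
  S.reflectionPairs.piecewise (fun p => S.jacobian p.1 p.2) fun _ => 0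

theorem measurable_reflectionExt (hS : S.IsAdmissible) {lam Lam : ℝ}
    (hb : S.CurvatureBounds lam Lam) : Measurable S.reflectionExt := by
  classical
  exact (continuousOn_reflection hS hb).measurable_piecewise continuousOn_const
    (measurableSet_reflectionPairs hS hb)

theorem measurable_jacobianExt (hS : S.IsAdmissible) {lam Lam : ℝ}
    (hb : S.CurvatureBounds lam Lam) : Measurable S.jacobianExt := by
  classical
  exact (continuousOn_jacobian hS hb).measurable_piecewise continuousOn_const
    (measurableSet_reflectionPairs hS hb)

theorem jacobianExt_nonneg (p : 𝕍 × 𝕍) : 0 ≤ S.jacobianExt p := by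
  classical
  by_cases hp : p ∈ S.reflectionPairs
  · rw [jacobianExt, Set.piecewise_eq_of_mem _ _ _ hp, jacobian]
    exact mul_nonneg (abs_nonneg _) (div_nonneg (S.areaElement_pos _).le (S.areaElement_pos _).le)
  · rw [jacobianExt, Set.piecewise_eq_of_notMem _ _ _ hp]

theorem jacobianExt_of_notMem {p : 𝕍 × 𝕍} (hp : p ∉ S.reflectionPairs) : S.jacobianExt p = 0 := by
  classical exact Set.piecewise_eq_of_notMem _ _ _ hp

theorem jacobianExt_of_mem {p : 𝕍 × 𝕍} (hp : p ∈ S.reflectionPairs) :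
    S.jacobianExt p = S.jacobian p.1 p.2 := by
  classical exact Set.piecewise_eq_of_mem _ _ _ hp

theorem reflectionExt_of_mem {p : 𝕍 × 𝕍} (hp : p ∈ S.reflectionPairs) :
    S.reflectionExt p = S.reflection p.1 p.2 := by
  classical exact Set.piecewise_eq_of_mem _ _ _ hp

theorem reflectionPairs_bounds (hS : S.IsAdmissible) {lam Lam : ℝ}
    (hb : S.CurvatureBounds lam Lam) {p : 𝕍 × 𝕍} (hp : p ∈ S.reflectionPairs) :
    0 < ‖p.2 - S.reflectionExt p‖ ∧ ‖p.2 - S.reflectionExt p‖ ≤ Metric.diam S.carrier ∧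
      lam * ‖p.1 - p.2‖ ≤ 4 * Lam * ‖p.2 - S.reflectionExt p‖ := by
  rw [reflectionExt_of_mem hp]
  obtain ⟨y, hy, z, hz, hzy, rfl⟩ := (mem_reflectionPairs_iff hS hb).1 hp
  dsimp only
  rw [reflection_mid hS hb hy hz hzy]
  refine ⟨norm_pos_iff.2 (sub_ne_zero.2 fun h => hzy (S.param_injective h).symm), ?_,
    norm_param_mid_sub_le hS hb hy hz hzy⟩
  rw [← dist_eq_norm]
  exact Metric.dist_le_diam_of_mem isCompact_carrier.isBounded ⟨y, hy, rfl⟩ ⟨z, hz, rfl⟩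

/-- The change of variables `u'' = R_u u'` for fixed `u'`. -/
theorem lintegral_reflection_le (hS : S.IsAdmissible) {lam Lam : ℝ}
    (hb : S.CurvatureBounds lam Lam) (v : 𝕍) {f : 𝕍 → ℝ≥0∞} (hf : Measurable f) :
    ∫⁻ u, f (S.reflectionExt (u, v)) * ENNReal.ofReal (S.jacobianExt (u, v)) ∂S.surfaceMeasure ≤
      ∫⁻ u, f u ∂S.surfaceMeasure := by
  by_cases hv : v ∈ S.carrier
  swap
  · have : ∀ u, S.jacobianExt (u, v) = 0 := fun u =>
      jacobianExt_of_notMem fun h => hv h.2.1.1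
    simp [this]
  obtain ⟨y, hy, rfl⟩ := hv
  have hm : Measurable fun u => f (S.reflectionExt (u, S.param y)) *
      ENNReal.ofReal (S.jacobianExt (u, S.param y)) :=
    (hf.comp ((measurable_reflectionExt hS hb).comp measurable_prodMk_right)).mul
      ((measurable_jacobianExt hS hb).comp measurable_prodMk_right).ennreal_ofReal
  rw [lintegral_surfaceMeasure hm, lintegral_surfaceMeasure hf]
  let A : Set 𝔼 := {x | (x, y) ∈ S.coordPairs}
  have hA : MeasurableSet A := (measurableSet_coordPairs hS hb).preimage measurable_prodMk_right
  have hAmid : ∀ x ∈ A, ∃ z ∈ S.D, z ≠ y ∧ S.mid y z = x := by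
    rintro x ⟨⟨y', z⟩, ⟨hy', hz, hzy⟩, h⟩
    obtain ⟨h1, rfl⟩ := Prod.mk.inj h
    exact ⟨z, hz, hzy, h1⟩
  let ρ := S.reflectionInCoord (S.param y)
  let E := S.reflectionInCoordDomain (S.param y)
  have hρ : ∀ {z}, z ∈ S.D → z ≠ y → ρ (S.mid y z) = z := fun hz hzy =>
    coordReflection_mid hS hb hy hz hzy
  have hAE : A ⊆ E := by
    intro x hx
    obtain ⟨z, hz, hzy, rfl⟩ := hAmid x hx
    exact ⟨mid_mem hS hb hy hz hzy, mem_reflectionDomain_mid hS hb hy hz hzy⟩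
  have hder : ∀ x ∈ A, HasFDerivWithinAt ρ (fderivWithin ℝ ρ E x) A x := by
    intro x hx
    obtain ⟨z, hz, hzy, rfl⟩ := hAmid x hx
    exact (reflectionInCoord_fderiv hS hb hy hz hzy).1.mono hAE
  have hinj : Set.InjOn ρ A := by
    intro x₁ h₁ x₂ h₂ h
    obtain ⟨z₁, hz₁, hzy₁, rfl⟩ := hAmid x₁ h₁
    obtain ⟨z₂, hz₂, hzy₂, rfl⟩ := hAmid x₂ h₂
    rw [hρ hz₁ hzy₁, hρ hz₂ hzy₂] at h
    rw [h]
  have himg : ρ '' A ⊆ S.D := by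
    rintro _ ⟨x, hx, rfl⟩
    obtain ⟨z, hz, hzy, rfl⟩ := hAmid x hx
    rwa [hρ hz hzy]
  have hAD : A ⊆ S.D := fun x hx => (hAE hx).1
  calc _ = ∫⁻ x in S.D, A.indicator (fun x => ENNReal.ofReal |(fderivWithin ℝ ρ E x).det| *
          (f (S.param (ρ x)) * ENNReal.ofReal (S.areaElement (ρ x)))) x := by
        refine setLIntegral_congr_fun measurableSet_D fun x hxD => ?_
        by_cases hx : x ∈ A
        · rw [Set.indicator_of_mem hx]
          obtain ⟨z, hz, hzy, rfl⟩ := hAmid x hx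
          have hp : (S.param (S.mid y z), S.param y) ∈ S.reflectionPairs :=
            (mem_reflectionPairs_iff hS hb).2 ⟨y, hy, z, hz, hzy, rfl⟩
          rw [jacobianExt_of_mem hp, reflectionExt_of_mem hp, reflection_mid hS hb hy hz hzy,
            hρ hz hzy, jacobian, coord_param, reflection_mid hS hb hy hz hzy, coord_param,
            mul_assoc, ← ENNReal.ofReal_mul (mul_nonneg (abs_nonneg _)
              (div_nonneg (S.areaElement_pos _).le (S.areaElement_pos _).le)), mul_assoc,
            div_mul_cancel₀ _ (S.areaElement_pos _).ne', ENNReal.ofReal_mul (abs_nonneg _)]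
          ring
        · rw [Set.indicator_of_notMem hx, jacobianExt_of_notMem]
          · simp
          · intro hp
            obtain ⟨y', hy', z, hz, hzy, h⟩ := (mem_reflectionPairs_iff hS hb).1 hp
            obtain ⟨h1, h2⟩ := Prod.mk.inj h
            refine hx ⟨(y', z), ⟨hy', hz, hzy⟩, ?_⟩
            rw [S.param_injective h1, S.param_injective h2]
    _ = ∫⁻ x in A, ENNReal.ofReal |(fderivWithin ℝ ρ E x).det| *
          (f (S.param (ρ x)) * ENNReal.ofReal (S.areaElement (ρ x))) := by
        rw [lintegral_indicator hA, Measure.restrict_restrict hA, Set.inter_eq_left.2 hAD]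
    _ = ∫⁻ z in ρ '' A, f (S.param z) * ENNReal.ofReal (S.areaElement z) :=
        (lintegral_image_eq_lintegral_abs_det_fderiv_mul volume hA hder hinj
          fun z => f (S.param z) * ENNReal.ofReal (S.areaElement z)).symm
    -- The only inequality: the reflected points need not fill `D`.
    _ ≤ _ := lintegral_mono_set himg

end GraphHypersurface

end

noncomputable section

/-! ### A bilinear estimate for localised kernels -/

namespace BilinearKernel

theorem ennreal_tsum_rpow_le {q : ℝ} (hq0 : 0 ≤ q) (hq1 : q ≤ 1) (a : ℕ → ℝ≥0∞) :
    (∑' k, a k) ^ q ≤ ∑' k, a k ^ q := by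
  rcases hq0.eq_or_lt with rfl | hq
  · simp only [ENNReal.rpow_zero]
    calc (1 : ℝ≥0∞) = ∑ k ∈ {0}, (fun _ : ℕ => (1 : ℝ≥0∞)) k := by simp
      _ ≤ _ := ENNReal.sum_le_tsum _
  have hfin : ∀ N : ℕ, (∑ k ∈ Finset.range N, a k) ^ q ≤ ∑ k ∈ Finset.range N, a k ^ q := by
    intro N
    induction N with
    | zero => simp [ENNReal.zero_rpow_of_pos hq]
    | succ N ih =>
      rw [Finset.sum_range_succ, Finset.sum_range_succ]
      exact (ENNReal.rpow_add_le_add_rpow _ _ hq0 hq1).trans (by gcongr)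
  refine le_of_tendsto' ((ENNReal.continuous_rpow_const.tendsto _).comp
    (ENNReal.tendsto_nat_tsum a)) fun N => (hfin N).trans (ENNReal.sum_le_tsum _)

variable {V : Type*} [NormedAddCommGroup V] [NormedSpace ℝ V] [FiniteDimensional ℝ V]
  [MeasurableSpace V] [BorelSpace V]

theorem lintegral_le_measure_rpow_mul {α : Type*} [MeasurableSpace α] (μ : Measure α) {p : ℝ}
    (hp : 1 ≤ p) {f : α → ℝ≥0∞} (hf : AEMeasurable f μ) :
    ∫⁻ x, f x ∂μ ≤ μ Set.univ ^ (1 - 1 / p) * (∫⁻ x, f x ^ p ∂μ) ^ (1 / p) := by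
  rcases hp.eq_or_lt with rfl | hp
  · simp
  · have hpq := Real.HolderConjugate.conjExponent hp
    have h := ENNReal.lintegral_mul_le_Lp_mul_Lq μ hpq hf (aemeasurable_const (b := 1))
    simp only [Pi.mul_apply, mul_one, ENNReal.one_rpow, lintegral_const, one_mul] at h
    rw [mul_comm]
    refine h.trans (le_of_eq ?_)
    congr 2
    have := hpq.inv_add_inv_eq_one
    rw [one_div, one_div]; linarith

theorem measurableSet_dist_le (r : ℝ) : MeasurableSet {p : V × V | dist p.2 p.1 ≤ r} :=
  (isClosed_le (continuous_snd.dist continuous_fst) continuous_const).measurableSet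

/-- Fubini: by translation invariance, the set of centres z whose ball contains a given point has
the same measure for every point. This turns estimates on balls into global ones. -/
theorem lintegral_closedBall_eq (σ ν : Measure V) [SFinite σ] [ν.IsAddHaarMeasure] (r : ℝ)
    {h : V → ℝ≥0∞} (hh : Measurable h) :
    ∫⁻ z, ∫⁻ u in Metric.closedBall z r, h u ∂σ ∂ν =
      ν (Metric.closedBall 0 r) * ∫⁻ u, h u ∂σ := by
  have hm : Measurable (Function.uncurry fun z u : V =>
      (Metric.closedBall z r).indicator h u) := by
    have : (Function.uncurry fun z u : V => (Metric.closedBall z r).indicator h u) =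
        {p : V × V | dist p.2 p.1 ≤ r}.indicator fun p => h p.2 := by
      ext p
      simp only [Function.uncurry, Set.indicator, Metric.mem_closedBall, Set.mem_ofPred_eq]
    rw [this]
    exact (hh.comp measurable_snd).indicator (measurableSet_dist_le r)
  calc ∫⁻ z, ∫⁻ u in Metric.closedBall z r, h u ∂σ ∂ν
      = ∫⁻ z, ∫⁻ u, (Metric.closedBall z r).indicator h u ∂σ ∂ν := by
        refine lintegral_congr fun z => ?_
        rw [lintegral_indicator Metric.isClosed_closedBall.measurableSet]
    _ = ∫⁻ u, ∫⁻ z, (Metric.closedBall z r).indicator h u ∂ν ∂σ :=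
        lintegral_lintegral_swap hm.aemeasurable
    _ = ∫⁻ u, ν (Metric.closedBall 0 r) * h u ∂σ := by
        refine lintegral_congr fun u => ?_
        have : (fun z => (Metric.closedBall z r).indicator h u) =
            (Metric.closedBall u r).indicator fun _ => h u := by
          ext z
          simp only [Set.indicator, Metric.mem_closedBall, dist_comm]
        rw [this, lintegral_indicator Metric.isClosed_closedBall.measurableSet,
          setLIntegral_const, Measure.addHaar_closedBall_center, mul_comm]
    _ = _ := lintegral_const_mul _ hh

/-- The positive bilinear operator with kernel `J` along the map `R`. -/
def op {V : Type*} [MeasurableSpace V] (σ : Measure V) (R : V × V → V) (J : V × V → ℝ≥0∞)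
    (G₁ G₂ : V → ℝ≥0∞) (u : V) : ℝ≥0∞ :=
  ∫⁻ v, G₁ v * (G₂ (R (u, v)) * J (u, v)) ∂σ

theorem measurable_op {V : Type*} [MeasurableSpace V] {σ : Measure V} [SFinite σ]
    {R : V × V → V} {J : V × V → ℝ≥0∞} {G₁ G₂ : V → ℝ≥0∞} (hR : Measurable R)
    (hJ : Measurable J) (hG₁ : Measurable G₁) (hG₂ : Measurable G₂) : Measurable (op σ R J G₁ G₂) :=
  Measurable.lintegral_prod_right' (f := fun p : V × V => G₁ p.2 * (G₂ (R p) * J p))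
    ((hG₁.comp measurable_snd).mul ((hG₂.comp hR).mul hJ))

/-- The kernel `J` is dominated by the Jacobian factor of `u ↦ R (u, v)`. -/
def IsSubJacobian {V : Type*} [MeasurableSpace V] (σ : Measure V) (R : V × V → V)
    (J : V × V → ℝ≥0∞) : Prop :=
  ∀ v, ∀ f : V → ℝ≥0∞, Measurable f → ∫⁻ u, f (R (u, v)) * J (u, v) ∂σ ≤ ∫⁻ u, f u ∂σ

/-- Localisation lets both functions be cut off to the doubled ball. After Fubini, the inner
integral in u is bounded by the integral of the cut-off G₂, independently of v, so the double
integral splits into a product. -/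
theorem setLIntegral_op_le {σ : Measure V} [SFinite σ] {R : V × V → V} {J : V × V → ℝ≥0∞}
    {G₁ G₂ : V → ℝ≥0∞} (hR : Measurable R) (hJ : Measurable J) (hG₁ : Measurable G₁)
    (hG₂ : Measurable G₂) (hRJ : IsSubJacobian σ R J) {ρ : ℝ}
    (hloc : ∀ p, J p ≠ 0 → ‖p.1 - p.2‖ ≤ ρ ∧ ‖p.1 - R p‖ ≤ ρ) (z : V) :
    ∫⁻ u in Metric.closedBall z ρ, op σ R J G₁ G₂ u ∂σ ≤
      (∫⁻ u in Metric.closedBall z (2 * ρ), G₁ u ∂σ) *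
        ∫⁻ u in Metric.closedBall z (2 * ρ), G₂ u ∂σ := by
  set B := Metric.closedBall z ρ with hB
  set B' := Metric.closedBall z (2 * ρ) with hB'
  have hB'm : MeasurableSet B' := Metric.isClosed_closedBall.measurableSet
  have hBm : MeasurableSet B := Metric.isClosed_closedBall.measurableSet
  have hmem : ∀ u ∈ B, ∀ w, ‖u - w‖ ≤ ρ → w ∈ B' := by
    intro u hu w hw
    rw [Metric.mem_closedBall] at hu ⊢
    have h1 : dist w u ≤ ρ := by rw [dist_comm, dist_eq_norm]; exact hw
    linarith [dist_triangle w u z]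
  have hm : Measurable (Function.uncurry fun u v : V => G₁ v * (G₂ (R (u, v)) * J (u, v))) :=
    (hG₁.comp measurable_snd).mul ((hG₂.comp hR).mul hJ)
  calc ∫⁻ u in B, op σ R J G₁ G₂ u ∂σ
      ≤ ∫⁻ u in B, ∫⁻ v, B'.indicator G₁ v * (B'.indicator G₂ (R (u, v)) * J (u, v)) ∂σ ∂σ := by
        refine setLIntegral_mono' hBm fun u hu => lintegral_mono fun v => ?_
        by_cases hJ0 : J (u, v) = 0
        · simp [hJ0]
        · obtain ⟨h1, h2⟩ := hloc (u, v) hJ0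
          rw [Set.indicator_of_mem (hmem u hu v h1), Set.indicator_of_mem (hmem u hu _ h2)]
    _ ≤ ∫⁻ u, ∫⁻ v, B'.indicator G₁ v * (B'.indicator G₂ (R (u, v)) * J (u, v)) ∂σ ∂σ :=
        setLIntegral_le_lintegral _ _
    _ = ∫⁻ v, ∫⁻ u, B'.indicator G₁ v * (B'.indicator G₂ (R (u, v)) * J (u, v)) ∂σ ∂σ := by
        refine lintegral_lintegral_swap (Measurable.aemeasurable ?_)
        exact ((hG₁.indicator hB'm).comp measurable_snd).mul
          (((hG₂.indicator hB'm).comp hR).mul hJ)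
    _ ≤ ∫⁻ v, B'.indicator G₁ v * ∫⁻ u, B'.indicator G₂ u ∂σ ∂σ := by
        refine lintegral_mono fun v => ?_
        dsimp only
        have hm' : Measurable fun u => B'.indicator G₂ (R (u, v)) * J (u, v) :=
          ((hG₂.indicator hB'm).comp (hR.comp measurable_prodMk_right)).mul
            (hJ.comp measurable_prodMk_right)
        rw [lintegral_const_mul _ hm']
        exact mul_le_mul_right (hRJ v _ (hG₂.indicator hB'm)) _
    _ = _ := by
        rw [lintegral_mul_const _ (hG₁.indicator hB'm), lintegral_indicator hB'm,
          lintegral_indicator hB'm]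

/-- Hölder from L¹ down to L^q on the left (q ≤ 1) and from L¹ up to L^(2q) on the right (2q ≥ 1).
The powers of M add up to (1 - q) + 2 (q - 1/2) = q. -/
theorem setLIntegral_op_rpow_le {σ : Measure V} [SFinite σ] {R : V × V → V} {J : V × V → ℝ≥0∞}
    {G₁ G₂ : V → ℝ≥0∞} (hR : Measurable R) (hJ : Measurable J) (hG₁ : Measurable G₁)
    (hG₂ : Measurable G₂) (hRJ : IsSubJacobian σ R J) {ρ : ℝ} (hρ : 0 ≤ ρ)
    (hloc : ∀ p, J p ≠ 0 → ‖p.1 - p.2‖ ≤ ρ ∧ ‖p.1 - R p‖ ≤ ρ) {q : ℝ}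
    (hq : q ∈ Set.Icc (1 / 2 : ℝ) 1) {M : ℝ≥0∞}
    (hM : ∀ z, σ (Metric.closedBall z (2 * ρ)) ≤ M) (z : V) :
    ∫⁻ u in Metric.closedBall z ρ, op σ R J G₁ G₂ u ^ q ∂σ ≤
      M ^ q * ((∫⁻ u in Metric.closedBall z (2 * ρ), G₁ u ^ (2 * q) ∂σ) ^ (1 / 2 : ℝ) *
        (∫⁻ u in Metric.closedBall z (2 * ρ), G₂ u ^ (2 * q) ∂σ) ^ (1 / 2 : ℝ)) := by
  obtain ⟨hq0, hq1⟩ := hq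
  have hqpos : 0 < q := by linarith
  have hop := measurable_op (σ := σ) hR hJ hG₁ hG₂
  have hball : σ (Metric.closedBall z ρ) ≤ M :=
    (measure_mono (Metric.closedBall_subset_closedBall (by linarith))).trans (hM z)
  have h1 := lintegral_le_measure_rpow_mul (σ.restrict (Metric.closedBall z ρ)) (p := 1 / q)
    (by rw [le_div_iff₀ hqpos]; linarith) (hop.pow_const q).aemeasurable
  simp only [one_div_one_div, Measure.restrict_apply_univ, ← ENNReal.rpow_mul,
    mul_one_div_cancel hqpos.ne', ENNReal.rpow_one] at h1
  have hG : ∀ G : V → ℝ≥0∞, Measurable G → ∫⁻ u in Metric.closedBall z (2 * ρ), G u ∂σ ≤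
      M ^ (1 - 1 / (2 * q)) *
        (∫⁻ u in Metric.closedBall z (2 * ρ), G u ^ (2 * q) ∂σ) ^ (1 / (2 * q)) := by
    intro G hGm
    have h := lintegral_le_measure_rpow_mul (σ.restrict (Metric.closedBall z (2 * ρ)))
      (p := 2 * q) (by linarith) hGm.aemeasurable
    rw [Measure.restrict_apply_univ] at h
    refine h.trans ?_
    have : 0 ≤ 1 - 1 / (2 * q) := by
      rw [sub_nonneg, div_le_one (by linarith)]; linarith
    gcongr
    exact hM z
  set a := ∫⁻ u in Metric.closedBall z (2 * ρ), G₁ u ^ (2 * q) ∂σ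
  set b := ∫⁻ u in Metric.closedBall z (2 * ρ), G₂ u ^ (2 * q) ∂σ
  have he : 0 ≤ 1 - 1 / (2 * q) := by
    rw [sub_nonneg, div_le_one (by linarith)]; linarith
  calc _ ≤ σ (Metric.closedBall z ρ) ^ (1 - q) *
        (∫⁻ u in Metric.closedBall z ρ, op σ R J G₁ G₂ u ∂σ) ^ q := h1
    _ ≤ M ^ (1 - q) * ((M ^ (1 - 1 / (2 * q)) * a ^ (1 / (2 * q))) *
          (M ^ (1 - 1 / (2 * q)) * b ^ (1 / (2 * q)))) ^ q := by
        have h2 : 0 ≤ 1 - q := by linarith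
        gcongr
        exact (setLIntegral_op_le hR hJ hG₁ hG₂ hRJ hloc z).trans
          (mul_le_mul' (hG G₁ hG₁) (hG G₂ hG₂))
    _ = _ := by
        simp only [ENNReal.mul_rpow_of_nonneg _ _ hqpos.le, ← ENNReal.rpow_mul]
        have e1 : 1 / (2 * q) * q = 1 / 2 := by field_simp
        have e2 : (1 - 1 / (2 * q)) * q = q - 1 / 2 := by rw [sub_mul, e1]; ring
        rw [e1, e2]
        have e3 : M ^ q = M ^ (1 - q) * (M ^ (q - 1 / 2) * M ^ (q - 1 / 2)) := by
          rw [← ENNReal.rpow_add_of_nonneg _ _ (by linarith) (by linarith),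
            ← ENNReal.rpow_add_of_nonneg _ _ (by linarith) (by linarith)]
          congr 1; ring
        rw [e3]; ring

/-- Integrate the local estimate over all centres; Cauchy–Schwarz handles the product of the two
square roots. The factor 2^dim is the volume ratio of the doubled ball to the ball. -/
theorem lintegral_op_rpow_le {σ : Measure V} [SFinite σ] {R : V × V → V} {J : V × V → ℝ≥0∞}
    {G₁ G₂ : V → ℝ≥0∞} (hR : Measurable R) (hJ : Measurable J) (hG₁ : Measurable G₁)
    (hG₂ : Measurable G₂) (hRJ : IsSubJacobian σ R J) {ρ : ℝ} (hρ : 0 < ρ)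
    (hloc : ∀ p, J p ≠ 0 → ‖p.1 - p.2‖ ≤ ρ ∧ ‖p.1 - R p‖ ≤ ρ) {q : ℝ}
    (hq : q ∈ Set.Icc (1 / 2 : ℝ) 1) {M : ℝ≥0∞}
    (hM : ∀ z, σ (Metric.closedBall z (2 * ρ)) ≤ M) :
    ∫⁻ u, op σ R J G₁ G₂ u ^ q ∂σ ≤ 2 ^ Module.finrank ℝ V * (M ^ q *
      ((∫⁻ u, G₁ u ^ (2 * q) ∂σ) ^ (1 / 2 : ℝ) * (∫⁻ u, G₂ u ^ (2 * q) ∂σ) ^ (1 / 2 : ℝ))) := by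
  let ν : Measure V := Measure.addHaar
  have hνpos : ν (Metric.closedBall 0 ρ) ≠ 0 := (Metric.measure_closedBall_pos ν 0 hρ).ne'
  have hνtop : ν (Metric.closedBall 0 ρ) ≠ ⊤ := measure_closedBall_lt_top.ne
  have hν2 : ν (Metric.closedBall 0 (2 * ρ)) =
      2 ^ Module.finrank ℝ V * ν (Metric.closedBall 0 ρ) := by
    rw [Measure.addHaar_closedBall _ _ (by linarith : (0 : ℝ) ≤ 2 * ρ),
      Measure.addHaar_closedBall _ _ hρ.le, mul_pow, ENNReal.ofReal_mul (by positivity),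
      ENNReal.ofReal_pow zero_le_two, ENNReal.ofReal_ofNat, mul_assoc]
  have hop := measurable_op (σ := σ) hR hJ hG₁ hG₂
  have hmeas : ∀ G : V → ℝ≥0∞, Measurable G →
      Measurable fun z => ∫⁻ u in Metric.closedBall z (2 * ρ), G u ∂σ := by
    intro G hG
    have h : Measurable fun p : V × V => {p : V × V | dist p.2 p.1 ≤ 2 * ρ}.indicator
        (fun p => G p.2) p := (hG.comp measurable_snd).indicator (measurableSet_dist_le _)
    convert Measurable.lintegral_prod_right' (ν := σ) h using 2 with z
    rw [← lintegral_indicator Metric.isClosed_closedBall.measurableSet]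
    rfl
  have key : ν (Metric.closedBall 0 ρ) * ∫⁻ u, op σ R J G₁ G₂ u ^ q ∂σ ≤
      ν (Metric.closedBall 0 ρ) * (2 ^ Module.finrank ℝ V * (M ^ q *
        ((∫⁻ u, G₁ u ^ (2 * q) ∂σ) ^ (1 / 2 : ℝ) *
          (∫⁻ u, G₂ u ^ (2 * q) ∂σ) ^ (1 / 2 : ℝ)))) := by
    rw [← lintegral_closedBall_eq σ ν ρ (hop.pow_const q)]
    calc _ ≤ ∫⁻ z, M ^ q *
          ((∫⁻ u in Metric.closedBall z (2 * ρ), G₁ u ^ (2 * q) ∂σ) ^ (1 / 2 : ℝ) *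
          (∫⁻ u in Metric.closedBall z (2 * ρ), G₂ u ^ (2 * q) ∂σ) ^ (1 / 2 : ℝ)) ∂ν :=
          lintegral_mono fun z =>
            setLIntegral_op_rpow_le hR hJ hG₁ hG₂ hRJ hρ.le hloc hq hM z
      _ = M ^ q * ∫⁻ z,
          ((∫⁻ u in Metric.closedBall z (2 * ρ), G₁ u ^ (2 * q) ∂σ) ^ (1 / 2 : ℝ) *
          (∫⁻ u in Metric.closedBall z (2 * ρ), G₂ u ^ (2 * q) ∂σ) ^ (1 / 2 : ℝ)) ∂ν :=
          lintegral_const_mul _ (((hmeas _ (hG₁.pow_const _)).pow_const _).mul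
            ((hmeas _ (hG₂.pow_const _)).pow_const _))
      _ ≤ M ^ q * ((∫⁻ z, ∫⁻ u in Metric.closedBall z (2 * ρ), G₁ u ^ (2 * q) ∂σ ∂ν) ^
            (1 / 2 : ℝ) *
          (∫⁻ z, ∫⁻ u in Metric.closedBall z (2 * ρ), G₂ u ^ (2 * q) ∂σ ∂ν) ^ (1 / 2 : ℝ)) := by
          gcongr
          have h := ENNReal.lintegral_mul_le_Lp_mul_Lq ν Real.HolderConjugate.two_two
            ((hmeas _ (hG₁.pow_const (2 * q))).pow_const (1 / 2 : ℝ)).aemeasurable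
            ((hmeas _ (hG₂.pow_const (2 * q))).pow_const (1 / 2 : ℝ)).aemeasurable
          simpa only [Pi.mul_apply, ← ENNReal.rpow_mul, one_div,
            inv_mul_cancel₀ (two_ne_zero (α := ℝ)), ENNReal.rpow_one] using h
      _ = _ := by
          rw [lintegral_closedBall_eq σ ν _ (hG₁.pow_const _),
            lintegral_closedBall_eq σ ν _ (hG₂.pow_const _), ← mul_assoc (ν _),
            mul_comm (ν (Metric.closedBall 0 ρ)) (2 ^ Module.finrank ℝ V), ← hν2]
          generalize ν (Metric.closedBall 0 (2 * ρ)) = W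
          generalize ∫⁻ u, G₁ u ^ (2 * q) ∂σ = a
          generalize ∫⁻ u, G₂ u ^ (2 * q) ∂σ = b
          have h : W ^ (1 / 2 : ℝ) * W ^ (1 / 2 : ℝ) = W := by
            rw [← ENNReal.rpow_add_of_nonneg _ _ (by norm_num) (by norm_num)]
            norm_num
          rw [ENNReal.mul_rpow_of_nonneg _ _ (by norm_num : (0 : ℝ) ≤ 1 / 2),
            ENNReal.mul_rpow_of_nonneg _ _ (by norm_num : (0 : ℝ) ≤ 1 / 2)]
          calc _ = (W ^ (1 / 2 : ℝ) * W ^ (1 / 2 : ℝ)) *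
                (M ^ q * (a ^ (1 / 2 : ℝ) * b ^ (1 / 2 : ℝ))) := by ring
            _ = _ := by rw [h]
  exact (ENNReal.mul_le_mul_iff_right hνpos hνtop).1 key

end BilinearKernel

end

noncomputable section

/-! ### Summation over dyadic scales -/

namespace BilinearKernel

/-- The size of the k-th piece, kernel weight times ball measure, as a geometric sequence of ratio
2^(-(d - s)), which is less than 1 when s < d. -/
theorem dyadic_weight_eq {Δ L s : ℝ} (hΔ : 0 < Δ) (d k : ℕ) :
    (Δ * (1 / 2) ^ (k + 1)) ^ (-s) * (2 * (2 * L * (Δ * (1 / 2) ^ k))) ^ d =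
      L ^ d * ((4 ^ d * (1 / 2 : ℝ) ^ (-s) * Δ ^ ((d : ℝ) - s)) *
        ((1 / 2 : ℝ) ^ ((d : ℝ) - s)) ^ k) := by
  have h1 : (Δ * (1 / 2) ^ (k + 1)) ^ (-s) = Δ ^ (-s) * ((1 / 2 : ℝ) ^ (-s)) ^ (k + 1) := by
    rw [Real.mul_rpow hΔ.le (by positivity), ← Real.rpow_natCast, ← Real.rpow_mul (by norm_num),
      ← Real.rpow_natCast, ← Real.rpow_mul (by norm_num), mul_comm (-s)]
  rw [h1, sub_eq_add_neg, Real.rpow_add hΔ, Real.rpow_add (by norm_num : (0 : ℝ) < 1 / 2),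
    Real.rpow_natCast, Real.rpow_natCast]
  generalize Δ ^ (-s) = A
  generalize (1 / 2 : ℝ) ^ (-s) = B
  rw [show (4 : ℝ) = 2 * 2 by norm_num]
  ring

variable {V : Type*} [NormedAddCommGroup V] [NormedSpace ℝ V] [FiniteDimensional ℝ V]
  [MeasurableSpace V] [BorelSpace V]

variable (V) in
/-- The `L^{2q} × L^{2q} → L^q` bound for the fractional integral operators along a map `R` whose
Jacobian factor dominates `J`, on a set of dimension `d > s` and diameter `Δ`. -/
theorem exists_fractional_bound (d : ℕ) {s q Δ : ℝ} (hs : 0 ≤ s) (hsd : s < d)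
    (hq : q ∈ Set.Icc (1 / 2 : ℝ) 1) (hΔ : 0 < Δ) {C₀ : ℝ≥0∞} (hC₀ : C₀ ≠ ⊤) :
    ∃ C : ℝ≥0∞, C ≠ ⊤ ∧ ∀ (σ : Measure V) [SFinite σ] (R : V × V → V) (J : V × V → ℝ≥0∞) (L : ℝ),
      1 ≤ L → Measurable R → Measurable J → IsSubJacobian σ R J →
      (∀ z r, 0 ≤ r → σ (Metric.closedBall z r) ≤ C₀ * ENNReal.ofReal (r ^ d)) →
      (∀ p, J p ≠ 0 → 0 < ‖p.2 - R p‖ ∧ ‖p.2 - R p‖ ≤ Δ ∧ ‖p.1 - p.2‖ ≤ L * ‖p.2 - R p‖) →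
      ∀ G₁ G₂ : V → ℝ≥0∞, Measurable G₁ → Measurable G₂ →
        ∫⁻ u, op σ R (fun p => J p * ENNReal.ofReal (‖p.2 - R p‖ ^ (-s))) G₁ G₂ u ^ q ∂σ ≤
          ENNReal.ofReal (L ^ d) ^ q * (C * ((∫⁻ u, G₁ u ^ (2 * q) ∂σ) ^ (1 / 2 : ℝ) *
            (∫⁻ u, G₂ u ^ (2 * q) ∂σ) ^ (1 / 2 : ℝ))) := by
  have hq0 : 0 < q := by linarith [hq.1]
  set θ : ℝ := (1 / 2 : ℝ) ^ ((d : ℝ) - s) with hθ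
  have hθ0 : 0 < θ := by positivity
  have hθ1 : θ < 1 := Real.rpow_lt_one (by norm_num) (by norm_num) (by linarith)
  set κ : ℝ := 4 ^ d * (1 / 2 : ℝ) ^ (-s) * Δ ^ ((d : ℝ) - s) with hκ
  have hκ0 : 0 < κ := by positivity
  refine ⟨(C₀ * ENNReal.ofReal κ) ^ q * 2 ^ Module.finrank ℝ V *
    (1 - ENNReal.ofReal θ ^ q)⁻¹, ?_, ?_⟩
  · refine ENNReal.mul_ne_top (ENNReal.mul_ne_top (ENNReal.rpow_ne_top_of_nonneg hq0.le
      (ENNReal.mul_ne_top hC₀ ENNReal.ofReal_ne_top)) (by finiteness)) (ENNReal.inv_ne_top.2 ?_)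
    refine (tsub_pos_of_lt (ENNReal.rpow_lt_one ?_ hq0)).ne'
    rwa [ENNReal.ofReal_lt_one]
  intro σ _ R J L hL hR hJ hRJ hσ hloc G₁ G₂ hG₁ hG₂
  set X := (∫⁻ u, G₁ u ^ (2 * q) ∂σ) ^ (1 / 2 : ℝ) * (∫⁻ u, G₂ u ^ (2 * q) ∂σ) ^ (1 / 2 : ℝ)
  let a : ℕ → ℝ := fun k => Δ * (1 / 2) ^ k
  have ha : ∀ k, 0 < a k := fun k => by positivity
  let A : ℕ → Set (V × V) := fun k => {p | a (k + 1) < ‖p.2 - R p‖ ∧ ‖p.2 - R p‖ ≤ a k}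
  have hnorm : Measurable fun p : V × V => ‖p.2 - R p‖ := (measurable_snd.sub hR).norm
  have hA : ∀ k, MeasurableSet (A k) := fun k =>
    (measurableSet_lt measurable_const hnorm).inter (measurableSet_le hnorm measurable_const)
  let Jk : ℕ → V × V → ℝ≥0∞ := fun k => (A k).indicator J
  have hJk : ∀ k, Measurable (Jk k) := fun k => hJ.indicator (hA k)
  let c : ℕ → ℝ≥0∞ := fun k => ENNReal.ofReal (a (k + 1) ^ (-s))
  -- Each point with J p ≠ 0 lies in some dyadic shell, where the weight is at most its value at the
  -- inner radius a (k + 1).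
  have hpt : ∀ p, J p * ENNReal.ofReal (‖p.2 - R p‖ ^ (-s)) ≤ ∑' k, c k * Jk k p := by
    intro p
    by_cases hJ0 : J p = 0
    · simp [hJ0]
    obtain ⟨h1, h2, -⟩ := hloc p hJ0
    obtain ⟨k, hk1, hk2⟩ := exists_nat_pow_near_of_lt_one (x := ‖p.2 - R p‖ / Δ)
      (y := (1 / 2 : ℝ)) (by positivity) ((div_le_one hΔ).2 h2) (by norm_num) (by norm_num)
    rw [lt_div_iff₀ hΔ, mul_comm] at hk1
    rw [div_le_iff₀ hΔ, mul_comm] at hk2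
    have hpA : p ∈ A k := ⟨hk1, hk2⟩
    refine le_trans ?_ (ENNReal.le_tsum k)
    simp only [Jk, Set.indicator_of_mem hpA, c]
    rw [mul_comm]
    exact mul_le_mul' (ENNReal.ofReal_le_ofReal
      (Real.rpow_le_rpow_of_nonpos (ha (k + 1)) hk1.le (neg_nonpos.2 hs))) le_rfl
  have hop : ∀ u, op σ R (fun p => J p * ENNReal.ofReal (‖p.2 - R p‖ ^ (-s))) G₁ G₂ u ≤
      ∑' k, c k * op σ R (Jk k) G₁ G₂ u := by
    intro u
    have hm : ∀ k, Measurable fun v => G₁ v * (G₂ (R (u, v)) * Jk k (u, v)) := fun k =>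
      hG₁.mul ((hG₂.comp (hR.comp measurable_prodMk_left)).mul
        ((hJk k).comp measurable_prodMk_left))
    calc _ ≤ ∫⁻ v, ∑' k, c k * (G₁ v * (G₂ (R (u, v)) * Jk k (u, v))) ∂σ := by
          refine lintegral_mono fun v => ?_
          have : ∀ k, c k * (G₁ v * (G₂ (R (u, v)) * Jk k (u, v))) =
              G₁ v * (G₂ (R (u, v)) * (c k * Jk k (u, v))) := fun k => by ring
          simp only [this, ENNReal.tsum_mul_left]
          gcongr
          exact hpt (u, v)
      _ = ∑' k, ∫⁻ v, c k * (G₁ v * (G₂ (R (u, v)) * Jk k (u, v))) ∂σ :=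
          lintegral_tsum fun k => ((hm k).const_mul _).aemeasurable
      _ = _ := by
          congr 1; ext k
          rw [lintegral_const_mul _ (hm k)]
          rfl
  have hmop : ∀ k, Measurable (op σ R (Jk k) G₁ G₂) := fun k => measurable_op hR (hJk k) hG₁ hG₂
  have hpiece : ∀ k, ∫⁻ u, op σ R (Jk k) G₁ G₂ u ^ q ∂σ ≤ 2 ^ Module.finrank ℝ V *
      ((C₀ * ENNReal.ofReal ((2 * (2 * L * a k)) ^ d)) ^ q * X) := by
    intro k
    have hak := ha k
    have hLa : 0 < L * a k := by positivity
    -- On the shell |u - v| ≤ L a_k and |v - R| ≤ a_k, so |u - R| ≤ (L + 1) a_k ≤ 2 L a_k because L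
    -- ≥ 1.
    refine lintegral_op_rpow_le hR (hJk k) hG₁ hG₂ ?_ (ρ := 2 * L * a k) (by positivity) ?_ hq ?_
    · intro v f hf
      refine (lintegral_mono fun u => ?_).trans (hRJ v f hf)
      gcongr
      exact Set.indicator_le_self _ _ _
    · intro p hp
      have hpA : p ∈ A k := Set.mem_of_indicator_ne_zero hp
      have hJp : J p ≠ 0 := by
        simp only [Jk, Set.indicator_of_mem hpA] at hp; exact hp
      obtain ⟨h1, h2, h3⟩ := hloc p hJp
      have h4 : ‖p.1 - p.2‖ ≤ L * a k := h3.trans (by gcongr; exact hpA.2)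
      have h5 : a k ≤ L * a k := le_mul_of_one_le_left hak.le hL
      have h6 : ‖p.1 - R p‖ ≤ ‖p.1 - p.2‖ + ‖p.2 - R p‖ := norm_sub_le_norm_sub_add_norm_sub _ _ _
      have h7 := hpA.2
      constructor <;> linarith
    · intro z
      exact hσ z _ (by positivity)
  have hterm : ∀ k, c k ^ q * (2 ^ Module.finrank ℝ V *
      ((C₀ * ENNReal.ofReal ((2 * (2 * L * a k)) ^ d)) ^ q * X)) =
      (ENNReal.ofReal (L ^ d) ^ q * ((C₀ * ENNReal.ofReal κ) ^ q * 2 ^ Module.finrank ℝ V) * X) *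
        (ENNReal.ofReal θ ^ q) ^ k := by
    intro k
    have h1 := dyadic_weight_eq (L := L) (s := s) hΔ d k
    have h2 : c k * ENNReal.ofReal ((2 * (2 * L * a k)) ^ d) =
        ENNReal.ofReal (L ^ d) * (ENNReal.ofReal κ * ENNReal.ofReal θ ^ k) := by
      rw [← ENNReal.ofReal_pow hθ0.le, ← ENNReal.ofReal_mul hκ0.le,
        ← ENNReal.ofReal_mul (by positivity), ← ENNReal.ofReal_mul (by positivity), h1]
    have h3 : c k ^ q * (C₀ * ENNReal.ofReal ((2 * (2 * L * a k)) ^ d)) ^ q =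
        ENNReal.ofReal (L ^ d) ^ q * (C₀ * ENNReal.ofReal κ) ^ q * (ENNReal.ofReal θ ^ q) ^ k := by
      rw [← ENNReal.rpow_natCast (ENNReal.ofReal θ ^ q), ← ENNReal.rpow_mul, mul_comm q,
        ENNReal.rpow_mul, ENNReal.rpow_natCast, ← ENNReal.mul_rpow_of_nonneg _ _ hq0.le,
        ← ENNReal.mul_rpow_of_nonneg _ _ hq0.le, ← ENNReal.mul_rpow_of_nonneg _ _ hq0.le,
        mul_left_comm, h2]
      congr 1; ring
    calc _ = (c k ^ q * (C₀ * ENNReal.ofReal ((2 * (2 * L * a k)) ^ d)) ^ q) *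
          (2 ^ Module.finrank ℝ V * X) := by ring
      _ = _ := by rw [h3]; ring
  calc ∫⁻ u, op σ R (fun p => J p * ENNReal.ofReal (‖p.2 - R p‖ ^ (-s))) G₁ G₂ u ^ q ∂σ
      ≤ ∫⁻ u, ∑' k, (c k * op σ R (Jk k) G₁ G₂ u) ^ q ∂σ :=
        lintegral_mono fun u => (ENNReal.rpow_le_rpow (hop u) hq0.le).trans
          (ennreal_tsum_rpow_le hq0.le hq.2 _)
    _ = ∑' k, ∫⁻ u, c k ^ q * op σ R (Jk k) G₁ G₂ u ^ q ∂σ := by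
        simp only [ENNReal.mul_rpow_of_nonneg _ _ hq0.le]
        exact lintegral_tsum fun k => (((hmop k).pow_const q).const_mul _).aemeasurable
    _ = ∑' k, c k ^ q * ∫⁻ u, op σ R (Jk k) G₁ G₂ u ^ q ∂σ := by
        congr 1; ext k
        rw [lintegral_const_mul _ ((hmop k).pow_const q)]
    _ ≤ ∑' k, c k ^ q * (2 ^ Module.finrank ℝ V *
          ((C₀ * ENNReal.ofReal ((2 * (2 * L * a k)) ^ d)) ^ q * X)) := by
        gcongr with k
        exact hpiece k
    _ = _ := by
        simp only [hterm]
        rw [ENNReal.tsum_mul_left, ENNReal.tsum_geometric]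
        ring

end BilinearKernel

end

noncomputable section

/-! ### The fractional integral as an integral operator with a measurable kernel -/

namespace GraphHypersurface

variable {n : ℕ} {S : GraphHypersurface n}

local notation "𝕍" => EuclideanSpace ℝ (Fin n)

theorem surfaceMeasure_singleton (hn : 2 ≤ n) (hS : S.IsAdmissible) {lam Lam : ℝ}
    (hb : S.CurvatureBounds lam Lam) (u : 𝕍) : S.surfaceMeasure {u} = 0 := by
  have h := surfaceMeasure_closedBall_le hS hb u le_rfl
  rw [zero_pow (by omega), ENNReal.ofReal_zero, mul_zero, Metric.closedBall_zero] at h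
  exact le_antisymm h zero_le

theorem reflectionDomain_eq_insert {u : 𝕍} (hu : u ∈ S.carrier) :
    S.reflectionDomain u = insert u (Prod.mk u ⁻¹' S.reflectionPairs) := by
  ext v
  simp only [Set.mem_insert_iff, Set.mem_preimage, reflectionPairs, Set.mem_ofPred_eq]
  constructor
  · intro h
    by_cases hv : v = u
    · exact Or.inl hv
    · exact Or.inr ⟨hu, h, Ne.symm hv⟩
  · rintro (rfl | h)
    · exact ⟨hu, Or.inl rfl⟩
    · exact h.2.1

theorem reflectionDomain_ae_eq (hn : 2 ≤ n) (hS : S.IsAdmissible) {lam Lam : ℝ}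
    (hb : S.CurvatureBounds lam Lam) {u : 𝕍} (hu : u ∈ S.carrier) :
    S.reflectionDomain u =ᵐ[S.surfaceMeasure] (Prod.mk u ⁻¹' S.reflectionPairs : Set 𝕍) := by
  rw [reflectionDomain_eq_insert hu]
  rw [Set.insert_eq]
  exact union_ae_eq_right_of_ae_eq_empty (ae_eq_empty.2 (surfaceMeasure_singleton hn hS hb u))

variable (S) in
/-- The integrand of the fractional integral, set to zero where `R_u u'` does not exist. -/
def fractionalKernel (s : ℝ) (g₁ g₂ : 𝕍 → ℂ) (p : 𝕍 × 𝕍) : ℂ :=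
  g₁ p.2 * g₂ (S.reflectionExt p) / ((‖p.2 - S.reflectionExt p‖ ^ s : ℝ) : ℂ) *
    ((S.jacobianExt p : ℝ) : ℂ)

theorem measurable_fractionalKernel (hS : S.IsAdmissible) {lam Lam : ℝ}
    (hb : S.CurvatureBounds lam Lam) (s : ℝ) {g₁ g₂ : 𝕍 → ℂ} (h₁ : Measurable g₁)
    (h₂ : Measurable g₂) : Measurable (S.fractionalKernel s g₁ g₂) := by
  have hR := measurable_reflectionExt hS hb
  have hJ := measurable_jacobianExt hS hb
  exact (((h₁.comp measurable_snd).mul (h₂.comp hR)).div (Complex.measurable_ofReal.comp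
    ((measurable_snd.sub hR).norm.pow_const s))).mul (Complex.measurable_ofReal.comp hJ)

theorem enorm_fractionalKernel (s : ℝ) (g₁ g₂ : 𝕍 → ℂ) (p : 𝕍 × 𝕍) :
    ‖S.fractionalKernel s g₁ g₂ p‖ₑ = ‖g₁ p.2‖ₑ * (‖g₂ (S.reflectionExt p)‖ₑ *
      (ENNReal.ofReal (S.jacobianExt p) *
        ENNReal.ofReal (‖p.2 - S.reflectionExt p‖ ^ (-s)))) := by
  have h : ‖S.fractionalKernel s g₁ g₂ p‖ = ‖g₁ p.2‖ * (‖g₂ (S.reflectionExt p)‖ *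
      (S.jacobianExt p * ‖p.2 - S.reflectionExt p‖ ^ (-s))) := by
    rw [fractionalKernel, norm_mul, norm_div, norm_mul, Complex.norm_real, Complex.norm_real,
      Real.norm_of_nonneg (jacobianExt_nonneg p),
      Real.norm_of_nonneg (Real.rpow_nonneg (norm_nonneg _) _), Real.rpow_neg (norm_nonneg _)]
    ring
  rw [← ofReal_norm, h, ENNReal.ofReal_mul (norm_nonneg _),
    ENNReal.ofReal_mul (norm_nonneg _), ENNReal.ofReal_mul (jacobianExt_nonneg p),
    ofReal_norm, ofReal_norm]

theorem isSubJacobian_jacobianExt (hS : S.IsAdmissible) {lam Lam : ℝ}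
    (hb : S.CurvatureBounds lam Lam) : BilinearKernel.IsSubJacobian S.surfaceMeasure
      S.reflectionExt fun p => ENNReal.ofReal (S.jacobianExt p) :=
  fun v _ hf => lintegral_reflection_le hS hb v hf

/-- The exceptional set of an almost everywhere equality is not seen by almost every `R_u`. -/
theorem ae_ae_reflectionExt (hS : S.IsAdmissible) {lam Lam : ℝ}
    (hb : S.CurvatureBounds lam Lam) {P : 𝕍 → Prop} (hP : ∀ᵐ x ∂S.surfaceMeasure, P x) :
    ∀ᵐ u ∂S.surfaceMeasure, ∀ᵐ v ∂S.surfaceMeasure,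
      S.jacobianExt (u, v) = 0 ∨ P (S.reflectionExt (u, v)) := by
  have := isFiniteMeasure_surfaceMeasure hS hb
  have hR := measurable_reflectionExt hS hb
  have hJ := (measurable_jacobianExt hS hb).ennreal_ofReal
  set N := toMeasurable S.surfaceMeasure {x | ¬ P x}
  have hN : S.surfaceMeasure N = 0 := (measure_toMeasurable _).trans hP
  have hNm : MeasurableSet N := measurableSet_toMeasurable _ _
  have hi : Measurable (N.indicator (1 : 𝕍 → ℝ≥0∞)) := measurable_one.indicator hNm
  have hm : Measurable fun p : 𝕍 × 𝕍 =>
      N.indicator (1 : 𝕍 → ℝ≥0∞) (S.reflectionExt p) * ENNReal.ofReal (S.jacobianExt p) :=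
    (hi.comp hR).mul hJ
  have h0 : ∫⁻ u, ∫⁻ v, N.indicator (1 : 𝕍 → ℝ≥0∞) (S.reflectionExt (u, v)) *
      ENNReal.ofReal (S.jacobianExt (u, v)) ∂S.surfaceMeasure ∂S.surfaceMeasure = 0 := by
    -- With u' fixed, the change of variables bounds the integral in u by σ(N) = 0; this is why the
    -- order of integration is exchanged.
    rw [lintegral_lintegral_swap (f := fun u v => N.indicator (1 : 𝕍 → ℝ≥0∞)
      (S.reflectionExt (u, v)) * ENNReal.ofReal (S.jacobianExt (u, v))) hm.aemeasurable]
    refine (lintegral_congr fun v => ?_).trans lintegral_zero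
    refine le_antisymm ((lintegral_reflection_le hS hb v hi).trans ?_) zero_le
    rw [lintegral_indicator_one hNm, hN]
  rw [lintegral_eq_zero_iff hm.lintegral_prod_right'] at h0
  filter_upwards [h0] with u hu
  have hu' := (lintegral_eq_zero_iff (hm.comp measurable_prodMk_left)).1 hu
  filter_upwards [hu'] with v hv
  by_cases h : S.reflectionExt (u, v) ∈ N
  · left
    simp only [Function.comp_apply, Set.indicator_of_mem h, Pi.one_apply, one_mul, Pi.zero_apply,
      ENNReal.ofReal_eq_zero] at hv
    exact le_antisymm hv (jacobianExt_nonneg _)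
  · right
    by_contra h'
    exact h (subset_toMeasurable _ _ h')

/-- Allows g₁ and g₂ to be replaced by measurable representatives: where R_u u' hits the exceptional
set of g₂, almost surely J = 0 and both sides vanish. -/
theorem ae_fractionalIntegrand_eq (hS : S.IsAdmissible) {lam Lam : ℝ}
    (hb : S.CurvatureBounds lam Lam) (s : ℝ) {g₁ g₂ k₁ k₂ : 𝕍 → ℂ}
    (h₁ : g₁ =ᵐ[S.surfaceMeasure] k₁) (h₂ : g₂ =ᵐ[S.surfaceMeasure] k₂) :
    ∀ᵐ u ∂S.surfaceMeasure, ∀ᵐ v ∂S.surfaceMeasure, v ∈ Prod.mk u ⁻¹' S.reflectionPairs →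
      S.fractionalIntegrand s g₁ g₂ u v = S.fractionalKernel s k₁ k₂ (u, v) := by
  filter_upwards [ae_ae_reflectionExt hS hb h₂] with u hu
  filter_upwards [hu, h₁] with v hv h₁v hp
  rw [fractionalIntegrand, fractionalKernel, ← jacobianExt_of_mem (p := (u, v)) hp,
    ← reflectionExt_of_mem (p := (u, v)) hp, h₁v]
  rcases hv with hv | hv
  · rw [hv]; simp
  · rw [hv]

/-- The domain of R_u differs from the section of `reflectionPairs` only by the point u, which is
null since n ≥ 2, and the kernel vanishes off that section. -/
theorem integrableOn_fractionalIntegrand_iff (hn : 2 ≤ n) (hS : S.IsAdmissible) {lam Lam : ℝ}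
    (hb : S.CurvatureBounds lam Lam) (s : ℝ) {g₁ g₂ k₁ k₂ : 𝕍 → ℂ}
    (h₁ : g₁ =ᵐ[S.surfaceMeasure] k₁) (h₂ : g₂ =ᵐ[S.surfaceMeasure] k₂) :
    ∀ᵐ u ∂S.surfaceMeasure,
      (IntegrableOn (S.fractionalIntegrand s g₁ g₂ u) (S.reflectionDomain u) S.surfaceMeasure ↔
        Integrable (fun v => S.fractionalKernel s k₁ k₂ (u, v)) S.surfaceMeasure) ∧
      S.fractionalIntegral s g₁ g₂ u =
        ∫ v, S.fractionalKernel s k₁ k₂ (u, v) ∂S.surfaceMeasure := by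
  filter_upwards [ae_fractionalIntegrand_eq hS hb s h₁ h₂, S.ae_mem_carrier] with u hu huc
  have hm : MeasurableSet (Prod.mk u ⁻¹' S.reflectionPairs : Set 𝕍) :=
    measurable_prodMk_left (measurableSet_reflectionPairs hS hb)
  have h0 : ∀ v ∉ (Prod.mk u ⁻¹' S.reflectionPairs : Set 𝕍),
      S.fractionalKernel s k₁ k₂ (u, v) = 0 := fun v hv => by
    rw [fractionalKernel, jacobianExt_of_notMem hv]; simp
  have hr := Measure.restrict_congr_set (reflectionDomain_ae_eq hn hS hb huc)
  refine ⟨?_, ?_⟩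
  · rw [IntegrableOn, hr, integrable_congr ((ae_restrict_iff' hm).2 hu)]
    exact integrableOn_iff_integrable_of_support_subset fun v hv => by
      by_contra h; exact hv (h0 v h)
  · rw [fractionalIntegral, hr, setIntegral_congr_ae hm hu]
    exact setIntegral_eq_integral_of_forall_compl_eq_zero h0

end GraphHypersurface

end

/-! ### Conclusion: from the kernel estimate to the theorem -/

theorem eLpNorm_ofReal_eq_lintegral {α E : Type*} [MeasurableSpace α] [NormedAddCommGroup E]
    {μ : Measure α} (f : α → E) {p : ℝ} (hp : 0 < p) :
    eLpNorm f (ENNReal.ofReal p) μ = (∫⁻ x, ‖f x‖ₑ ^ p ∂μ) ^ (1 / p) := by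
  rw [eLpNorm_eq_lintegral_rpow_enorm_toReal (by simpa using hp) ENNReal.ofReal_ne_top,
    ENNReal.toReal_ofReal hp.le]

theorem GraphHypersurface.one_le_curvatureQuotient {n : ℕ} {S : GraphHypersurface n} {lam Lam : ℝ}
    (hb : S.CurvatureBounds lam Lam) (h : Lam ≤ S.curvatureQuotient * lam) :
    1 ≤ S.curvatureQuotient := by
  have h1 := hb.le.trans h
  have h2 := hb.pos
  nlinarith

theorem GraphHypersurface.reflectionExt_bounds {n : ℕ} {S : GraphHypersurface n}
    (hS : S.IsAdmissible) {lam Lam : ℝ} (hb : S.CurvatureBounds lam Lam)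
    (h : Lam ≤ S.curvatureQuotient * lam) {p : EuclideanSpace ℝ (Fin n) × EuclideanSpace ℝ (Fin n)}
    (hp : S.jacobianExt p ≠ 0) : 0 < ‖p.2 - S.reflectionExt p‖ ∧
      ‖p.2 - S.reflectionExt p‖ ≤ Metric.diam S.carrier ∧
      ‖p.1 - p.2‖ ≤ 4 * S.curvatureQuotient * ‖p.2 - S.reflectionExt p‖ := by
  have hmem : p ∈ S.reflectionPairs := by
    by_contra h'
    exact hp (jacobianExt_of_notMem h')
  obtain ⟨h1, h2, h3⟩ := reflectionPairs_bounds hS hb hmem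
  refine ⟨h1, h2, le_of_mul_le_mul_left (h3.trans ?_) hb.pos⟩
  nlinarith [mul_le_mul_of_nonneg_right h h1.le]

theorem theorem7p2 (n : ℕ) (s q : ℝ) (hs : 0 < s) (hsn : s < (n : ℝ) - 1)
    (hq : q ∈ Set.Icc (1 / 2 : ℝ) 1) (δ : ℝ) :
    ∃ C : ℝ≥0, ∀ S : GraphHypersurface n, S.IsAdmissible → Metric.diam S.carrier = δ →
      ∀ g₁ g₂ : EuclideanSpace ℝ (Fin n) → ℂ,
        MemLp g₁ (ENNReal.ofReal (2 * q)) S.surfaceMeasure →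
        MemLp g₂ (ENNReal.ofReal (2 * q)) S.surfaceMeasure →
        (∀ᵐ u ∂S.surfaceMeasure,
          IntegrableOn (S.fractionalIntegrand s g₁ g₂ u) (S.reflectionDomain u)
            S.surfaceMeasure) ∧
        AEStronglyMeasurable (S.fractionalIntegral s g₁ g₂) S.surfaceMeasure ∧
        eLpNorm (S.fractionalIntegral s g₁ g₂) (ENNReal.ofReal q) S.surfaceMeasure ≤
          C * ENNReal.ofReal (S.curvatureQuotient ^ (2 * (n - 1))) *
            eLpNorm g₁ (ENNReal.ofReal (2 * q)) S.surfaceMeasure *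
            eLpNorm g₂ (ENNReal.ofReal (2 * q)) S.surfaceMeasure := by
  have hq0 : 0 < q := by linarith [hq.1]
  have hn : 2 ≤ n := by
    have : (1 : ℝ) < n := by linarith
    exact_mod_cast this
  have hd : ((n - 1 : ℕ) : ℝ) = n - 1 := by push_cast [Nat.cast_sub (by omega : 1 ≤ n)]; ring
  -- Any positive Δ not smaller than the diameter serves; |δ| + 1 is positive even when δ = 0. C₀ is
  -- the volume growth constant, which depends on n alone.
  obtain ⟨C, hC, hbound⟩ := BilinearKernel.exists_fractional_bound (EuclideanSpace ℝ (Fin n))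
    (n - 1) hs.le (by rw [hd]; exact hsn) hq (Δ := |δ| + 1) (by positivity)
    (C₀ := 2 ^ (n - 1) * volume (Metric.ball (0 : EuclideanSpace ℝ (Fin (n - 1))) 1))
    (ENNReal.mul_ne_top (by finiteness) measure_ball_lt_top.ne)
  have hC' : (4 : ℝ≥0∞) ^ (n - 1) * C ^ (1 / q) ≠ ⊤ :=
    ENNReal.mul_ne_top (by finiteness) (ENNReal.rpow_ne_top_of_nonneg (by positivity) hC)
  refine ⟨((4 : ℝ≥0∞) ^ (n - 1) * C ^ (1 / q)).toNNReal, fun S hS hδ g₁ g₂ h₁ h₂ => ?_⟩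
  rw [ENNReal.coe_toNNReal hC']
  rcases S.D.eq_empty_or_nonempty with hD | hD
  · have h0 : S.surfaceMeasure = 0 := by simp [GraphHypersurface.surfaceMeasure, hD]
    simp [h0]
  obtain ⟨lam, Lam, hb, hLam⟩ := GraphHypersurface.exists_curvatureBounds hn hS hD
  have hQ := GraphHypersurface.one_le_curvatureQuotient hb hLam
  have := GraphHypersurface.isFiniteMeasure_surfaceMeasure hS hb
  set σ := S.surfaceMeasure
  set Q := S.curvatureQuotient
  have hR := GraphHypersurface.measurable_reflectionExt hS hb
  have hJ := (GraphHypersurface.measurable_jacobianExt hS hb).ennreal_ofReal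
  -- Measurable representatives, needed since the kernel estimate is for measurable functions.
  set k₁ := h₁.1.mk g₁
  set k₂ := h₂.1.mk g₂
  have hk₁ : g₁ =ᵐ[σ] k₁ := h₁.1.ae_eq_mk
  have hk₂ : g₂ =ᵐ[σ] k₂ := h₂.1.ae_eq_mk
  have hm₁ : Measurable k₁ := h₁.1.stronglyMeasurable_mk.measurable
  have hm₂ : Measurable k₂ := h₂.1.stronglyMeasurable_mk.measurable
  have hK := GraphHypersurface.measurable_fractionalKernel hS hb s hm₁ hm₂
  set K := S.fractionalKernel s k₁ k₂
  set A₁ := ∫⁻ u, ‖k₁ u‖ₑ ^ (2 * q) ∂σ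
  set A₂ := ∫⁻ u, ‖k₂ u‖ₑ ^ (2 * q) ∂σ
  have he₁ : eLpNorm g₁ (ENNReal.ofReal (2 * q)) σ = A₁ ^ (1 / (2 * q)) := by
    rw [eLpNorm_congr_ae hk₁, eLpNorm_ofReal_eq_lintegral _ (by positivity)]
  have he₂ : eLpNorm g₂ (ENNReal.ofReal (2 * q)) σ = A₂ ^ (1 / (2 * q)) := by
    rw [eLpNorm_congr_ae hk₂, eLpNorm_ofReal_eq_lintegral _ (by positivity)]
  have hmain : (∫⁻ u, (∫⁻ v, ‖K (u, v)‖ₑ ∂σ) ^ q ∂σ) ^ (1 / q) ≤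
      4 ^ (n - 1) * C ^ (1 / q) * ENNReal.ofReal (Q ^ (2 * (n - 1))) *
        eLpNorm g₁ (ENNReal.ofReal (2 * q)) σ * eLpNorm g₂ (ENNReal.ofReal (2 * q)) σ := by
    have h := hbound σ S.reflectionExt (fun p => ENNReal.ofReal (S.jacobianExt p)) (4 * Q)
      (by linarith) hR hJ (GraphHypersurface.isSubJacobian_jacobianExt hS hb)
      (fun z r hr => GraphHypersurface.surfaceMeasure_closedBall_le hS hb z hr)
      (fun p hp => by
        obtain ⟨h1, h2, h3⟩ := GraphHypersurface.reflectionExt_bounds hS hb hLam (p := p)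
          fun h => hp (by rw [h, ENNReal.ofReal_zero])
        exact ⟨h1, by linarith [le_abs_self δ], h3⟩)
      (fun u => ‖k₁ u‖ₑ) (fun u => ‖k₂ u‖ₑ) hm₁.enorm hm₂.enorm
    have h' : ∫⁻ u, (∫⁻ v, ‖K (u, v)‖ₑ ∂σ) ^ q ∂σ ≤ ENNReal.ofReal ((4 * Q) ^ (n - 1)) ^ q *
        (C * (A₁ ^ (1 / 2 : ℝ) * A₂ ^ (1 / 2 : ℝ))) := by
      refine le_trans (le_of_eq (lintegral_congr fun u => ?_)) h
      congr 1
      exact lintegral_congr fun v => GraphHypersurface.enorm_fractionalKernel s k₁ k₂ (u, v)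
    have hr : (1 / 2 : ℝ) * (1 / q) = 1 / (2 * q) := by field_simp
    -- The estimate is applied with L = 4 Q, and Q ≥ 1 allows the exponent n - 1 to be doubled.
    have hpow : ENNReal.ofReal ((4 * Q) ^ (n - 1)) ≤
        4 ^ (n - 1) * ENNReal.ofReal (Q ^ (2 * (n - 1))) := by
      rw [mul_pow, ENNReal.ofReal_mul (by positivity), ENNReal.ofReal_pow (by norm_num)]
      refine mul_le_mul' (by norm_num) (ENNReal.ofReal_le_ofReal ?_)
      exact pow_le_pow_right₀ hQ (by omega)
    calc _ ≤ (ENNReal.ofReal ((4 * Q) ^ (n - 1)) ^ q *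
          (C * (A₁ ^ (1 / 2 : ℝ) * A₂ ^ (1 / 2 : ℝ)))) ^ (1 / q) :=
          ENNReal.rpow_le_rpow h' (by positivity)
      _ = ENNReal.ofReal ((4 * Q) ^ (n - 1)) *
          (C ^ (1 / q) * (A₁ ^ (1 / (2 * q)) * A₂ ^ (1 / (2 * q)))) := by
          rw [ENNReal.mul_rpow_of_nonneg _ _ (by positivity),
            ENNReal.mul_rpow_of_nonneg _ _ (by positivity),
            ENNReal.mul_rpow_of_nonneg _ _ (by positivity), ← ENNReal.rpow_mul,
            ← ENNReal.rpow_mul, ← ENNReal.rpow_mul, hr, mul_one_div_cancel hq0.ne',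
            ENNReal.rpow_one]
      _ ≤ 4 ^ (n - 1) * ENNReal.ofReal (Q ^ (2 * (n - 1))) *
          (C ^ (1 / q) * (A₁ ^ (1 / (2 * q)) * A₂ ^ (1 / (2 * q)))) := mul_le_mul' hpow le_rfl
      _ = _ := by rw [he₁, he₂]; ring
  -- Absolute convergence comes from the same bound: its right side is finite, so the integral of
  -- |K(u, ·)| is finite for almost every u.
  have hint : ∀ᵐ u ∂σ, Integrable (fun v => K (u, v)) σ := by
    have htop : ∫⁻ u, (∫⁻ v, ‖K (u, v)‖ₑ ∂σ) ^ q ∂σ ≠ ⊤ := by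
      intro htop
      rw [htop, ENNReal.top_rpow_of_pos (by positivity), top_le_iff] at hmain
      exact ENNReal.mul_ne_top (ENNReal.mul_ne_top (ENNReal.mul_ne_top hC'
        ENNReal.ofReal_ne_top) h₁.2.ne) h₂.2.ne hmain
    filter_upwards [ae_lt_top (hK.enorm.lintegral_prod_right'.pow_const q) htop] with u hu
    exact ⟨(hK.comp measurable_prodMk_left).aestronglyMeasurable,
      (ENNReal.rpow_lt_top_iff_of_pos hq0).1 hu⟩
  have hae := GraphHypersurface.integrableOn_fractionalIntegrand_iff hn hS hb s hk₁ hk₂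
  have heq : S.fractionalIntegral s g₁ g₂ =ᵐ[σ] fun u => ∫ v, K (u, v) ∂σ :=
    hae.mono fun u hu => hu.2
  refine ⟨?_, ?_, ?_⟩
  · filter_upwards [hae, hint] with u hu hi
    exact hu.1.2 hi
  · exact hK.stronglyMeasurable.integral_prod_right'.aestronglyMeasurable.congr heq.symm
  · rw [eLpNorm_congr_ae heq, eLpNorm_ofReal_eq_lintegral _ hq0]
    refine le_trans (ENNReal.rpow_le_rpow (lintegral_mono fun u => ?_) (by positivity)) hmain
    exact ENNReal.rpow_le_rpow (enorm_integral_le_lintegral_enorm _) hq0.le
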